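/- The $abc$ Conjecture is the assertion that for every real $\varepsilon>0$ there is a constant $K_\varepsilon>0$ such that $c\le K_\varepsilon\,\mathrm{rad}(abc)^{1+\varepsilon}$ for all coprime positive integers $a,b$ with $c=a+b$, where $\mathrm{rad}(k)$ is the product of the distinct primes dividing $k$. For a prime $p$, let $v_p$ denote the $p$-adic valuation on $\mathbb{Z}$. Lemma. (1) Assume the $abc$ Conjecture. Then for every irreducible polynomial $g\in\mathbb{Z}[x]$ of degree at least $2$, $$n=O\bigl(\#\{p\ge n \text{ prime} : v_p(g(m))=1\text{ for some integer } m \text{ with } 1\le m\le n\}\bigr)\qquad (n\to\infty),$$ that is, there are constants $C,n_0$ depending only on $g$ such that for all integers $n\ge n_0$ the integer $n$ is at most $C$ times the number of such primes. (2) For every irreducible $g\in\mathbb{Z}[x]$ of degree $2$ or $3$, the same conclusion holds unconditionally (without assuming the $abc$ Conjecture). -/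

import Mathlib

open Polynomial Asymptotics Filter

/-- The `abc` Conjecture (over `ℚ`): for every `ε > 0` there is a constant `K > 0` such that
`c ≤ K * rad (a * b * c) ^ (1 + ε)` for all coprime positive integers `a`, `b` with `a + b = c`. -/
def ABCConjecture : Prop :=
  ∀ ε : ℝ, 0 < ε → ∃ K : ℝ, 0 < K ∧ ∀ a b c : ℕ, 0 < a → 0 < b → Nat.Coprime a b → a + b = c →
    (c : ℝ) ≤ K * ((UniqueFactorizationMonoid.radical (a * b * c) : ℕ) : ℝ) ^ (1 + ε)

/-- The set of primes `p ≥ n` such that `v_p (g m) = 1` for some integer `m` with `1 ≤ m ≤ n`. -/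
def simplePrimeDivisors (g : ℤ[X]) (n : ℕ) : Set ℕ :=
  {p : ℕ | p.Prime ∧ n ≤ p ∧ ∃ m : ℕ, 1 ≤ m ∧ m ≤ n ∧ padicValInt p (g.eval (m : ℤ)) = 1}

theorem simplePrimeDivisors_finite (g : ℤ[X]) (n : ℕ) : (simplePrimeDivisors g n).Finite := by
  refine Set.Finite.subset
    ((Finset.Icc 1 n).biUnion fun m => (g.eval (m : ℤ)).natAbs.primeFactors).finite_toSet ?_
  rintro p ⟨hp, -, m, h1, hm, hv⟩
  have h0 : padicValNat p (g.eval (m : ℤ)).natAbs ≠ 0 := by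
    rw [padicValInt] at hv
    omega
  simp only [Finset.coe_biUnion, Set.mem_iUnion]
  refine ⟨m, by simp [h1, hm], ?_⟩
  simp only [Finset.mem_coe, Nat.mem_primeFactors]
  refine ⟨hp, dvd_of_one_le_padicValNat (Nat.one_le_iff_ne_zero.mpr h0), ?_⟩
  intro hz
  simp [hz] at h0

/-! The proof is Chebyshev's method applied to the product of the values `g m`, `m ≤ n`. Put `d =
deg g`. The sum of `log |g m|` over `m ≤ n` is at least `d n log n - O(n)`. Primes `p ≤ n` account
for at most `(1 + o(1)) n log n` of it (`sum_small_primes_le`): on average a prime has at most one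
root of `g`, which is the upper half of Mertens' theorem for prime ideals of `ℚ[X]/(g)`. So primes
`p > n` carry about `(d - 1) n log n`. If those occurring with exponent at least two carry at most
`(d - 1 - δ) n log n`, then primes of exponent one carry a positive multiple of `n log n`. Each of
these has `log p = O(log n)` and divides at most `d` of the values, so there are at least a constant
times `n` of them (`isBigO_simplePrimeDivisors_of_nonsimpleWeight`). It remains to bound the weight
of the repeated large primes.

In degrees two and three it is enough that `p ^ 2 ∣ g m` with `p > n` happens for only `o(n)` values
of `m` (`eventually_ncard_square_le`). Primes between `n` and `K n` are too few to matter. For `p ≥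
K n` a quadratic is too small, while a cubic forces `g m = q p ^ 2` with `q` a small fraction of
`n`. For each root of `g` modulo `q` this makes a rescaled cubic a square; a sieve over residue
classes bounds the number of such `m`, and the linear bound for the number of roots modulo `q`,
summed over `q`, adds up the results (`exists_card_large_square_le`).

In degree at least four `abc` enters through a Belyi polynomial `F` sending the roots of `g` and its
own critical points to `{0, 1}`. The squarefree part of `F (F - 1)` has degree `deg F + 1` and is a
multiple `g H` of `g`. Applying `abc` to `F + (1 - F) = 1` at `m`, cleared of denominators, and
bounding `H m` trivially leaves `log |g m| - log rad (g m) ≤ (1 + η) log m + O(1)`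
(`ABCConjecture.log_sub_log_radical_le`). Repeated primes weigh at most twice this defect, roughly
`2 log m`, which is below `(d - 1) log n` by a fixed margin once `d ≥ 4`. -/

/-- The number of residue classes modulo `q` that are roots of `g` modulo `q`. -/
def rootCount (g : ℤ[X]) (q : ℕ) : ℕ :=
  ((Finset.range q).filter fun b : ℕ => (q : ℤ) ∣ g.eval (b : ℤ)).card

/-! ### An order `ℤ[α]` in the number field of `g`. -/

section NumberFieldModel

open NumberField

theorem exists_int_multiple_aeval {K : Type*} [Field K] [Algebra ℚ K] {θ : K} (P : ℚ[X]) {c : ℤ}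
    (hc : c ≠ 0) :
    ∃ N : ℤ, N ≠ 0 ∧ ∃ Q : ℤ[X], (N : K) * aeval θ P = aeval ((c : K) * θ) Q := by
  have : CharZero K := algebraRat.charZero K
  induction P using Polynomial.induction_on' with
  | add p q hp hq =>
    obtain ⟨N, hN, Q, hQ⟩ := hp
    obtain ⟨N', hN', Q', hQ'⟩ := hq
    refine ⟨N * N', mul_ne_zero hN hN', C N' * Q + C N * Q', ?_⟩
    simp only [map_add, map_mul, aeval_C, ← hQ, ← hQ']
    simp
    ring
  | monomial n a =>
    refine ⟨c ^ n * a.den, mul_ne_zero (pow_ne_zero _ hc) (by simp), C a.num * X ^ n, ?_⟩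
    simp only [aeval_monomial, map_mul, aeval_C, map_pow, aeval_X]
    have h : (a.den : K) * algebraMap ℚ K a = a.num := by
      rw [← map_natCast (algebraMap ℚ K), ← map_mul, Rat.den_mul_eq_num, map_intCast]
    simp only [algebraMap_int_eq, eq_intCast]
    rw [← h]
    push_cast
    ring

/-- Multiplying the root `θ` by the leading coefficient `c` makes it integral; `D` is the product of
the denominators of an integral basis with respect to `α = c θ`. If `P(α) = 0`, then `P(c X)`
vanishes at `θ`, so `g` divides it over `ℤ`. -/
theorem exists_numberField_model_of_root {g : ℤ[X]} (hg : g ≠ 0) {K : Type} [Field K]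
    [NumberField K] {θ : K} (hθ : g.eval₂ (Int.castRingHom K) θ = 0)
    (hmin : ∀ P : ℤ[X], P.eval₂ (Int.castRingHom K) θ = 0 → g ∣ P)
    (hgen : ∀ z : K, ∃ P : ℚ[X], z = aeval θ P) :
    ∃ (α : 𝓞 K) (c D : ℤ), c ≠ 0 ∧ D ≠ 0 ∧
      (∀ z : 𝓞 K, ∃ P : ℤ[X], (D : 𝓞 K) * z = aeval α P) ∧
      (∀ P : ℤ[X], aeval α P = 0 → ∀ b : ℤ, g.eval b ∣ P.eval (c * b)) := by
  let c := g.leadingCoeff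
  have hc : c ≠ 0 := leadingCoeff_ne_zero.2 hg
  have hint : IsIntegral ℤ ((c : K) * θ) := by
    have := isIntegral_leadingCoeff_smul g θ (by simpa [aeval_def] using hθ)
    rwa [zsmul_eq_mul] at this
  let α : 𝓞 K := ⟨(c : K) * θ, hint⟩
  have hα : ∀ P : ℤ[X], algebraMap (𝓞 K) K (aeval α P) = aeval ((c : K) * θ) P := by
    intro P
    rw [← aeval_algebraMap_apply]
    rfl
  have hinj : Function.Injective (algebraMap (𝓞 K) K) := RingOfIntegers.coe_injective
  have hz : ∀ z : 𝓞 K, ∃ N : ℤ, N ≠ 0 ∧ ∃ Q : ℤ[X], (N : 𝓞 K) * z = aeval α Q := by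
    intro z
    obtain ⟨P, hP⟩ := hgen z
    obtain ⟨N, hN, Q, hQ⟩ := exists_int_multiple_aeval (θ := θ) P hc
    refine ⟨N, hN, Q, hinj ?_⟩
    rw [hα, ← hQ, map_mul, ← hP]
    simp
  choose N hN Q hQ using fun i => hz (RingOfIntegers.basis K i)
  refine ⟨α, c, ∏ i, N i, hc, Finset.prod_ne_zero_iff.2 fun i _ => hN i, ?_, ?_⟩
  · intro z
    let B := RingOfIntegers.basis K
    refine ⟨∑ i, C (B.repr z i * ∏ j ∈ Finset.univ.erase i, N j) * Q i, ?_⟩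
    conv_lhs => rw [← B.sum_repr z, Finset.mul_sum]
    rw [map_sum]
    refine Finset.sum_congr rfl fun i _ => ?_
    rw [map_mul, aeval_C, ← hQ i, ← Finset.mul_prod_erase _ _ (Finset.mem_univ i)]
    simp only [algebraMap_int_eq, eq_intCast, zsmul_eq_mul, B]
    push_cast
    ring
  · intro P hP b
    have h1 : aeval θ (P.comp (C c * X)) = 0 := by
      rw [aeval_comp]
      simpa [hP] using (hα P).symm
    have := eval_dvd (x := b) (hmin _ h1)
    rwa [eval_comp, eval_mul, eval_C, eval_X] at this

theorem exists_numberField_model {g : ℤ[X]} (hg : Irreducible g) (hd : g.natDegree ≠ 0) :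
    ∃ (K : Type) (_ : Field K) (_ : NumberField K) (α : 𝓞 K) (c D : ℤ), c ≠ 0 ∧ D ≠ 0 ∧
      (∀ z : 𝓞 K, ∃ P : ℤ[X], (D : 𝓞 K) * z = aeval α P) ∧
      (∀ P : ℤ[X], aeval α P = 0 → ∀ b : ℤ, g.eval b ∣ P.eval (c * b)) := by
  have hprim : g.IsPrimitive := hg.isPrimitive hd
  have hirr : Irreducible (g.map (Int.castRingHom ℚ)) :=
    (IsPrimitive.Int.irreducible_iff_irreducible_map_cast hprim).1 hg
  have : Fact (Irreducible (g.map (Int.castRingHom ℚ))) := ⟨hirr⟩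
  let K := AdjoinRoot (g.map (Int.castRingHom ℚ))
  have : CharZero K := algebraRat.charZero K
  have : FiniteDimensional ℚ K := (AdjoinRoot.powerBasis hirr.ne_zero).finite
  -- The `ℚ`-algebra structure of `AdjoinRoot` has to be identified with the one every division ring
  -- of characteristic zero carries.
  have hf : @Module.Finite ℚ K _ _ (DivisionRing.toRatAlgebra).toModule := by
    convert! this
  have : NumberField K := { to_charZero := inferInstance, to_finiteDimensional := hf }
  let θ : K := AdjoinRoot.root _
  have key : ∀ P : ℤ[X], P.eval₂ (Int.castRingHom K) θ =
      AdjoinRoot.mk _ (P.map (Int.castRingHom ℚ)) := by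
    intro P
    rw [← AdjoinRoot.aeval_eq, aeval_def, eval₂_map]
    congr 1
  refine ⟨K, inferInstance, inferInstance, exists_numberField_model_of_root hg.ne_zero (θ := θ)
    ?_ ?_ ?_⟩
  · rw [key, AdjoinRoot.mk_self]
  · intro P hP
    rwa [IsPrimitive.Int.dvd_iff_map_cast_dvd_map_cast _ _ hprim, ← AdjoinRoot.mk_eq_zero, ← key]
  · intro z
    obtain ⟨P, rfl⟩ := AdjoinRoot.mk_surjective z
    refine ⟨P, ?_⟩
    rw [← AdjoinRoot.aeval_eq, aeval_def, aeval_def]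
    congr 1

variable {K : Type*} [Field K]

/-- The ideal of `𝓞 K` attached to the root `b` modulo `q`. -/
def rootIdeal (α : 𝓞 K) (c : ℤ) (q : ℕ) (b : ℤ) : Ideal (𝓞 K) :=
  Ideal.span {(q : 𝓞 K), α - (c * b : ℤ)}

theorem natCast_mem_rootIdeal (α : 𝓞 K) (c : ℤ) (q : ℕ) (b : ℤ) :
    (q : 𝓞 K) ∈ rootIdeal α c q b := Ideal.subset_span (by simp)

theorem sub_mem_rootIdeal (α : 𝓞 K) (c : ℤ) (q : ℕ) (b : ℤ) :
    α - (c * b : ℤ) ∈ rootIdeal α c q b := Ideal.subset_span (by simp)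

theorem aeval_sub_mem_rootIdeal (α : 𝓞 K) (c : ℤ) (q : ℕ) (b : ℤ) (P : ℤ[X]) :
    aeval α P - (P.eval (c * b) : ℤ) ∈ rootIdeal α c q b := by
  have h := sub_dvd_eval_sub α ((c * b : ℤ) : 𝓞 K) (P.map (Int.castRingHom (𝓞 K)))
  rw [eval_intCast_map, eval_map] at h
  exact Ideal.mem_of_dvd _ h (sub_mem_rootIdeal α c q b)

end NumberFieldModel

/-! ### Norms and coincidences of the ideals attached to roots modulo `q`. -/

section RootIdeal
open NumberField

variable {K : Type*} [Field K]

theorem dvd_of_intCast_mem_rootIdeal {g : ℤ[X]} {α : 𝓞 K} {c D : ℤ}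
    (hD : ∀ z : 𝓞 K, ∃ P : ℤ[X], (D : 𝓞 K) * z = aeval α P)
    (hα : ∀ P : ℤ[X], aeval α P = 0 → ∀ b : ℤ, g.eval b ∣ P.eval (c * b)) {q : ℕ} {b : ℤ}
    (hq : (q : ℤ) ∣ g.eval b) {n : ℤ} (hn : (n : 𝓞 K) ∈ rootIdeal α c q b) : (q : ℤ) ∣ D * n := by
  obtain ⟨z, w, h⟩ := Ideal.mem_span_pair.1 hn
  obtain ⟨P, hP⟩ := hD z
  obtain ⟨Q, hQ⟩ := hD w
  -- The membership relation, multiplied by `D`, becomes a polynomial relation at `α`; at `c b` the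
  -- polynomial takes the value `D n - q P(c b)`, which must be a multiple of `g b`, hence of `q`.
  have h0 : aeval α (C (D * n) - P * C (q : ℤ) - Q * (X - C (c * b))) = 0 := by
    simp only [map_sub, map_mul, aeval_C, aeval_X, ← hP, ← hQ]
    simp only [algebraMap_int_eq, eq_intCast, ← h]
    push_cast
    ring
  have h1 := hq.trans (hα _ h0 b)
  simp only [eval_sub, eval_mul, eval_C, eval_X, sub_self, mul_zero, sub_zero] at h1
  exact (Int.dvd_iff_dvd_of_dvd_sub h1).2 (Dvd.intro_left _ rfl)

theorem exists_intCast_sub_mem_rootIdeal {α : 𝓞 K} {D : ℤ}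
    (hD : ∀ z : 𝓞 K, ∃ P : ℤ[X], (D : 𝓞 K) * z = aeval α P) (c : ℤ) (q : ℕ) (b : ℤ) (z : 𝓞 K) :
    ∃ n : ℤ, (D : 𝓞 K) * z - n ∈ rootIdeal α c q b := by
  obtain ⟨P, hP⟩ := hD z
  exact ⟨_, hP ▸ aeval_sub_mem_rootIdeal α c q b P⟩

theorem exists_lt_intCast_sub_mem_rootIdeal (α : 𝓞 K) (c : ℤ) {q : ℕ} (hq : q ≠ 0) (b n : ℤ) :
    ∃ i : Fin q, (n : 𝓞 K) - (i : ℕ) ∈ rootIdeal α c q b := by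
  have h0 : (0 : ℤ) < q := by omega
  have h1 := Int.emod_nonneg n h0.ne'
  have h2 := Int.emod_lt_of_pos n h0
  refine ⟨⟨(n % q).toNat, by omega⟩, ?_⟩
  have : (n : 𝓞 K) - ((n % q).toNat : ℕ) = ((n / q : ℤ) : 𝓞 K) * (q : 𝓞 K) := by
    have h3 : (((n % q).toNat : ℤ)) = n - q * (n / q) := by
      rw [Int.toNat_of_nonneg h1, Int.emod_def]
    have h4 : (((n % q).toNat : ℕ) : 𝓞 K) = ((n - q * (n / q) : ℤ) : 𝓞 K) := by
      rw [← h3, Int.cast_natCast]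
    rw [h4]; push_cast; ring
  rw [this]
  exact Ideal.mul_mem_left _ _ (natCast_mem_rootIdeal α c q b)

/-- The ideal remembers `q` and `b` up to factors dividing `D` and `D c`, so `(q, b) ↦ rootIdeal α c
q b` has bounded fibres and is injective over primes not dividing `D c`. -/
theorem rootIdeal_congr {g : ℤ[X]} {α : 𝓞 K} {c D : ℤ}
    (hD : ∀ z : 𝓞 K, ∃ P : ℤ[X], (D : 𝓞 K) * z = aeval α P)
    (hα : ∀ P : ℤ[X], aeval α P = 0 → ∀ b : ℤ, g.eval b ∣ P.eval (c * b)) {q q' : ℕ} {b b' : ℤ}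
    (hq : (q : ℤ) ∣ g.eval b) (h : rootIdeal α c q b = rootIdeal α c q' b') :
    (q : ℤ) ∣ D * q' ∧ (q : ℤ) ∣ D * (c * (b - b')) := by
  constructor
  · refine dvd_of_intCast_mem_rootIdeal hD hα hq ?_
    rw [h]
    simpa using natCast_mem_rootIdeal α c q' b'
  · refine dvd_of_intCast_mem_rootIdeal hD hα hq ?_
    have h1 := sub_mem_rootIdeal α c q b
    have h2 := sub_mem_rootIdeal α c q' b'
    rw [← h] at h2
    have := (rootIdeal α c q b).sub_mem h2 h1
    convert this using 1
    push_cast; ring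

variable [NumberField K]

theorem absNorm_rootIdeal_ne_zero (α : 𝓞 K) (c : ℤ) {q : ℕ} (hq : q ≠ 0) (b : ℤ) :
    Ideal.absNorm (rootIdeal α c q b) ≠ 0 := by
  rw [Ne, Ideal.absNorm_eq_zero_iff]
  intro h
  have := natCast_mem_rootIdeal α c q b
  rw [h, Ideal.mem_bot] at this
  exact hq (by exact_mod_cast this)

/-- Modulo the ideal, `D w` is congruent to an integer for every `w`. Hence representatives of `𝓞 K`
modulo `D`, shifted by `0, …, q - 1`, exhaust the quotient. -/
theorem absNorm_rootIdeal_le {α : 𝓞 K} {D : ℤ} (hD0 : D ≠ 0)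
    (hD : ∀ z : 𝓞 K, ∃ P : ℤ[X], (D : 𝓞 K) * z = aeval α P) (c : ℤ) {q : ℕ} (hq : q ≠ 0) (b : ℤ) :
    Ideal.absNorm (rootIdeal α c q b) ≤ q * Ideal.absNorm (Ideal.span {(D : 𝓞 K)}) := by
  set J := rootIdeal α c q b
  set E := Ideal.span {(D : 𝓞 K)}
  have hE : Ideal.absNorm E ≠ 0 := by
    rw [Ne, Ideal.absNorm_eq_zero_iff, Ideal.span_singleton_eq_bot]
    exact_mod_cast hD0
  have : Finite (𝓞 K ⧸ E) := (Ideal.absNorm_ne_zero_iff E).1 hE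
  rw [Ideal.absNorm_apply, Ideal.absNorm_apply, Submodule.cardQuot_apply,
    Submodule.cardQuot_apply]
  let f : Fin q × (𝓞 K ⧸ E) → 𝓞 K ⧸ J := fun x => Ideal.Quotient.mk J ((x.1 : ℕ) + x.2.out)
  have hf : Function.Surjective f := by
    intro y
    obtain ⟨z, rfl⟩ := Ideal.Quotient.mk_surjective y
    set e : 𝓞 K ⧸ E := Ideal.Quotient.mk E z
    have h1 : Ideal.Quotient.mk E e.out = Ideal.Quotient.mk E z := by
      exact Quotient.out_eq e
    rw [eq_comm, Ideal.Quotient.eq, Ideal.mem_span_singleton] at h1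
    obtain ⟨w, hw⟩ := h1
    obtain ⟨n, hn⟩ := exists_intCast_sub_mem_rootIdeal hD c q b w
    obtain ⟨i, hi⟩ := exists_lt_intCast_sub_mem_rootIdeal α c hq b n
    refine ⟨(i, e), ?_⟩
    simp only [f]
    rw [eq_comm, Ideal.Quotient.eq]
    have : z - ((i : ℕ) + e.out) = ((D : 𝓞 K) * w - n) + (n - (i : ℕ)) := by
      rw [← hw]; ring
    rw [this]
    exact J.add_mem hn hi
  have := Nat.card_le_card_of_surjective f hf
  simpa [Nat.card_prod] using this

/-- Since `D` is invertible modulo `p`, the integers alone exhaust the quotient, so the norm is at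
most `p`. It is also a power of `p`, and it is not `1` because `p ∤ D`. -/
theorem absNorm_rootIdeal_of_prime {g : ℤ[X]} {α : 𝓞 K} {c D : ℤ}
    (hD : ∀ z : 𝓞 K, ∃ P : ℤ[X], (D : 𝓞 K) * z = aeval α P)
    (hα : ∀ P : ℤ[X], aeval α P = 0 → ∀ b : ℤ, g.eval b ∣ P.eval (c * b)) {p : ℕ} (hp : p.Prime)
    (hpD : ¬ (p : ℤ) ∣ D) {b : ℤ} (hq : (p : ℤ) ∣ g.eval b) :
    Ideal.absNorm (rootIdeal α c p b) = p := by
  set J := rootIdeal α c p b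
  have hle : Ideal.absNorm J ≤ p := by
    rw [Ideal.absNorm_apply, Submodule.cardQuot_apply]
    let f : Fin p → 𝓞 K ⧸ J := fun x => Ideal.Quotient.mk J (x : ℕ)
    have hf : Function.Surjective f := by
      intro y
      obtain ⟨z, rfl⟩ := Ideal.Quotient.mk_surjective y
      have hcop : IsCoprime (p : ℤ) D :=
        ((Nat.prime_iff_prime_int.1 hp).irreducible.coprime_iff_not_dvd).2 hpD
      obtain ⟨u, v, huv⟩ := hcop
      obtain ⟨n, hn⟩ := exists_intCast_sub_mem_rootIdeal hD c p b z
      obtain ⟨i, hi⟩ := exists_lt_intCast_sub_mem_rootIdeal α c hp.ne_zero b (v * n)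
      refine ⟨i, ?_⟩
      simp only [f]
      rw [eq_comm, Ideal.Quotient.eq]
      have h1 : (u : 𝓞 K) * p + v * D = 1 := by exact_mod_cast congrArg (Int.cast : ℤ → 𝓞 K) huv
      have : z - (i : ℕ) = ((u : 𝓞 K) * z) * p + v * ((D : 𝓞 K) * z - n)
          + (((v * n : ℤ) : 𝓞 K) - (i : ℕ)) := by
        push_cast
        linear_combination -z * h1
      rw [this]
      exact J.add_mem (J.add_mem (J.mul_mem_left _ (natCast_mem_rootIdeal α c p b))
        (J.mul_mem_left _ hn)) hi
    simpa using Nat.card_le_card_of_surjective f hf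
  have hdvd : Ideal.absNorm J ∣ p ^ Module.finrank ℤ (𝓞 K) := by
    rw [← Ideal.absNorm_span_natCast]
    exact Ideal.absNorm_dvd_absNorm_of_le
      ((Ideal.span_singleton_le_iff_mem _).2 (natCast_mem_rootIdeal α c p b))
  have hne : Ideal.absNorm J ≠ 1 := by
    rw [Ne, Ideal.absNorm_eq_one_iff, Ideal.eq_top_iff_one]
    intro h
    have := dvd_of_intCast_mem_rootIdeal (n := 1) hD hα hq (by simpa using h)
    exact hpD (by simpa using this)
  obtain ⟨k, -, hk⟩ := (Nat.dvd_prime_pow hp).1 hdvd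
  rw [hk] at hle hne ⊢
  have hk0 : k ≠ 0 := by rintro rfl; simp at hne
  have : k ≤ 1 := (Nat.pow_le_pow_iff_right hp.one_lt).1 (by simpa using hle)
  rw [show k = 1 by omega, pow_one]

end RootIdeal

/-! ### Counting ideals, and the upper half of Mertens' theorem. -/

section IdealCount
open NumberField

variable (K : Type*) [Field K] [NumberField K]

theorem finite_nonzero_ideals_absNorm_le (s : ℝ) :
    {I : Ideal (𝓞 K) | I ≠ ⊥ ∧ (Ideal.absNorm I : ℝ) ≤ s}.Finite := by
  refine (Ideal.finite_setOfPred_absNorm_le (S := 𝓞 K) ⌊s⌋₊).subset ?_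
  rintro I ⟨-, h⟩
  exact Nat.le_floor h

/-- The nonzero ideals of norm at most `s`. -/
noncomputable def idealsLE (s : ℝ) : Finset (Ideal (𝓞 K)) :=
  (finite_nonzero_ideals_absNorm_le K s).toFinset

variable {K}

theorem mem_idealsLE {s : ℝ} {I : Ideal (𝓞 K)} :
    I ∈ idealsLE K s ↔ I ≠ ⊥ ∧ (Ideal.absNorm I : ℝ) ≤ s := by
  simp [idealsLE]

variable (K)

theorem exists_tendsto_card_idealsLE :
    ∃ κ : ℝ, 0 < κ ∧ Tendsto (fun s : ℝ => ((idealsLE K s).card : ℝ) / s) atTop (nhds κ) := by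
  refine ⟨_, NumberField.dedekindZeta_residue_pos K, ?_⟩
  refine (NumberField.Ideal.tendsto_norm_le_div_atTop₀ K).congr fun s => ?_
  congr 2
  rw [← Nat.card_eq_finsetCard]
  refine Nat.card_congr ((Equiv.subtypeSubtypeEquivSubtypeInter
    (fun I : Ideal (𝓞 K) => I ∈ nonZeroDivisors _) (fun I => (Ideal.absNorm I : ℝ) ≤ s)).trans
    (Equiv.subtypeEquivRight fun I => ?_))
  rw [mem_idealsLE, mem_nonZeroDivisors_iff_ne_zero]
  rfl

theorem exists_card_idealsLE_le :
    ∃ C : ℝ, 0 < C ∧ ∀ s : ℝ, 1 ≤ s → ((idealsLE K s).card : ℝ) ≤ C * s := by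
  obtain ⟨κ, hκ, h⟩ := exists_tendsto_card_idealsLE K
  obtain ⟨s0, hs0⟩ := eventually_atTop.1 (h.eventually_le_const (show κ < κ + 1 by linarith))
  refine ⟨κ + 1 + (idealsLE K (max s0 1)).card, by positivity, fun s hs => ?_⟩
  rcases le_total (max s0 1) s with h1 | h1
  · have := hs0 s (le_of_max_le_left h1)
    rw [div_le_iff₀ (by linarith)] at this
    nlinarith [Nat.cast_nonneg (α := ℝ) (idealsLE K (max s0 1)).card]
  · have : (idealsLE K s).card ≤ (idealsLE K (max s0 1)).card := by
      refine Finset.card_le_card fun I hI => ?_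
      rw [mem_idealsLE] at hI ⊢
      exact ⟨hI.1, hI.2.trans h1⟩
    have : ((idealsLE K s).card : ℝ) ≤ (idealsLE K (max s0 1)).card := by exact_mod_cast this
    nlinarith [Nat.cast_nonneg (α := ℝ) (idealsLE K (max s0 1)).card]

variable {K}

open scoped Classical in
theorem sum_log_absNorm_of_dvd_le {I : Ideal (𝓞 K)} (hI : I ≠ ⊥) (T : Finset (Ideal (𝓞 K)))
    (hT : ∀ P ∈ T, Prime P) :
    ∑ P ∈ T with P ∣ I, Real.log (Ideal.absNorm P) ≤ Real.log (Ideal.absNorm I) := by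
  have hdvd : ∏ P ∈ T with P ∣ I, P ∣ I :=
    Finset.prod_primes_dvd I (fun P hP => hT P (Finset.mem_filter.1 hP).1)
      (fun P hP => (Finset.mem_filter.1 hP).2)
  have h0 : Ideal.absNorm I ≠ 0 := by rwa [Ne, Ideal.absNorm_eq_zero_iff]
  have hP0 : ∀ P ∈ T, (Ideal.absNorm P : ℝ) ≠ 0 := by
    intro P hP
    have := (hT P hP).ne_zero
    rw [Ne, Nat.cast_eq_zero, Ideal.absNorm_eq_zero_iff]
    exact this
  rw [← Real.log_prod (fun P hP => hP0 P (Finset.mem_filter.1 hP).1)]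
  have h1 : ∏ P ∈ T with P ∣ I, Ideal.absNorm P ∣ Ideal.absNorm I := by
    rw [← map_prod]
    exact map_dvd Ideal.absNorm hdvd
  refine Real.log_le_log ?_ ?_
  · refine lt_of_le_of_ne (Finset.prod_nonneg fun _ _ => by positivity) (Ne.symm ?_)
    exact Finset.prod_ne_zero_iff.2 fun P hP => hP0 P (Finset.mem_filter.1 hP).1
  · exact_mod_cast Nat.le_of_dvd (Nat.pos_of_ne_zero h0) h1

open scoped Classical in
theorem card_idealsLE_div_le {P : Ideal (𝓞 K)} (hP : P ≠ ⊥) (s : ℝ) :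
    (idealsLE K (s / Ideal.absNorm P)).card ≤ ((idealsLE K s).filter fun I => P ∣ I).card := by
  have hP0 : (0 : ℝ) < Ideal.absNorm P := by
    have : Ideal.absNorm P ≠ 0 := by rwa [Ne, Ideal.absNorm_eq_zero_iff]
    positivity
  refine Finset.card_le_card_of_injOn (fun I => P * I) ?_ ?_
  · intro I hI
    simp only [Finset.mem_coe] at hI
    simp only [Finset.mem_coe]
    rw [mem_idealsLE, le_div_iff₀ hP0] at hI
    rw [Finset.mem_filter, mem_idealsLE]
    refine ⟨⟨mul_ne_zero hP hI.1, ?_⟩, dvd_mul_right _ _⟩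
    rw [map_mul]
    push_cast
    linarith [hI.2]
  · intro I _ J _ h
    exact mul_left_cancel₀ hP h

/-- Chebyshev's double count of pairs `P ∣ I`: the distinct primes dividing `I` have total weight at
most `log N(I)`. -/
theorem sum_log_mul_card_idealsLE_le (T : Finset (Ideal (𝓞 K))) (hT : ∀ P ∈ T, Prime P) (s : ℝ) :
    ∑ P ∈ T, Real.log (Ideal.absNorm P) * (idealsLE K (s / Ideal.absNorm P)).card ≤
      (idealsLE K s).card * Real.log s := by
  classical
  calc _ ≤ ∑ P ∈ T, ∑ I ∈ idealsLE K s with P ∣ I, Real.log (Ideal.absNorm P) := by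
        refine Finset.sum_le_sum fun P hP => ?_
        rw [Finset.sum_const, nsmul_eq_mul, mul_comm]
        refine mul_le_mul_of_nonneg_right ?_ (Real.log_natCast_nonneg _)
        exact_mod_cast card_idealsLE_div_le (hT P hP).ne_zero s
    _ = ∑ I ∈ idealsLE K s, ∑ P ∈ T with P ∣ I, Real.log (Ideal.absNorm P) := by
        simp only [Finset.sum_filter]
        exact Finset.sum_comm
    _ ≤ ∑ I ∈ idealsLE K s, Real.log s := by
        refine Finset.sum_le_sum fun I hI => ?_
        rw [mem_idealsLE] at hI
        refine (sum_log_absNorm_of_dvd_le hI.1 T hT).trans (Real.log_le_log ?_ hI.2)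
        have : Ideal.absNorm I ≠ 0 := by rw [Ne, Ideal.absNorm_eq_zero_iff]; exact hI.1
        positivity
    _ = _ := by simp

variable (K)

theorem mertens_prime_ideals {ε : ℝ} (hε : 0 < ε) :
    ∀ᶠ N : ℝ in atTop, ∀ T : Finset (Ideal (𝓞 K)),
      (∀ P ∈ T, Prime P ∧ (Ideal.absNorm P : ℝ) ≤ N) →
      ∑ P ∈ T, Real.log (Ideal.absNorm P) / Ideal.absNorm P ≤ (1 + ε) * Real.log N := by
  obtain ⟨κ, hκ, h⟩ := exists_tendsto_card_idealsLE K
  -- Chosen so that `(κ + η) / (κ - η)` is exactly `1 + ε / 2`.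
  set η : ℝ := κ * (ε / (4 + ε)) with hη
  have hη0 : 0 < η := by positivity
  have hηκ : η < κ := by
    rw [hη]
    have : ε / (4 + ε) < 1 := by rw [div_lt_one (by positivity)]; linarith
    nlinarith
  have hratio : (κ + η) = (1 + ε / 2) * (κ - η) := by
    rw [hη]; field_simp; ring
  obtain ⟨s0, hs0⟩ := eventually_atTop.1 ((h.eventually_le_const (show κ < κ + η by linarith)).and
    (h.eventually_const_le (show κ - η < κ by linarith)))
  -- The double count is run up to `N * y` rather than `N`, so that `N * y / N(P) ≥ y` for every `P`
  -- in play and the ideal asymptotics apply to each term. The cost, `log y`, is bounded.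
  set y := max s0 1
  have hy1 : 1 ≤ y := le_max_right _ _
  have hlog : ∀ᶠ N : ℝ in atTop, Real.log y * (1 + ε / 2) * (2 / ε) ≤ Real.log N :=
    Real.tendsto_log_atTop.eventually_ge_atTop _
  filter_upwards [hlog, eventually_ge_atTop 1] with N hN hN1 T hT
  have hpos : ∀ P ∈ T, (0 : ℝ) < Ideal.absNorm P := by
    intro P hP
    have : Ideal.absNorm P ≠ 0 := by rw [Ne, Ideal.absNorm_eq_zero_iff]; exact (hT P hP).1.ne_zero
    positivity
  have hx : y ≤ N * y := by nlinarith
  have hx0 : 0 < N * y := by linarith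
  have h1 := sum_log_mul_card_idealsLE_le T (fun P hP => (hT P hP).1) (N * y)
  have h2 : ((idealsLE K (N * y)).card : ℝ) ≤ (κ + η) * (N * y) := by
    have := (hs0 (N * y) ((le_max_left _ _).trans hx)).1
    rwa [div_le_iff₀ hx0] at this
  have h3 : ∑ P ∈ T, Real.log (Ideal.absNorm P) * ((κ - η) * (N * y / Ideal.absNorm P)) ≤
      ∑ P ∈ T, Real.log (Ideal.absNorm P) * (idealsLE K (N * y / Ideal.absNorm P)).card := by
    refine Finset.sum_le_sum fun P hP => mul_le_mul_of_nonneg_left ?_ (Real.log_natCast_nonneg _)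
    have h4 : y ≤ N * y / Ideal.absNorm P := by
      rw [le_div_iff₀ (hpos P hP)]
      nlinarith [(hT P hP).2]
    have := (hs0 _ ((le_max_left _ _).trans h4)).2
    rwa [le_div_iff₀ (by linarith)] at this
  have h5 : ∑ P ∈ T, Real.log (Ideal.absNorm P) * ((κ - η) * (N * y / Ideal.absNorm P)) =
      (κ - η) * (N * y) * ∑ P ∈ T, Real.log (Ideal.absNorm P) / Ideal.absNorm P := by
    rw [Finset.mul_sum]
    exact Finset.sum_congr rfl fun P _ => by ring
  have hlx : 0 ≤ Real.log (N * y) := Real.log_nonneg (by linarith)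
  have h6 : (κ - η) * (N * y) * ∑ P ∈ T, Real.log (Ideal.absNorm P) / Ideal.absNorm P ≤
      (κ - η) * (N * y) * ((1 + ε / 2) * Real.log (N * y)) := by
    rw [← h5]
    refine (h3.trans h1).trans ((mul_le_mul_of_nonneg_right h2 hlx).trans_eq ?_)
    rw [hratio]; ring
  have h7 := le_of_mul_le_mul_left h6 (mul_pos (by linarith) hx0)
  rw [Real.log_mul (by linarith) (by linarith)] at h7
  have h8 : Real.log y * (1 + ε / 2) ≤ ε / 2 * Real.log N := by
    have := mul_le_mul_of_nonneg_left hN (show 0 ≤ ε / 2 by positivity)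
    refine le_trans (le_of_eq ?_) this
    field_simp
  linarith

end IdealCount

/-! ### Averages of the number of roots of `g` modulo `q`. -/

section RootCount
open NumberField

theorem rootCount_le_self (g : ℤ[X]) (q : ℕ) : rootCount g q ≤ q :=
  (Finset.card_filter_le _ _).trans (by simp)

/-- The sum of `rootCount g q` over `q ≤ Q` grows at most linearly in `Q`. -/
theorem exists_sum_rootCount_le {g : ℤ[X]} (hg : Irreducible g) (hd : g.natDegree ≠ 0) :
    ∃ C : ℝ, 0 < C ∧ ∀ Q : ℕ, 1 ≤ Q → ((∑ q ∈ Finset.Icc 1 Q, rootCount g q : ℕ) : ℝ) ≤ C * Q := by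
  classical
  obtain ⟨K, _, _, α, c, D, hc, hD0, hD, hα⟩ := exists_numberField_model hg hd
  obtain ⟨C, hC, hCle⟩ := exists_card_idealsLE_le K
  set E := Ideal.absNorm (Ideal.span {(D : 𝓞 K)}) with hE
  have hE0 : E ≠ 0 := by
    rw [Ne, Ideal.absNorm_eq_zero_iff, Ideal.span_singleton_eq_bot]
    exact_mod_cast hD0
  set A : ℤ := D ^ 2 * |c| with hA
  set F : ℕ := ((Finset.range (D.natAbs * D.natAbs + 1)) ×ˢ (Finset.Icc (-A) A)).card with hF
  have hF0 : 0 < F := by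
    rw [hF, Finset.card_pos]
    exact ⟨(0, 0), by simp [hA]; positivity⟩
  refine ⟨F * (C * E), by positivity, fun Q hQ => ?_⟩
  let S : Finset ((_ : ℕ) × ℕ) :=
    (Finset.Icc 1 Q).sigma fun q => (Finset.range q).filter fun b : ℕ => (q : ℤ) ∣ g.eval (b : ℤ)
  have hS : S.card = ∑ q ∈ Finset.Icc 1 Q, rootCount g q := Finset.card_sigma _ _
  have hmem : ∀ x ∈ S, x.1 ≠ 0 ∧ x.1 ≤ Q ∧ x.2 < x.1 ∧ (x.1 : ℤ) ∣ g.eval (x.2 : ℤ) := by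
    intro x hx
    simp only [S, Finset.mem_sigma, Finset.mem_Icc, Finset.mem_filter, Finset.mem_range] at hx
    exact ⟨by omega, hx.1.2, hx.2.1, hx.2.2⟩
  have hmain : S.card ≤ F * (idealsLE K (Q * E : ℕ)).card := by
    refine Finset.card_le_mul_card_image_of_maps_to
      (f := fun x : (_ : ℕ) × ℕ => rootIdeal α c x.1 (x.2 : ℤ)) ?_ _ ?_
    · intro x hx
      obtain ⟨h0, h1, h2, h3⟩ := hmem x hx
      rw [mem_idealsLE]
      have hne := absNorm_rootIdeal_ne_zero α c h0 x.2
      refine ⟨fun h => hne (by rw [h, Ideal.absNorm_bot]), ?_⟩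
      have := absNorm_rootIdeal_le hD0 hD c h0 x.2
      exact_mod_cast this.trans (Nat.mul_le_mul_right _ h1)
    · intro J _
      rcases (S.filter fun x => rootIdeal α c x.1 (x.2 : ℤ) = J).eq_empty_or_nonempty with he | he
      · rw [he]; simp
      obtain ⟨x0, hx0⟩ := he
      rw [Finset.mem_filter] at hx0
      obtain ⟨h0, h1, h2, h3⟩ := hmem x0 hx0.1
      -- Within a fibre, each of `x.1` and `x0.1` divides `D` times the other, and `x.1` divides `D
      -- c (x.2 - x0.2)`. The two quotients determine `x` and lie in ranges depending only on `D`
      -- and `c`.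
      refine Finset.card_le_card_of_injOn (fun x : (_ : ℕ) × ℕ =>
        (D.natAbs * x.1 / x0.1, D * (c * ((x.2 : ℤ) - x0.2)) / x.1)) ?_ ?_
      · intro x hx
        simp only [Finset.coe_filter, Set.mem_ofPred_eq] at hx
        obtain ⟨h0', h1', h2', h3'⟩ := hmem x hx.1
        obtain ⟨k1, k2⟩ := rootIdeal_congr hD hα h3' (hx.2.trans hx0.2.symm)
        obtain ⟨k3, k4⟩ := rootIdeal_congr hD hα h3 (hx0.2.trans hx.2.symm)
        have e1 : x.1 ≤ D.natAbs * x0.1 := by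
          have := Int.natAbs_dvd_natAbs.2 k1
          simp only [Int.natAbs_mul, Int.natAbs_natCast] at this
          exact Nat.le_of_dvd (Nat.pos_of_ne_zero (by simp [hD0, h0])) this
        have e2 : x0.1 ≤ D.natAbs * x.1 := by
          have := Int.natAbs_dvd_natAbs.2 k3
          simp only [Int.natAbs_mul, Int.natAbs_natCast] at this
          exact Nat.le_of_dvd (Nat.pos_of_ne_zero (by simp [hD0, h0'])) this
        simp only [Finset.mem_coe, Finset.mem_product, Finset.mem_range, Finset.mem_Icc]
        refine ⟨Nat.lt_succ_of_le (Nat.div_le_of_le_mul ?_), ?_⟩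
        · calc _ ≤ D.natAbs * (D.natAbs * x0.1) := Nat.mul_le_mul_left _ e1
            _ = _ := by ring
        · rw [← abs_le]
          obtain ⟨w, hw⟩ := k2
          have hx1 : (x.1 : ℤ) ≠ 0 := by exact_mod_cast h0'
          rw [hw, Int.mul_ediv_cancel_left _ hx1]
          have hx1' : (0 : ℤ) < x.1 := by positivity
          refine le_of_mul_le_mul_left ?_ hx1'
          rw [← abs_of_pos hx1', ← abs_mul, ← hw, abs_mul, abs_mul, abs_of_pos hx1', hA]
          have e3 : |(x.2 : ℤ) - x0.2| ≤ |D| * x.1 := by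
            have hDa : (D.natAbs : ℤ) = |D| := Int.natCast_natAbs D
            have e2' : (x0.1 : ℤ) ≤ |D| * x.1 := by rw [← hDa]; exact_mod_cast e2
            have : 1 ≤ |D| := Int.one_le_abs hD0
            have : (x.1 : ℤ) ≤ |D| * x.1 := by nlinarith
            rw [abs_le]; constructor <;> omega
          calc |D| * (|c| * |(x.2 : ℤ) - x0.2|) ≤ |D| * (|c| * (|D| * x.1)) := by gcongr
            _ = |D| ^ 2 * |c| * x.1 := by ring
            _ = _ := by rw [sq_abs]; ring
      · intro x hx y hy hxy
        simp only [Finset.coe_filter, Set.mem_ofPred_eq] at hx hy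
        obtain ⟨h0', h1', h2', h3'⟩ := hmem x hx.1
        obtain ⟨h0'', h1'', h2'', h3''⟩ := hmem y hy.1
        simp only [Prod.mk.injEq] at hxy
        have hdx : x0.1 ∣ D.natAbs * x.1 := by
          have := Int.natAbs_dvd_natAbs.2 (rootIdeal_congr hD hα h3 (hx0.2.trans hx.2.symm)).1
          simpa only [Int.natAbs_mul, Int.natAbs_natCast] using this
        have hdy : x0.1 ∣ D.natAbs * y.1 := by
          have := Int.natAbs_dvd_natAbs.2 (rootIdeal_congr hD hα h3 (hx0.2.trans hy.2.symm)).1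
          simpa only [Int.natAbs_mul, Int.natAbs_natCast] using this
        have hq : x.1 = y.1 := by
          have := (Nat.div_left_inj hdx hdy).1 hxy.1
          exact Nat.eq_of_mul_eq_mul_left (Int.natAbs_pos.2 hD0) this
        have hxd := (rootIdeal_congr hD hα h3' (hx.2.trans hx0.2.symm)).2
        have hyd := (rootIdeal_congr hD hα h3'' (hy.2.trans hx0.2.symm)).2
        have h4 := hxy.2
        rw [← hq] at h4 hyd
        have h5 := (Int.ediv_left_inj hxd hyd).1 h4
        have h6 := mul_left_cancel₀ hc (mul_left_cancel₀ hD0 h5)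
        have h7 : x.2 = y.2 := by omega
        exact Sigma.ext hq (heq_of_eq h7)
  rw [← hS]
  have h1 : (1 : ℝ) ≤ (Q * E : ℕ) := by
    exact_mod_cast Nat.one_le_iff_ne_zero.2 (Nat.mul_ne_zero (by omega) hE0)
  calc (S.card : ℝ) ≤ F * (idealsLE K (Q * E : ℕ)).card := by exact_mod_cast hmain
    _ ≤ F * (C * (Q * E : ℕ)) := by gcongr; exact hCle _ h1
    _ = _ := by push_cast; ring

theorem sum_rootCount_log_div_le {g : ℤ[X]} (hg : Irreducible g) (hd : g.natDegree ≠ 0) {ε : ℝ}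
    (hε : 0 < ε) :
    ∀ᶠ N : ℕ in atTop, ∑ p ∈ (Finset.Icc 1 N).filter Nat.Prime,
      rootCount g p * Real.log p / p ≤ (1 + ε) * Real.log N := by
  classical
  obtain ⟨K, _, _, α, c, D, hc, hD0, hD, hα⟩ := exists_numberField_model hg hd
  -- Away from these finitely many primes, roots modulo `p` inject into prime ideals of norm `p`;
  -- the exceptional primes contribute only a constant.
  set A := (D * c).natAbs.primeFactors with hA
  have h1 := (mertens_prime_ideals K (show 0 < ε / 2 by positivity)).natCast_atTop
  have h2 : ∀ᶠ N : ℕ in atTop, (∑ p ∈ A, Real.log p) ≤ ε / 2 * Real.log N :=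
    (Tendsto.const_mul_atTop (by positivity)
      (Real.tendsto_log_atTop.comp tendsto_natCast_atTop_atTop)).eventually_ge_atTop _
  filter_upwards [h1, h2] with N hN1 hN2
  set s := (Finset.Icc 1 N).filter Nat.Prime
  let S : Finset ((_ : ℕ) × ℕ) := (s.filter fun p => p ∉ A).sigma
    fun q => (Finset.range q).filter fun b : ℕ => (q : ℤ) ∣ g.eval (b : ℤ)
  have hmem : ∀ x ∈ S, x.1 ≤ N ∧ x.1.Prime ∧ ¬ (x.1 : ℤ) ∣ D * c ∧ x.2 < x.1 ∧
      (x.1 : ℤ) ∣ g.eval (x.2 : ℤ) := by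
    intro x hx
    simp only [S, s, Finset.mem_sigma, Finset.mem_Icc, Finset.mem_filter, Finset.mem_range] at hx
    refine ⟨hx.1.1.1.2, hx.1.1.2, fun h => hx.1.2 ?_, hx.2.1, hx.2.2⟩
    rw [hA, Nat.mem_primeFactors]
    exact ⟨hx.1.1.2, Int.natCast_dvd.1 h, by simp [hD0, hc]⟩
  let f : ((_ : ℕ) × ℕ) → Ideal (𝓞 K) := fun x => rootIdeal α c x.1 (x.2 : ℤ)
  have hnorm : ∀ x ∈ S, Ideal.absNorm (f x) = x.1 := by
    intro x hx
    obtain ⟨h0, h1, h2, h3, h4⟩ := hmem x hx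
    exact absNorm_rootIdeal_of_prime hD hα h1 (fun h => h2 (Dvd.dvd.mul_right h _)) h4
  have hinj : Set.InjOn f S := by
    intro x hx y hy hxy
    have hq : x.1 = y.1 := by rw [← hnorm x hx, ← hnorm y hy, hxy]
    obtain ⟨h0, h1, h2, h3, h4⟩ := hmem x hx
    obtain ⟨h0', h1', h2', h3', h4'⟩ := hmem y hy
    have h5 := (rootIdeal_congr hD hα h4 hxy).2
    rw [← mul_assoc] at h5
    have h6 := ((Nat.prime_iff_prime_int.1 h1).dvd_or_dvd h5).resolve_left h2
    have h7 : x.2 = y.2 := by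
      have := Int.eq_zero_of_abs_lt_dvd h6 (by rw [abs_lt]; constructor <;> omega)
      omega
    exact Sigma.ext hq (heq_of_eq h7)
  have hT := hN1 (S.image f) (by
    intro P hP
    obtain ⟨x, hx, rfl⟩ := Finset.mem_image.1 hP
    have hn := hnorm x hx
    obtain ⟨h0, h1, h2, h3, h4⟩ := hmem x hx
    refine ⟨?_, by rw [hn]; exact_mod_cast h0⟩
    have hne : f x ≠ ⊥ := by
      intro h
      rw [h, Ideal.absNorm_bot] at hn
      exact h1.ne_zero hn.symm
    rw [Ideal.prime_iff_isPrime hne]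
    exact Ideal.isPrime_of_irreducible_absNorm (by rw [hn]; exact h1))
  rw [Finset.sum_image hinj] at hT
  have hgood : ∑ p ∈ s with p ∉ A, rootCount g p * Real.log p / p =
      ∑ x ∈ S, Real.log (Ideal.absNorm (f x)) / Ideal.absNorm (f x) := by
    trans ∑ x ∈ S, Real.log x.1 / x.1
    · rw [Finset.sum_sigma]
      refine Finset.sum_congr rfl fun p _ => ?_
      simp only [Finset.sum_const, nsmul_eq_mul, rootCount]
      ring
    · exact Finset.sum_congr rfl fun x hx => by rw [hnorm x hx]
  have hbad : ∑ p ∈ s with ¬ p ∉ A, rootCount g p * Real.log p / p ≤ ∑ p ∈ A, Real.log p := by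
    calc _ ≤ ∑ p ∈ s with ¬ p ∉ A, Real.log p := by
          refine Finset.sum_le_sum fun p _ => ?_
          have : (rootCount g p : ℝ) ≤ p := by exact_mod_cast rootCount_le_self g p
          refine div_le_of_le_mul₀ (by positivity) (Real.log_natCast_nonneg _) ?_
          rw [mul_comm (Real.log p)]
          exact mul_le_mul_of_nonneg_right this (Real.log_natCast_nonneg _)
      _ ≤ _ := by
          refine Finset.sum_le_sum_of_subset_of_nonneg ?_ fun p _ _ => Real.log_natCast_nonneg _
          intro p hp
          simpa using (Finset.mem_filter.1 hp).2
  rw [← Finset.sum_filter_add_sum_filter_not s fun p => p ∉ A, hgood]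
  linarith

end RootCount

/-! ### Values of `g` divisible by high powers of a prime. -/

theorem eval_ne_zero_of_irreducible {g : ℤ[X]} (hg : Irreducible g) (hd : 2 ≤ g.natDegree) (a : ℤ) :
    g.eval a ≠ 0 := by
  intro h
  obtain ⟨q, hq⟩ := dvd_iff_isRoot.2 h
  have hdeg := congrArg natDegree hq
  have hq0 : q ≠ 0 := by
    rintro rfl
    exact hg.ne_zero (by simpa using hq)
  rcases hg.isUnit_or_isUnit hq with h1 | h1
  · have := natDegree_eq_zero_of_isUnit h1
    rw [natDegree_X_sub_C] at this
    omega
  · rw [natDegree_mul (X_sub_C_ne_zero a) hq0, natDegree_eq_zero_of_isUnit h1, natDegree_X_sub_C]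
      at hdeg
    omega

theorem exists_natAbs_eval_le (g : ℤ[X]) :
    ∃ C : ℕ, 1 ≤ C ∧ ∀ m n : ℕ, 1 ≤ m → m ≤ n →
      (g.eval (m : ℤ)).natAbs ≤ C * n ^ g.natDegree := by
  refine ⟨1 + ∑ i ∈ Finset.range (g.natDegree + 1), (g.coeff i).natAbs, by omega, ?_⟩
  intro m n hm hmn
  rw [eval_eq_sum_range, add_mul, Finset.sum_mul]
  refine (Int.natAbs_sum_le _ _).trans (le_add_left (Finset.sum_le_sum fun i hi => ?_))
  rw [Int.natAbs_mul, Int.natAbs_pow, Int.natAbs_natCast]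
  refine Nat.mul_le_mul_left _ ((Nat.pow_le_pow_left hmn i).trans
    (Nat.pow_le_pow_right (by omega) ?_))
  have := Finset.mem_range.1 hi
  omega

/-- `R` plays the role of the discriminant: modulo a prime not dividing `R`, all roots of `g` are
simple. -/
theorem exists_bezout_derivative {g : ℤ[X]} (hg : Irreducible g) (hd : g.natDegree ≠ 0) :
    ∃ R : ℤ, R ≠ 0 ∧ ∃ u v : ℤ[X], u * g + v * derivative g = C R := by
  have hprim : g.IsPrimitive := hg.isPrimitive hd
  have hirr : Irreducible (g.map (Int.castRingHom ℚ)) :=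
    (IsPrimitive.Int.irreducible_iff_irreducible_map_cast hprim).1 hg
  obtain ⟨u, v, huv⟩ := hirr.separable
  obtain ⟨a, ha, hu⟩ := IsLocalization.integerNormalization_spec (nonZeroDivisors ℤ) u
  obtain ⟨b, hb, hv⟩ := IsLocalization.integerNormalization_spec (nonZeroDivisors ℤ) v
  have ha0 := nonZeroDivisors.ne_zero ha
  have hb0 := nonZeroDivisors.ne_zero hb
  refine ⟨a * b, mul_ne_zero ha0 hb0,
    C b * IsLocalization.integerNormalization (nonZeroDivisors ℤ) u,
    C a * IsLocalization.integerNormalization (nonZeroDivisors ℤ) v, ?_⟩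
  apply map_injective (Int.castRingHom ℚ) Int.cast_injective
  rw [algebraMap_int_eq] at hu hv
  simp only [Polynomial.map_add, Polynomial.map_mul, hu, hv, map_C, Algebra.smul_def]
  rw [derivative_map] at huv
  have e1 : ∀ z : ℤ, ((z : ℤ) : ℚ[X]) = C (z : ℚ) := fun z => by simp
  simp only [eq_intCast, Int.cast_mul, C_mul, ← e1] at huv ⊢
  linear_combination (a : ℚ[X]) * (b : ℚ[X]) * huv

theorem pow_sub_dvd_of_pow_dvd_mul {p : ℕ} (hp : p.Prime) {k s : ℕ} {x y : ℤ}
    (h : (p : ℤ) ^ k ∣ x * y) (hy : ¬ (p : ℤ) ^ (s + 1) ∣ y) : (p : ℤ) ^ (k - s) ∣ x := by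
  have : Fact p.Prime := ⟨hp⟩
  rcases eq_or_ne x 0 with rfl | hx
  · simp
  have hy0 : y ≠ 0 := by rintro rfl; simp at hy
  rw [padicValInt_dvd_iff] at h hy ⊢
  rw [padicValInt.mul hx hy0] at h
  have := mul_ne_zero hx hy0
  right
  simp only [this, hy0, false_or, not_le] at h hy
  omega

/-- A uniqueness statement of Hensel type. Write `g b - g a = (b - a)(g'(a) + w (b - a))`. If `p ^
(s + 1)` divided the second factor it would divide `g'(a)` and `g a`, hence `R`; so at least `p ^ (k
- s)` falls on `b - a`. -/
theorem pow_dvd_sub_of_dvd_eval {g : ℤ[X]} {R : ℤ} {u v : ℤ[X]}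
    (h : u * g + v * derivative g = C R) {p : ℕ} (hp : p.Prime) {s k : ℕ} (hks : s < k)
    (hR : ¬ (p : ℤ) ^ (s + 1) ∣ R) {a b : ℤ} (ha : (p : ℤ) ^ k ∣ g.eval a)
    (hb : (p : ℤ) ^ k ∣ g.eval b) (hab : (p : ℤ) ^ (s + 1) ∣ b - a) :
    (p : ℤ) ^ (k - s) ∣ b - a := by
  obtain ⟨w, hw⟩ := binomExpansion g a (b - a)
  rw [add_sub_cancel] at hw
  have h1 : (p : ℤ) ^ k ∣ (b - a) * ((derivative g).eval a + w * (b - a)) := by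
    have : (b - a) * ((derivative g).eval a + w * (b - a)) = g.eval b - g.eval a := by
      rw [hw]; ring
    rw [this]
    exact dvd_sub hb ha
  refine pow_sub_dvd_of_pow_dvd_mul hp h1 fun h2 => hR ?_
  have h3 : (p : ℤ) ^ (s + 1) ∣ (derivative g).eval a :=
    (dvd_add_left (Dvd.dvd.mul_left hab w)).1 h2
  have h4 : (p : ℤ) ^ (s + 1) ∣ g.eval a := (pow_dvd_pow _ hks).trans ha
  have h5 := congrArg (eval a) h
  simp only [eval_add, eval_mul, eval_C] at h5
  rw [← h5]
  exact dvd_add (Dvd.dvd.mul_left h4 _) (Dvd.dvd.mul_left h3 _)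

theorem card_le_of_pairwise_modEq {n M : ℕ} {S : Finset ℕ} (hS : S ⊆ Finset.Icc 1 n)
    (h : ∀ a ∈ S, ∀ b ∈ S, (M : ℤ) ∣ (b : ℤ) - a) : S.card ≤ n / M + 1 := by
  rw [← Finset.card_range (n / M + 1)]
  refine Finset.card_le_card_of_injOn (fun m => m / M) ?_ ?_
  · intro m hm
    have := Finset.mem_Icc.1 (hS hm)
    simp only [Finset.coe_range, Set.mem_Iio]
    exact Nat.lt_succ_of_le (Nat.div_le_div_right this.2)
  · intro a ha b hb hab
    have h1 : a % M = b % M := (Nat.modEq_iff_dvd.2 (h a ha b hb))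
    rw [← Nat.div_add_mod a M, ← Nat.div_add_mod b M, h1]
    exact congrArg (fun t => M * t + b % M) hab

theorem card_pow_dvd_eval_le {g : ℤ[X]} {R : ℤ} {u v : ℤ[X]}
    (h : u * g + v * derivative g = C R) {p : ℕ} (hp : p.Prime) {s k : ℕ} (hks : s < k)
    (hR : ¬ (p : ℤ) ^ (s + 1) ∣ R) (n : ℕ) :
    ((Finset.Icc 1 n).filter fun m : ℕ => (p : ℤ) ^ k ∣ g.eval (m : ℤ)).card ≤
      rootCount g (p ^ (s + 1)) * (n / p ^ (k - s) + 1) := by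
  classical
  rw [rootCount, mul_comm]
  refine Finset.card_le_mul_card_image_of_maps_to (f := fun m => m % p ^ (s + 1)) ?_ _ ?_
  · intro m hm
    rw [Finset.mem_filter] at hm
    rw [Finset.mem_filter, Finset.mem_range]
    refine ⟨Nat.mod_lt _ (pow_pos hp.pos _), ?_⟩
    have h1 : ((p ^ (s + 1) : ℕ) : ℤ) ∣ g.eval (m : ℤ) := by
      push_cast
      exact (pow_dvd_pow _ hks).trans hm.2
    have h2 : ((p ^ (s + 1) : ℕ) : ℤ) ∣ (m : ℤ) - ((m % p ^ (s + 1) : ℕ) : ℤ) :=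
      Nat.modEq_iff_dvd.1 (Nat.mod_modEq _ _)
    exact (dvd_sub_right h1).1 (h2.trans (sub_dvd_eval_sub _ _ g))
  · intro b _
    refine card_le_of_pairwise_modEq ?_ ?_
    · exact (Finset.filter_subset _ _).trans (Finset.filter_subset _ _)
    · intro x hx y hy
      simp only [Finset.mem_filter] at hx hy
      push_cast
      refine pow_dvd_sub_of_dvd_eval h hp hks hR hx.1.2 hy.1.2 ?_
      have : x ≡ y [MOD p ^ (s + 1)] := hx.2.trans hy.2.symm
      exact_mod_cast Nat.modEq_iff_dvd.1 this

theorem padicValInt_eq_card {p : ℕ} (hp : p.Prime) {x : ℤ} (hx : x ≠ 0) {L : ℕ}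
    (hL : padicValInt p x ≤ L) :
    padicValInt p x = ((Finset.Icc 1 L).filter fun k => (p : ℤ) ^ k ∣ x).card := by
  have : Fact p.Prime := ⟨hp⟩
  have : ((Finset.Icc 1 L).filter fun k => (p : ℤ) ^ k ∣ x) = Finset.Icc 1 (padicValInt p x) := by
    ext k
    simp only [Finset.mem_filter, Finset.mem_Icc, padicValInt_dvd_iff, hx, false_or]
    omega
  rw [this]
  simp

theorem padicValInt_le_log {p : ℕ} (hp : p.Prime) {x : ℤ} (hx : x ≠ 0) {B : ℕ}
    (hB : x.natAbs ≤ B) : padicValInt p x ≤ Nat.log p B := by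
  refine Nat.le_log_of_pow_le hp.one_lt (le_trans (Nat.le_of_dvd (Int.natAbs_pos.2 hx) ?_) hB)
  exact pow_padicValNat_dvd

/-- The geometric series is below `1 / (p - 1)`; the bound isolates the main term `1 / p`, and the
remainder stays summable over primes even with weight `log p`. -/
theorem sum_inv_pow_le {p : ℕ} (hp : p.Prime) (L : ℕ) :
    ∑ k ∈ Finset.Icc 1 L, (1 : ℝ) / p ^ k ≤ 1 / p + 2 / p ^ 2 := by
  have hp2 : (2 : ℝ) ≤ p := by exact_mod_cast hp.two_le
  have h1 : (0 : ℝ) < p - 1 := by linarith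
  have key : ∑ k ∈ Finset.Icc 1 L, (1 : ℝ) / p ^ k = (1 - 1 / p ^ L) / (p - 1) := by
    induction L with
    | zero => simp
    | succ L ih =>
      rw [Finset.sum_Icc_succ_top (by omega), ih]
      field_simp
      ring
  rw [key]
  have h2 : (1 : ℝ) / p + 2 / p ^ 2 = (p + 2) / p ^ 2 := by field_simp
  rw [h2, div_le_div_iff₀ h1 (by positivity)]
  have : (0 : ℝ) ≤ 1 / p ^ L := by positivity
  nlinarith

theorem rootCount_le_natDegree {g : ℤ[X]} {p : ℕ} [Fact p.Prime]
    (hg : g.map (Int.castRingHom (ZMod p)) ≠ 0) : rootCount g p ≤ g.natDegree := by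
  classical
  calc rootCount g p ≤ (g.map (Int.castRingHom (ZMod p))).roots.toFinset.card := by
        refine Finset.card_le_card_of_injOn (fun b : ℕ => (b : ZMod p)) ?_ ?_
        · intro b hb
          simp only [Finset.coe_filter, Set.mem_ofPred_eq] at hb
          simp only [Finset.mem_coe, Multiset.mem_toFinset, mem_roots hg, IsRoot.def]
          have := eval_intCast_map (Int.castRingHom (ZMod p)) g b
          simp only [Int.cast_natCast, eq_intCast] at this
          rw [this]
          exact (ZMod.intCast_zmod_eq_zero_iff_dvd _ _).2 hb.2
        · intro a ha b hb hab
          simp only [Finset.coe_filter, Set.mem_ofPred_eq, Finset.mem_range] at ha hb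
          have := (ZMod.natCast_eq_natCast_iff' a b p).1 hab
          rwa [Nat.mod_eq_of_lt ha.1, Nat.mod_eq_of_lt hb.1] at this
    _ ≤ (g.map (Int.castRingHom (ZMod p))).natDegree :=
        (Multiset.toFinset_card_le _).trans (card_roots' _)
    _ ≤ g.natDegree := natDegree_map_le

theorem map_ne_zero_of_isPrimitive {g : ℤ[X]} (hg : g.IsPrimitive) {p : ℕ} (hp : p.Prime) :
    g.map (Int.castRingHom (ZMod p)) ≠ 0 := by
  intro h
  have : C (p : ℤ) ∣ g := by
    rw [C_dvd_iff_dvd_coeff]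
    intro i
    have := congrArg (fun f => f.coeff i) h
    simp only [coeff_map, eq_intCast, coeff_zero] at this
    exact (ZMod.intCast_zmod_eq_zero_iff_dvd _ _).1 this
  exact (Nat.prime_iff_prime_int.1 hp).not_isUnit (hg _ this)

/-- A bound for the total `p`-adic valuation of the first `n` values of `g`. -/
theorem sum_padicValInt_le {g : ℤ[X]} (hg0 : ∀ a : ℤ, g.eval a ≠ 0) {R : ℤ} {u v : ℤ[X]}
    (h : u * g + v * derivative g = C R) {p : ℕ} (hp : p.Prime) {s : ℕ}
    (hR : ¬ (p : ℤ) ^ (s + 1) ∣ R) {n B : ℕ} (hB1 : 1 ≤ B)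
    (hB : ∀ m : ℕ, 1 ≤ m → m ≤ n → (g.eval (m : ℤ)).natAbs ≤ B) :
    (∑ m ∈ Finset.Icc 1 n, (padicValInt p (g.eval (m : ℤ)) : ℝ)) * Real.log p ≤
      s * n * Real.log p + rootCount g (p ^ (s + 1)) * (n * (Real.log p / p)
        + 2 * n * (Real.log p / p ^ 2) + Real.log B) := by
  classical
  have hlp : 0 ≤ Real.log p := Real.log_natCast_nonneg _
  set L := Nat.log p B with hL
  set N : ℕ → ℕ := fun k =>
    ((Finset.Icc 1 n).filter fun m : ℕ => (p : ℤ) ^ k ∣ g.eval (m : ℤ)).card with hN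
  set r := rootCount g (p ^ (s + 1)) with hr
  have h1 : ∑ m ∈ Finset.Icc 1 n, padicValInt p (g.eval (m : ℤ)) = ∑ k ∈ Finset.Icc 1 L, N k := by
    trans ∑ m ∈ Finset.Icc 1 n, ((Finset.Icc 1 L).filter
      fun k => (p : ℤ) ^ k ∣ g.eval (m : ℤ)).card
    · refine Finset.sum_congr rfl fun m hm => padicValInt_eq_card hp (hg0 _) ?_
      rw [Finset.mem_Icc] at hm
      exact padicValInt_le_log hp (hg0 _) (hB m hm.1 hm.2)
    · simp only [hN, Finset.card_filter]
      exact Finset.sum_comm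
  -- Exponents `k ≤ s` are bounded trivially by `n`; only beyond `s` do the roots separate. For
  -- primes not dividing `R`, `s = 0` and the first range is empty.
  have h2 : ∀ k ∈ Finset.Icc 1 L, (N k : ℝ) ≤
      (if k ≤ s then (n : ℝ) else 0) + (if s < k then r * (n * (1 / (p : ℝ) ^ (k - s)) + 1) else 0) := by
    intro k _
    split_ifs with h3 h4 h4
    · omega
    · rw [add_zero]
      exact_mod_cast (Finset.card_filter_le _ _).trans (by simp)
    · rw [zero_add]
      have h5 := card_pow_dvd_eval_le h hp h4 hR n
      have h6 : ((n / p ^ (k - s) : ℕ) : ℝ) ≤ n * (1 / (p : ℝ) ^ (k - s)) := by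
        refine Nat.cast_div_le.trans (le_of_eq ?_)
        push_cast
        ring
      calc (N k : ℝ) ≤ r * ((n / p ^ (k - s) : ℕ) + 1) := by exact_mod_cast h5
        _ ≤ _ := by gcongr
    · omega
  have h3 : (∑ m ∈ Finset.Icc 1 n, (padicValInt p (g.eval (m : ℤ)) : ℝ)) ≤
      s * n + r * (n * (1 / p + 2 / p ^ 2) + L) := by
    rw [← Nat.cast_sum, h1, Nat.cast_sum]
    refine (Finset.sum_le_sum h2).trans ?_
    rw [Finset.sum_add_distrib, ← Finset.sum_filter, ← Finset.sum_filter]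
    refine add_le_add ?_ ?_
    · rw [Finset.sum_const, nsmul_eq_mul]
      gcongr
      calc _ ≤ (Finset.Icc 1 s).card := Finset.card_le_card fun k hk => by
            simp only [Finset.mem_filter, Finset.mem_Icc] at hk ⊢; omega
        _ = s := by simp
    · rw [← Finset.mul_sum, Finset.sum_add_distrib, ← Finset.mul_sum, Finset.sum_const,
        nsmul_eq_mul, mul_one]
      gcongr
      · refine le_trans ?_ (sum_inv_pow_le hp L)
        rw [← Finset.sum_image (s := (Finset.Icc 1 L).filter fun k => s < k) (g := fun k => k - s)
          (f := fun k => (1 : ℝ) / (p : ℝ) ^ k)]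
        · refine Finset.sum_le_sum_of_subset_of_nonneg ?_ fun _ _ _ => by positivity
          intro k hk
          simp only [Finset.mem_image, Finset.mem_filter, Finset.mem_Icc] at hk ⊢
          omega
        · intro a ha b hb hab
          simp only [Finset.coe_filter, Set.mem_ofPred_eq, Finset.mem_Icc] at ha hb
          simp only at hab
          omega
      · exact (Finset.card_filter_le _ _).trans (by simp)
  have h4 : (L : ℝ) * Real.log p ≤ Real.log B := by
    rw [← Real.log_pow]
    refine Real.log_le_log (by have := hp.pos; positivity) ?_
    exact_mod_cast Nat.pow_log_le_self p (by omega)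
  calc _ ≤ (s * n + r * (n * (1 / p + 2 / p ^ 2) + L)) * Real.log p :=
        mul_le_mul_of_nonneg_right h3 hlp
    _ = s * n * Real.log p + r * (n * (Real.log p / p) + 2 * n * (Real.log p / p ^ 2)
        + L * Real.log p) := by ring
    _ ≤ _ := by gcongr

/-! ### The share of the primes up to `n`. -/

/-- The primes up to `n`. -/
def primesUpTo (n : ℕ) : Finset ℕ := (Finset.Icc 1 n).filter Nat.Prime

theorem mem_primesUpTo {n p : ℕ} : p ∈ primesUpTo n ↔ p.Prime ∧ p ≤ n := by
  simp only [primesUpTo, Finset.mem_filter, Finset.mem_Icc]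
  exact ⟨fun h => ⟨h.2, h.1.2⟩, fun h => ⟨⟨h.1.one_lt.le, h.2⟩, h.1⟩⟩

theorem card_primesUpTo (n : ℕ) : (primesUpTo n).card = Nat.primeCounting n := by
  rw [Nat.primeCounting, Nat.primeCounting', Nat.count_eq_card_filter_range]
  congr 1
  ext p
  rw [mem_primesUpTo, Finset.mem_filter, Finset.mem_range, Nat.lt_succ_iff, and_comm]

theorem exists_card_primesUpTo_mul_log_le :
    ∃ A : ℝ, 0 < A ∧ ∀ᶠ n : ℕ in atTop, ((primesUpTo n).card : ℝ) * Real.log n ≤ A * n := by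
  refine ⟨Real.log 4 + 1, by positivity, ?_⟩
  filter_upwards [(Chebyshev.eventually_primeCounting_le one_pos).natCast_atTop,
    eventually_gt_atTop 1] with n hn h1
  rw [Nat.floor_natCast, ← card_primesUpTo] at hn
  rwa [le_div_iff₀ (Real.log_pos (by exact_mod_cast h1))] at hn

theorem exists_sum_log_div_sq_le :
    ∃ A : ℝ, 0 < A ∧ ∀ s : Finset ℕ, ∑ p ∈ s, Real.log p / (p : ℝ) ^ 2 ≤ A := by
  have h : Summable fun k : ℕ => (2 : ℝ) * (1 / (k : ℝ) ^ (3 / 2 : ℝ)) :=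
    (Real.summable_one_div_nat_rpow.2 (by norm_num)).mul_left 2
  have hle : ∀ k : ℕ, Real.log k / (k : ℝ) ^ 2 ≤ 2 * (1 / (k : ℝ) ^ (3 / 2 : ℝ)) := by
    intro k
    rcases Nat.eq_zero_or_pos k with rfl | hk
    · simp
    have hk' : (0 : ℝ) < k := by exact_mod_cast hk
    have h1 := Real.log_le_rpow_div hk'.le (show (0 : ℝ) < 1 / 2 by norm_num)
    have h2 : (k : ℝ) ^ 2 = (k : ℝ) ^ (1 / 2 : ℝ) * (k : ℝ) ^ (3 / 2 : ℝ) := by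
      rw [← Real.rpow_add hk', ← Real.rpow_natCast]; norm_num
    rw [h2, div_le_iff₀ (by positivity)]
    refine h1.trans (le_of_eq ?_)
    field_simp
  refine ⟨∑' k : ℕ, (2 : ℝ) * (1 / (k : ℝ) ^ (3 / 2 : ℝ)) + 1, ?_, fun s => ?_⟩
  · have : 0 ≤ ∑' k : ℕ, (2 : ℝ) * (1 / (k : ℝ) ^ (3 / 2 : ℝ)) := tsum_nonneg fun k => by positivity
    linarith
  · have := h.sum_le_tsum s fun k _ => by positivity
    have := Finset.sum_le_sum (s := s) fun k _ => hle k
    linarith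

/-- The primes up to `n` contribute at most `(1 + o(1)) n log n` to `∑ m ≤ n, log |g m|`. -/
theorem sum_small_primes_le {g : ℤ[X]} (hg : Irreducible g) (hd : 2 ≤ g.natDegree) {ε : ℝ}
    (hε : 0 < ε) :
    ∀ᶠ n : ℕ in atTop, ∑ p ∈ primesUpTo n,
      (∑ m ∈ Finset.Icc 1 n, (padicValInt p (g.eval (m : ℤ)) : ℝ)) * Real.log p ≤
        (1 + ε) * (n * Real.log n) := by
  classical
  obtain ⟨R, hR0, u, v, huv⟩ := exists_bezout_derivative hg (by omega)
  obtain ⟨C, hC1, hC⟩ := exists_natAbs_eval_le g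
  obtain ⟨A₁, hA₁, hpi⟩ := exists_card_primesUpTo_mul_log_le
  obtain ⟨A₂, hA₂, hsq⟩ := exists_sum_log_div_sq_le
  set d := g.natDegree with hdd
  set T := R.natAbs.primeFactors with hT
  set r : ℕ → ℕ := fun p => rootCount g (p ^ (padicValInt p R + 1)) with hr
  set A₃ : ℝ := ∑ p ∈ T, (padicValInt p R * Real.log p + r p * (Real.log p / p
    + 2 * (Real.log p / (p : ℝ) ^ 2))) with hA₃
  set A₄ : ℝ := ∑ p ∈ T, (r p : ℝ) with hA₄
  -- This collects the coefficients of all `O(n)` terms: the convergent sum of `log p / p ^ 2`, the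
  -- `π(n) log B` loss controlled by Chebyshev, and the finitely many primes dividing `R`.
  set A₅ : ℝ := 2 * d * A₂ + d * (Real.log C + d * A₁) + A₃ + A₄ * (Real.log C + d) with hA₅
  have hlogC : 0 ≤ Real.log C := Real.log_natCast_nonneg _
  have hA₄0 : 0 ≤ A₄ := Finset.sum_nonneg fun _ _ => by positivity
  have hlog : ∀ᶠ n : ℕ in atTop, A₅ ≤ ε / 2 * Real.log n :=
    (Tendsto.const_mul_atTop (by positivity)
      (Real.tendsto_log_atTop.comp tendsto_natCast_atTop_atTop)).eventually_ge_atTop _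
  filter_upwards [sum_rootCount_log_div_le hg (by omega) (show 0 < ε / 2 by positivity), hpi,
    hlog, eventually_ge_atTop 1] with n hmer hpin hlogn hn
  have hn0 : (0 : ℝ) < n := by exact_mod_cast hn
  have hn1 : (1 : ℝ) ≤ n := by exact_mod_cast hn
  set B := C * n ^ d with hB
  have hB1 : 1 ≤ B := Nat.one_le_iff_ne_zero.2 (Nat.mul_ne_zero (by omega) (by positivity))
  have hlogB : Real.log B = Real.log C + d * Real.log n := by
    rw [hB]
    push_cast
    rw [Real.log_mul (by positivity) (by positivity), Real.log_pow]
  have hlogB0 : 0 ≤ Real.log B := Real.log_natCast_nonneg _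
  have hlogn_le : Real.log n ≤ n := (Real.log_le_sub_one_of_pos hn0).trans (by linarith)
  have hlogB' : Real.log B ≤ n * (Real.log C + d) := by
    rw [hlogB]
    nlinarith [Nat.cast_nonneg (α := ℝ) d]
  have hterm : ∀ p ∈ primesUpTo n,
      (∑ m ∈ Finset.Icc 1 n, (padicValInt p (g.eval (m : ℤ)) : ℝ)) * Real.log p ≤
      padicValInt p R * n * Real.log p + r p * (n * (Real.log p / p)
        + 2 * n * (Real.log p / p ^ 2) + Real.log B) := by
    intro p hp
    have hp' := (mem_primesUpTo.1 hp).1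
    have : Fact p.Prime := ⟨hp'⟩
    refine sum_padicValInt_le (eval_ne_zero_of_irreducible hg hd) huv hp' ?_ hB1
      fun m hm hmn => hC m n hm hmn
    rw [padicValInt_dvd_iff]
    simp [hR0]
  have hgood : ∑ p ∈ primesUpTo n with p ∉ T, (padicValInt p R * n * Real.log p
      + r p * (n * (Real.log p / p) + 2 * n * (Real.log p / p ^ 2) + Real.log B)) ≤
      n * ((1 + ε / 2) * Real.log n) + 2 * d * n * A₂ + d * ((primesUpTo n).card * Real.log B) := by
    calc _ ≤ ∑ p ∈ primesUpTo n with p ∉ T, (n * (rootCount g p * Real.log p / p)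
          + 2 * d * n * (Real.log p / p ^ 2) + d * Real.log B) := by
          refine Finset.sum_le_sum fun p hp => ?_
          rw [Finset.mem_filter] at hp
          have hp' := (mem_primesUpTo.1 hp.1).1
          have : Fact p.Prime := ⟨hp'⟩
          have hpR : padicValInt p R = 0 := by
            refine padicValNat.eq_zero_of_not_dvd fun h => hp.2 ?_
            rw [hT, Nat.mem_primeFactors]
            exact ⟨hp', h, by simpa using hR0⟩
          have hrp : r p = rootCount g p := by simp [hr, hpR]
          have hrd : (rootCount g p : ℝ) ≤ d := by
            exact_mod_cast rootCount_le_natDegree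
              (map_ne_zero_of_isPrimitive (hg.isPrimitive (by omega)) hp')
          have h1 : 0 ≤ Real.log p / (p : ℝ) ^ 2 :=
            div_nonneg (Real.log_natCast_nonneg _) (by positivity)
          have h2 : rootCount g p * (2 * n * (Real.log p / (p : ℝ) ^ 2) + Real.log B) ≤
              d * (2 * n * (Real.log p / (p : ℝ) ^ 2) + Real.log B) := by gcongr
          rw [hpR, hrp]
          simp only [Nat.cast_zero, zero_mul, zero_add]
          calc _ = n * (rootCount g p * Real.log p / p)
                + rootCount g p * (2 * n * (Real.log p / (p : ℝ) ^ 2) + Real.log B) := by ring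
            _ ≤ _ := by linarith
      _ ≤ ∑ p ∈ primesUpTo n, (n * (rootCount g p * Real.log p / p)
          + 2 * d * n * (Real.log p / p ^ 2) + d * Real.log B) := by
          refine Finset.sum_le_sum_of_subset_of_nonneg (Finset.filter_subset _ _) fun p _ _ => ?_
          have := Real.log_natCast_nonneg p
          positivity
      _ = n * (∑ p ∈ primesUpTo n, rootCount g p * Real.log p / p)
          + 2 * d * n * (∑ p ∈ primesUpTo n, Real.log p / (p : ℝ) ^ 2)
          + d * ((primesUpTo n).card * Real.log B) := by
          rw [Finset.sum_add_distrib, Finset.sum_add_distrib, ← Finset.mul_sum, ← Finset.mul_sum,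
            Finset.sum_const, nsmul_eq_mul]
          ring
      _ ≤ _ := by
          gcongr
          · exact hmer
          · exact hsq _
  have hbad : ∑ p ∈ primesUpTo n with ¬ p ∉ T, (padicValInt p R * n * Real.log p
      + r p * (n * (Real.log p / p) + 2 * n * (Real.log p / p ^ 2) + Real.log B)) ≤
      n * A₃ + A₄ * Real.log B := by
    calc _ ≤ ∑ p ∈ T, (padicValInt p R * n * Real.log p
          + r p * (n * (Real.log p / p) + 2 * n * (Real.log p / p ^ 2) + Real.log B)) := by
          refine Finset.sum_le_sum_of_subset_of_nonneg ?_ fun p _ _ => ?_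
          · intro p hp
            simpa using (Finset.mem_filter.1 hp).2
          · have := Real.log_natCast_nonneg p
            positivity
      _ = _ := by
          rw [hA₃, hA₄, Finset.mul_sum, Finset.sum_mul, ← Finset.sum_add_distrib]
          exact Finset.sum_congr rfl fun p _ => by ring
  have hcard : ((primesUpTo n).card : ℝ) ≤ n := by
    exact_mod_cast (Finset.card_filter_le _ _).trans (by simp)
  have hpiB : (primesUpTo n).card * Real.log B ≤ n * (Real.log C + d * A₁) := by
    rw [hlogB]
    have h1 := mul_le_mul_of_nonneg_right hcard hlogC
    have h2 := mul_le_mul_of_nonneg_left hpin (Nat.cast_nonneg (α := ℝ) d)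
    linarith
  refine (Finset.sum_le_sum hterm).trans ?_
  rw [← Finset.sum_filter_add_sum_filter_not _ fun p => p ∉ T]
  have h1 := mul_le_mul_of_nonneg_left hpiB (Nat.cast_nonneg (α := ℝ) d)
  have h2 := mul_le_mul_of_nonneg_left hlogB' hA₄0
  have h3 := mul_le_mul_of_nonneg_left hlogn hn0.le
  have h4 : n * A₅ = 2 * d * n * A₂ + d * (n * (Real.log C + d * A₁)) + n * A₃
      + A₄ * (n * (Real.log C + d)) := by rw [hA₅]; ring
  linarith

/-! ### Lower bounds for the logarithms of the values. -/

theorem log_natAbs_eq_sum {x : ℤ} (hx : x ≠ 0) :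
    Real.log x.natAbs = ∑ p ∈ x.natAbs.primeFactors, padicValInt p x * Real.log p := by
  have h := Nat.prod_factorization_pow_eq_self (Int.natAbs_ne_zero.2 hx)
  conv_lhs => rw [← h, Finsupp.prod]
  push_cast
  rw [Real.log_prod]
  · rw [Nat.support_factorization]
    refine Finset.sum_congr rfl fun p hp => ?_
    rw [Real.log_pow, padicValInt, Nat.factorization_def _ (Nat.prime_of_mem_primeFactors hp)]
  · intro p hp
    have := (Nat.prime_of_mem_primeFactors (Nat.support_factorization _ ▸ hp)).ne_zero
    positivity

theorem sum_log_Icc_ge (n : ℕ) (hn : 1 ≤ n) :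
    (n : ℝ) * Real.log n - n ≤ ∑ m ∈ Finset.Icc 1 n, Real.log m := by
  rw [← Real.log_prod (fun m hm => by
    have := (Finset.mem_Icc.1 hm).1
    positivity), ← Nat.cast_prod]
  have hfac : ∏ i ∈ Finset.Icc 1 n, i = n.factorial := by
    clear hn
    induction n with
    | zero => simp
    | succ n ih => rw [Finset.prod_Icc_succ_top (by omega), ih, Nat.factorial_succ, mul_comm]
  rw [hfac]
  have h := Real.pow_div_factorial_le_exp (n : ℝ) (by positivity) n
  have hn0 : (0 : ℝ) < n := by exact_mod_cast hn
  have hf : (0 : ℝ) < n.factorial := by exact_mod_cast n.factorial_pos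
  have h2 := Real.log_le_log (by positivity) h
  rw [Real.log_div (by positivity) hf.ne', Real.log_exp, Real.log_pow] at h2
  linarith

/-- Comparison with the leading term over `ℝ`. Only large `m` are covered, since the auxiliary
polynomials of the `abc` argument may have integer roots. -/
theorem exists_log_natAbs_eval_ge_of_le {g : ℤ[X]} (hg : g ≠ 0) :
    ∃ (A : ℝ) (N : ℕ), ∀ m : ℕ, N ≤ m → 1 ≤ m →
      g.eval (m : ℤ) ≠ 0 ∧ g.natDegree * Real.log m - A ≤ Real.log (g.eval (m : ℤ)).natAbs := by
  set G := g.map (Int.castRingHom ℝ) with hG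
  have hinj : Function.Injective (Int.castRingHom ℝ) := Int.cast_injective
  have hdeg : G.natDegree = g.natDegree := natDegree_map_eq_of_injective hinj g
  have hG0 : G.leadingCoeff ≠ 0 := by
    rwa [leadingCoeff_ne_zero, hG, Polynomial.map_ne_zero_iff hinj]
  have heval : ∀ m : ℕ, G.eval (m : ℝ) = (g.eval (m : ℤ) : ℤ) := by
    intro m
    have := eval_intCast_map (Int.castRingHom ℝ) g (m : ℤ)
    simp only [Int.cast_natCast, eq_intCast] at this
    exact this
  have h1 := (isEquivalent_atTop_lead G).isBigO_symm
  obtain ⟨c, hc0, hc⟩ := h1.exists_pos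
  obtain ⟨N, hN⟩ := eventually_atTop.1 hc.bound.natCast_atTop
  have hk : 0 < c / |G.leadingCoeff| := by positivity
  refine ⟨Real.log (c / |G.leadingCoeff|), N, fun m h hm => ?_⟩
  have hm0 : (0 : ℝ) < m := by exact_mod_cast hm
  have habs : ((g.eval (m : ℤ)).natAbs : ℝ) = |G.eval (m : ℝ)| := by
    rw [heval, Nat.cast_natAbs, Int.cast_abs]
  have h2 := hN m h
  rw [Real.norm_eq_abs, Real.norm_eq_abs, abs_mul, abs_pow, abs_of_pos hm0, hdeg, ← habs] at h2
  have h3 : (m : ℝ) ^ g.natDegree ≤ c / |G.leadingCoeff| * (g.eval (m : ℤ)).natAbs := by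
    rw [div_mul_eq_mul_div, le_div_iff₀ (abs_pos.2 hG0)]
    linarith
  have h0 : g.eval (m : ℤ) ≠ 0 := by
    intro h0
    rw [h0, Int.natAbs_zero, Nat.cast_zero, mul_zero] at h3
    exact absurd h3 (not_le.2 (by positivity))
  refine ⟨h0, ?_⟩
  have h4 := Real.log_le_log (by positivity) h3
  rw [Real.log_pow, Real.log_mul hk.ne' (by exact_mod_cast Int.natAbs_ne_zero.2 h0)] at h4
  linarith

theorem exists_log_natAbs_eval_ge {g : ℤ[X]} (hg0 : ∀ a : ℤ, g.eval a ≠ 0) :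
    ∃ A : ℝ, 0 ≤ A ∧ ∀ m : ℕ, 1 ≤ m →
      g.natDegree * Real.log m - A ≤ Real.log (g.eval (m : ℤ)).natAbs := by
  obtain ⟨A, N, hA⟩ := exists_log_natAbs_eval_ge_of_le
    (g := g) (by rintro rfl; exact hg0 0 (by simp))
  have hlN := Real.log_natCast_nonneg N
  refine ⟨|A| + g.natDegree * Real.log N, by positivity, fun m hm => ?_⟩
  have hm0 : (0 : ℝ) < m := by exact_mod_cast hm
  have h1 : 0 ≤ (g.natDegree : ℝ) * Real.log N := by positivity
  rcases le_total N m with h | h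
  · have := (hA m h hm).2
    linarith [le_abs_self A]
  · have h2 : Real.log m ≤ Real.log N := Real.log_le_log hm0 (by exact_mod_cast h)
    have h3 := mul_le_mul_of_nonneg_left h2 (Nat.cast_nonneg (α := ℝ) g.natDegree)
    have h4 := Real.log_natCast_nonneg (g.eval (m : ℤ)).natAbs
    linarith [abs_nonneg A]

theorem exists_log_natAbs_eval_le (g : ℤ[X]) :
    ∃ N : ℕ, ∀ n : ℕ, N ≤ n → ∀ m : ℕ, 1 ≤ m → m ≤ n →
      Real.log (g.eval (m : ℤ)).natAbs ≤ (g.natDegree + 1) * Real.log n := by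
  obtain ⟨C, hC1, hC⟩ := exists_natAbs_eval_le g
  refine ⟨max C 1, fun n hn m hm hmn => ?_⟩
  have hn1 : 1 ≤ n := le_of_max_le_right hn
  have h1 : (g.eval (m : ℤ)).natAbs ≤ n ^ (g.natDegree + 1) := by
    calc _ ≤ C * n ^ g.natDegree := hC m n hm hmn
      _ ≤ n * n ^ g.natDegree := Nat.mul_le_mul_right _ (le_of_max_le_left hn)
      _ = _ := by ring
  rcases Nat.eq_zero_or_pos (g.eval (m : ℤ)).natAbs with h0 | h0
  · rw [h0]
    have := Real.log_natCast_nonneg n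
    simp only [CharP.cast_eq_zero, Real.log_zero]
    positivity
  · have h2 : ((g.eval (m : ℤ)).natAbs : ℝ) ≤ (n : ℝ) ^ (g.natDegree + 1) := by exact_mod_cast h1
    have := Real.log_le_log (by exact_mod_cast h0) h2
    rw [Real.log_pow] at this
    exact_mod_cast this

/-! ### From weights of large primes to the number of simple primes. -/

/-- The logarithmic contribution to `g m` of the primes `p > n` whose square divides `g m`. -/
noncomputable def nonsimpleWeight (g : ℤ[X]) (n m : ℕ) : ℝ :=
  ∑ p ∈ (g.eval (m : ℤ)).natAbs.primeFactors with n < p ∧ 2 ≤ padicValInt p (g.eval (m : ℤ)),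
    padicValInt p (g.eval (m : ℤ)) * Real.log p

/-- The primes `p > n` dividing `g m` exactly once. -/
def simpleLargePrimes (g : ℤ[X]) (n m : ℕ) : Finset ℕ :=
  (g.eval (m : ℤ)).natAbs.primeFactors.filter
    fun p => n < p ∧ padicValInt p (g.eval (m : ℤ)) = 1

theorem sum_log_natAbs_eval_le {g : ℤ[X]} (hg0 : ∀ a : ℤ, g.eval a ≠ 0) (n : ℕ) :
    ∑ m ∈ Finset.Icc 1 n, Real.log (g.eval (m : ℤ)).natAbs ≤
      (∑ p ∈ primesUpTo n,
        (∑ m ∈ Finset.Icc 1 n, (padicValInt p (g.eval (m : ℤ)) : ℝ)) * Real.log p) +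
      ∑ m ∈ Finset.Icc 1 n, nonsimpleWeight g n m +
      ∑ m ∈ Finset.Icc 1 n, ∑ p ∈ simpleLargePrimes g n m, Real.log p := by
  classical
  have h1 : (∑ p ∈ primesUpTo n,
        (∑ m ∈ Finset.Icc 1 n, (padicValInt p (g.eval (m : ℤ)) : ℝ)) * Real.log p) =
      ∑ m ∈ Finset.Icc 1 n, ∑ p ∈ primesUpTo n, padicValInt p (g.eval (m : ℤ)) * Real.log p := by
    simp only [Finset.sum_mul]
    exact Finset.sum_comm
  rw [h1, ← Finset.sum_add_distrib, ← Finset.sum_add_distrib]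
  refine Finset.sum_le_sum fun m _ => ?_
  have hx := hg0 m
  set x := g.eval (m : ℤ)
  have hnn : ∀ p : ℕ, 0 ≤ (padicValInt p x : ℝ) * Real.log p := fun p => by
    have := Real.log_natCast_nonneg p
    positivity
  rw [log_natAbs_eq_sum hx, ← Finset.sum_filter_add_sum_filter_not _ fun p => n < p, add_assoc,
    add_comm]
  refine add_le_add ?_ ?_
  · refine Finset.sum_le_sum_of_subset_of_nonneg ?_ fun p _ _ => hnn p
    intro p hp
    rw [Finset.mem_filter] at hp
    rw [mem_primesUpTo]
    exact ⟨Nat.prime_of_mem_primeFactors hp.1, not_lt.1 hp.2⟩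
  · rw [← Finset.sum_filter_add_sum_filter_not _ fun p => 2 ≤ padicValInt p x,
      Finset.filter_filter, Finset.filter_filter]
    refine add_le_add le_rfl (le_of_eq ?_)
    have hv : ∀ p ∈ x.natAbs.primeFactors, 1 ≤ padicValInt p x := by
      intro p hp
      have : Fact p.Prime := ⟨Nat.prime_of_mem_primeFactors hp⟩
      exact one_le_padicValNat_of_dvd (Int.natAbs_ne_zero.2 hx) (Nat.dvd_of_mem_primeFactors hp)
    refine Finset.sum_congr ?_ ?_
    · ext p
      simp only [simpleLargePrimes, Finset.mem_filter]
      constructor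
      · rintro ⟨h1, h2, h3⟩
        have := hv p h1
        exact ⟨h1, h2, by change padicValInt p x = 1; omega⟩
      · rintro ⟨h1, h2, h3⟩
        have h3' : padicValInt p x = 1 := h3
        exact ⟨h1, h2, by omega⟩
    · intro p hp
      rw [simpleLargePrimes, Finset.mem_filter] at hp
      have h3 : padicValInt p x = 1 := hp.2.2
      rw [h3]
      simp

/-- As `m ≤ n < p`, different `m` are different residues modulo `p`, so one prime serves at most `d`
values of `m`. -/
theorem sum_card_simpleLargePrimes_le {g : ℤ[X]} (hg : g.IsPrimitive) (n : ℕ) :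
    ∑ m ∈ Finset.Icc 1 n, (simpleLargePrimes g n m).card ≤
      g.natDegree * (simplePrimeDivisors g n).ncard := by
  classical
  rw [← Finset.card_sigma, Set.ncard_eq_toFinset_card _ (simplePrimeDivisors_finite g n)]
  refine Finset.card_le_mul_card_image_of_maps_to (f := fun x : (_ : ℕ) × ℕ => x.2) ?_ _ ?_
  · intro x hx
    simp only [Finset.mem_sigma, simpleLargePrimes, Finset.mem_filter, Finset.mem_Icc] at hx
    rw [Set.Finite.mem_toFinset]
    exact ⟨Nat.prime_of_mem_primeFactors hx.2.1, hx.2.2.1.le, x.1, hx.1.1, hx.1.2, hx.2.2.2⟩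
  · intro p hp
    rw [Set.Finite.mem_toFinset] at hp
    have : Fact p.Prime := ⟨hp.1⟩
    refine le_trans ?_ (rootCount_le_natDegree (map_ne_zero_of_isPrimitive hg hp.1))
    refine Finset.card_le_card_of_injOn (fun x : (_ : ℕ) × ℕ => x.1) ?_ ?_
    · intro x hx
      simp only [Finset.coe_filter, Set.mem_ofPred_eq, Finset.mem_sigma, simpleLargePrimes,
        Finset.mem_filter, Finset.mem_Icc, Finset.mem_range] at hx ⊢
      obtain ⟨⟨⟨h1, h2⟩, h3, h4, h5⟩, rfl⟩ := hx
      exact ⟨by omega, Int.natCast_dvd.2 (Nat.dvd_of_mem_primeFactors h3)⟩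
    · intro x hx y hy hxy
      simp only [Finset.coe_filter, Set.mem_ofPred_eq] at hx hy
      exact Sigma.ext hxy (heq_of_eq (hx.2.trans hy.2.symm))

/-- If the primes `p > n` whose square divides `g m` contribute little, then there are
many simple prime divisors. -/
theorem isBigO_simplePrimeDivisors_of_nonsimpleWeight {g : ℤ[X]} (hg : Irreducible g)
    (hd : 2 ≤ g.natDegree) {δ : ℝ} (hδ : 0 < δ)
    (h : ∀ᶠ n : ℕ in atTop, ∑ m ∈ Finset.Icc 1 n, nonsimpleWeight g n m ≤
      (g.natDegree - 1 - δ) * (n * Real.log n)) :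
    (fun n : ℕ => (n : ℝ)) =O[atTop] fun n : ℕ => ((simplePrimeDivisors g n).ncard : ℝ) := by
  have hg0 := eval_ne_zero_of_irreducible hg hd
  obtain ⟨A, hA0, hA⟩ := exists_log_natAbs_eval_ge hg0
  obtain ⟨N, hN⟩ := exists_log_natAbs_eval_le g
  set d : ℝ := (g.natDegree : ℝ) with hdd
  have hd0 : 0 ≤ d := Nat.cast_nonneg _
  have hlog : ∀ᶠ n : ℕ in atTop, d + A ≤ δ / 4 * Real.log n :=
    (Tendsto.const_mul_atTop (by positivity)
      (Real.tendsto_log_atTop.comp tendsto_natCast_atTop_atTop)).eventually_ge_atTop _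
  refine IsBigO.of_bound (2 * (d + 1) * d / δ) ?_
  filter_upwards [h, hlog, eventually_ge_atTop N, eventually_gt_atTop 1,
    sum_small_primes_le hg hd (show 0 < δ / 4 by positivity)] with n h1 h2 h3 h4 h5
  have hn0 : (0 : ℝ) < n := by positivity
  have hl0 : 0 < Real.log n := Real.log_pos (by exact_mod_cast h4)
  have h6 : d * (n * Real.log n) - n * (d + A) ≤
      ∑ m ∈ Finset.Icc 1 n, Real.log (g.eval (m : ℤ)).natAbs := by
    calc _ = d * (n * Real.log n - n) - n * A := by ring
      _ ≤ d * ∑ m ∈ Finset.Icc 1 n, Real.log m - n * A := by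
          gcongr; exact sum_log_Icc_ge n h4.le
      _ = ∑ m ∈ Finset.Icc 1 n, (d * Real.log m - A) := by
          rw [Finset.sum_sub_distrib, Finset.mul_sum]; simp
      _ ≤ _ := Finset.sum_le_sum fun m hm => hA m (Finset.mem_Icc.1 hm).1
  have h7 : ∑ m ∈ Finset.Icc 1 n, ∑ p ∈ simpleLargePrimes g n m, Real.log p ≤
      (∑ m ∈ Finset.Icc 1 n, (simpleLargePrimes g n m).card : ℕ) * ((d + 1) * Real.log n) := by
    push_cast
    rw [Finset.sum_mul]
    refine Finset.sum_le_sum fun m hm => ?_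
    rw [Finset.mem_Icc] at hm
    rw [← nsmul_eq_mul, ← Finset.sum_const]
    refine Finset.sum_le_sum fun p hp => le_trans ?_ (hN n h3 m hm.1 hm.2)
    have hp := (Finset.mem_filter.1 hp).1
    have hpp := (Nat.prime_of_mem_primeFactors hp).pos
    refine Real.log_le_log (by positivity) ?_
    exact_mod_cast Nat.le_of_dvd (Int.natAbs_pos.2 (hg0 _)) (Nat.dvd_of_mem_primeFactors hp)
  have h8 := sum_log_natAbs_eval_le hg0 n
  have h9 := sum_card_simpleLargePrimes_le (hg.isPrimitive (by omega)) n
  have h10 : ((∑ m ∈ Finset.Icc 1 n, (simpleLargePrimes g n m).card : ℕ) : ℝ) ≤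
      d * (simplePrimeDivisors g n).ncard := by
    rw [hdd]
    exact_mod_cast h9
  have h11 := mul_le_mul_of_nonneg_right h10 (show 0 ≤ (d + 1) * Real.log n by positivity)
  have h12 := mul_le_mul_of_nonneg_left h2 hn0.le
  -- Of the saving `δ`, one quarter pays for the error in the small primes and one quarter for the
  -- `O(n)` terms.
  have h13 : δ / 2 * n * Real.log n ≤
      (d * (simplePrimeDivisors g n).ncard * (d + 1)) * Real.log n := by linarith
  have h14 := le_of_mul_le_mul_right h13 hl0
  rw [Real.norm_of_nonneg hn0.le, Real.norm_of_nonneg (Nat.cast_nonneg _), div_mul_eq_mul_div,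
    le_div_iff₀ hδ]
  linarith

theorem isBigO_simplePrimeDivisors_of_card_square {g : ℤ[X]} (hg : Irreducible g)
    (hd : 2 ≤ g.natDegree)
    (h : ∀ ε : ℝ, 0 < ε → ∀ᶠ n : ℕ in atTop,
      ({m ∈ Set.Icc 1 n | ∃ p : ℕ, p.Prime ∧ n < p ∧ (p : ℤ) ^ 2 ∣ g.eval (m : ℤ)}.ncard : ℝ)
        ≤ ε * n) :
    (fun n : ℕ => (n : ℝ)) =O[atTop] fun n : ℕ => ((simplePrimeDivisors g n).ncard : ℝ) := by
  classical
  obtain ⟨N, hN⟩ := exists_log_natAbs_eval_le g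
  have hg0 := eval_ne_zero_of_irreducible hg hd
  have hd' : (2 : ℝ) ≤ g.natDegree := by exact_mod_cast hd
  refine isBigO_simplePrimeDivisors_of_nonsimpleWeight hg hd (δ := 1 / 2) (by norm_num) ?_
  -- Each exceptional `m` costs at most `(d + 1) log n`, so this density keeps the total below `n
  -- log n / 2`, which is at most `(d - 3 / 2) n log n` because `d ≥ 2`.
  filter_upwards [h (1 / (2 * (g.natDegree + 1))) (by positivity), eventually_ge_atTop N]
    with n h1 h2
  have hln := Real.log_natCast_nonneg n
  set S := (Finset.Icc 1 n).filter
    fun m : ℕ => ∃ p : ℕ, p.Prime ∧ n < p ∧ (p : ℤ) ^ 2 ∣ g.eval (m : ℤ) with hS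
  have hcard : (S.card : ℝ) ≤ 1 / (2 * (g.natDegree + 1)) * n := by
    rw [← Set.ncard_coe_finset]
    convert h1 using 3
    ext m
    simp [hS]
  have h3 : ∑ m ∈ Finset.Icc 1 n, nonsimpleWeight g n m ≤
      ∑ m ∈ S, (g.natDegree + 1) * Real.log n := by
    rw [hS, Finset.sum_filter]
    refine Finset.sum_le_sum fun m hm => ?_
    rw [Finset.mem_Icc] at hm
    split_ifs with hp
    · refine le_trans ?_ (hN n h2 m hm.1 hm.2)
      rw [log_natAbs_eq_sum (hg0 m)]
      refine Finset.sum_le_sum_of_subset_of_nonneg (Finset.filter_subset _ _) fun p _ _ => ?_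
      have := Real.log_natCast_nonneg p
      positivity
    · rw [nonsimpleWeight, Finset.filter_false_of_mem, Finset.sum_empty]
      rintro p hpf ⟨h4, h5⟩
      have hpp := Nat.prime_of_mem_primeFactors hpf
      have : Fact p.Prime := ⟨hpp⟩
      exact hp ⟨p, hpp, h4, (padicValInt_dvd_iff 2 _).2 (Or.inr h5)⟩
  rw [Finset.sum_const, nsmul_eq_mul] at h3
  refine h3.trans ((mul_le_mul_of_nonneg_right hcard (by positivity)).trans ?_)
  have : 1 / (2 * ((g.natDegree : ℝ) + 1)) * n * ((g.natDegree + 1) * Real.log n) =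
      1 / 2 * (n * Real.log n) := by field_simp
  rw [this]
  have : 0 ≤ n * Real.log n := by positivity
  nlinarith

/-! ### Square values of cubics over a prime field, by Stepanov's method. -/

section SquareValues

variable {ℓ : ℕ} [Fact ℓ.Prime]

/-- An auxiliary polynomial vanishing to order two at each point where `f` is a nonzero square. -/
theorem card_eval_pow_eq_one_le {f : (ZMod ℓ)[X]} (hℓ : ℓ ≠ 2) (hf : f.natDegree = 3) :
    4 * (Finset.univ.filter fun x : ZMod ℓ => f.eval x ^ (ℓ / 2) = 1).card ≤ 3 * (ℓ + 1) := by
  classical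
  have hp : ℓ.Prime := Fact.out
  have hodd : 2 * (ℓ / 2) + 1 = ℓ := by
    have := hp.eq_two_or_odd.resolve_left hℓ
    omega
  have h3 := hp.two_le
  set k := ℓ / 2 with hk
  set A : (ZMod ℓ)[X] := 2 * f + (X ^ ℓ - X) * derivative f with hA
  have hA_deg : A.natDegree ≤ ℓ + 2 := by
    refine natDegree_add_le_of_degree_le ?_ ?_
    · refine natDegree_mul_le.trans ?_
      rw [show (2 : (ZMod ℓ)[X]) = C 2 from (map_ofNat C 2).symm, natDegree_C]
      omega
    · refine natDegree_mul_le_of_le ?_ ((natDegree_derivative_le f).trans (by omega))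
      exact (natDegree_sub_le_of_le (natDegree_X_pow_le ℓ) (natDegree_X_le.trans hp.pos)).trans
        (max_self ℓ).le
  have h2 : (2 : ZMod ℓ) ≠ 0 := by
    have : Fact (2 < ℓ) := ⟨by omega⟩
    exact (ZMod.neg_one_ne_one (n := ℓ)).symm ∘ fun h => by
      linear_combination h
  have hf0 : f ≠ 0 := by rintro rfl; simp at hf
  have hpow : (2 * f ^ (k + 1)).natDegree = 3 * (k + 1) := by
    rw [show (2 : (ZMod ℓ)[X]) = C 2 from (map_ofNat C 2).symm, natDegree_C_mul h2, natDegree_pow, hf]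
    ring
  -- Where `f ^ k = 1`, both `2 f ^ (k + 1) - 2 f` and `X ^ ℓ - X` vanish, and the derivative of `Φ`
  -- equals `(2 k + 1) f' = ℓ f' = 0`. The double zeros number at most half the degree `3 (k + 1)`.
  set Φ : (ZMod ℓ)[X] := 2 * f ^ (k + 1) - A with hΦ
  have hΦ_deg : Φ.natDegree = 3 * (k + 1) := by
    rw [hΦ, natDegree_sub_eq_left_of_natDegree_lt (by omega), hpow]
  have hΦ0 : Φ ≠ 0 := by
    intro h
    rw [h, natDegree_zero] at hΦ_deg
    omega
  set S := Finset.univ.filter fun x : ZMod ℓ => f.eval x ^ k = 1 with hS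
  have hmult : ∀ x ∈ S, 2 ≤ Φ.roots.count x := by
    intro x hx
    have hx1 : f.eval x ^ k = 1 := (Finset.mem_filter.1 hx).2
    have hx2 : x ^ ℓ = x := ZMod.pow_card x
    rw [count_roots]
    refine (one_lt_rootMultiplicity_iff_isRoot hΦ0).2 ⟨?_, ?_⟩
    · simp only [IsRoot.def, hΦ, hA, eval_sub, eval_add, eval_mul, eval_pow, eval_X, pow_succ, hx1,
        hx2, eval_ofNat]
      ring
    · have hd : derivative Φ = 2 * (((k : ℕ) + 1 : (ZMod ℓ)[X]) * f ^ k * derivative f)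
          - (2 * derivative f + (-derivative f + (X ^ ℓ - X) * derivative (derivative f))) := by
        rw [hΦ, hA]
        simp only [derivative_sub, derivative_add, derivative_mul, derivative_pow, derivative_X,
          derivative_ofNat, map_natCast]
        simp
      have hcast : (2 : ZMod ℓ) * k + 1 = 0 := by
        have := congrArg (fun n : ℕ => (n : ZMod ℓ)) hodd
        push_cast at this
        rw [this, ZMod.natCast_self]
      rw [IsRoot.def, hd]
      simp only [eval_sub, eval_add, eval_mul, eval_pow, eval_X, eval_neg, hx1, hx2, eval_ofNat,
        eval_natCast, eval_one]
      linear_combination (derivative f).eval x * hcast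
  have hcard : S.card * 2 ≤ Φ.roots.card := by
    rw [← Multiset.toFinset_sum_count_eq, ← smul_eq_mul, ← Finset.sum_const]
    calc _ ≤ ∑ x ∈ S, Φ.roots.count x := Finset.sum_le_sum hmult
      _ ≤ _ := Finset.sum_le_sum_of_subset fun x hx => by
          rw [Multiset.mem_toFinset, ← Multiset.count_pos]
          have := hmult x hx
          omega
  have := hcard.trans (card_roots' Φ)
  omega

/-- Nonzero squares are picked out by Euler's criterion and zeros number at most three. In the cubic
case `5 (3 (ℓ + 1) / 4 + 3) ≤ 4 ℓ` holds exactly from `ℓ = 75` on. -/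
theorem card_isSquare_eval_le {f : (ZMod ℓ)[X]} (hℓ : 75 ≤ ℓ)
    (hf : f.natDegree = 1 ∨ f.natDegree = 3) :
    5 * (Finset.univ.filter fun x : ZMod ℓ => IsSquare (f.eval x)).card ≤ 4 * ℓ := by
  classical
  have hf0 : f ≠ 0 := by rintro rfl; simp at hf
  have hroots : (Finset.univ.filter fun x : ZMod ℓ => f.eval x = 0).card ≤ 3 := by
    have h1 : (Finset.univ.filter fun x : ZMod ℓ => f.eval x = 0) ⊆ f.roots.toFinset := by
      intro x hx
      rw [Multiset.mem_toFinset, mem_roots hf0]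
      exact (Finset.mem_filter.1 hx).2
    refine (Finset.card_le_card h1).trans ((Multiset.toFinset_card_le _).trans ?_)
    have := card_roots' f
    omega
  have hsub : (Finset.univ.filter fun x : ZMod ℓ => IsSquare (f.eval x)) ⊆
      (Finset.univ.filter fun x : ZMod ℓ => f.eval x ^ (ℓ / 2) = 1) ∪
      (Finset.univ.filter fun x : ZMod ℓ => f.eval x = 0) := by
    intro x hx
    simp only [Finset.mem_union, Finset.mem_filter, Finset.mem_univ, true_and] at hx ⊢
    by_cases h : f.eval x = 0
    · exact Or.inr h
    · exact Or.inl ((ZMod.euler_criterion ℓ h).1 hx)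
  have h1 := (Finset.card_le_card hsub).trans (Finset.card_union_le _ _)
  rcases hf with hf | hf
  · have h2 : (Finset.univ.filter fun x : ZMod ℓ => f.eval x ^ (ℓ / 2) = 1).card ≤ ℓ / 2 := by
      set Φ : (ZMod ℓ)[X] := f ^ (ℓ / 2) - 1 with hΦ
      have hdeg : Φ.natDegree = ℓ / 2 := by
        rw [hΦ, natDegree_sub_eq_left_of_natDegree_lt, natDegree_pow, hf, mul_one]
        rw [natDegree_pow, hf, natDegree_one]
        omega
      have hΦ0 : Φ ≠ 0 := by
        intro h
        rw [h, natDegree_zero] at hdeg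
        omega
      have h3 : (Finset.univ.filter fun x : ZMod ℓ => f.eval x ^ (ℓ / 2) = 1) ⊆
          Φ.roots.toFinset := by
        intro x hx
        rw [Multiset.mem_toFinset, mem_roots hΦ0]
        simp [hΦ, (Finset.mem_filter.1 hx).2]
      refine (Finset.card_le_card h3).trans ((Multiset.toFinset_card_le _).trans ?_)
      have := card_roots' Φ
      omega
    omega
  · have h2 := card_eval_pow_eq_one_le (by omega) hf
    omega

end SquareValues

/-! ### A sieve for integer square values of a polynomial. -/

section SquareSieve

open scoped Classical in
theorem card_filter_isSquare_zmod (h : ℤ[X]) (ℓ : ℕ) [Fact ℓ.Prime] :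
    ((Finset.range ℓ).filter fun b : ℕ => IsSquare ((h.eval (b : ℤ) : ℤ) : ZMod ℓ)).card ≤
      (Finset.univ.filter fun x : ZMod ℓ =>
        IsSquare ((h.map (Int.castRingHom (ZMod ℓ))).eval x)).card := by
  refine Finset.card_le_card_of_injOn (fun b : ℕ => (b : ZMod ℓ)) ?_ ?_
  · intro b hb
    simp only [Finset.coe_filter, Set.mem_ofPred_eq, Finset.mem_univ, true_and] at hb ⊢
    have := eval_intCast_map (Int.castRingHom (ZMod ℓ)) h b
    simp only [Int.cast_natCast, eq_intCast] at this
    rw [this]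
    exact hb.2
  · intro a ha b hb hab
    simp only [Finset.coe_filter, Set.mem_ofPred_eq, Finset.mem_range] at ha hb
    have := (ZMod.natCast_eq_natCast_iff' a b ℓ).1 hab
    rwa [Nat.mod_eq_of_lt ha.1, Nat.mod_eq_of_lt hb.1] at this

open scoped Classical in
/-- A sieve bound for the number of square values of a polynomial. -/
theorem card_isSquare_eval_int_le (h : ℤ[X]) (L : Finset ℕ) (hL : ∀ ℓ ∈ L, ℓ.Prime)
    (hsq : ∀ ℓ ∈ L, 5 * ((Finset.range ℓ).filter
      fun b : ℕ => IsSquare ((h.eval (b : ℤ) : ℤ) : ZMod ℓ)).card ≤ 4 * ℓ)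
    {T : ℕ} (hT : ∏ ℓ ∈ L, ℓ ≤ T) :
    (((Finset.range T).filter fun t : ℕ => ∃ y : ℤ, h.eval (t : ℤ) = y ^ 2).card : ℝ) ≤
      2 * T * (4 / 5) ^ L.card := by
  set M := ∏ ℓ ∈ L, ℓ with hM
  have hM0 : 0 < M := Finset.prod_pos fun ℓ hℓ => (hL ℓ hℓ).pos
  set Ω : ℕ → Finset ℕ := fun ℓ => (Finset.range ℓ).filter
    fun b : ℕ => IsSquare ((h.eval (b : ℤ) : ℤ) : ZMod ℓ) with hΩ
  have h1 : ((Finset.range T).filter fun t : ℕ => ∃ y : ℤ, h.eval (t : ℤ) = y ^ 2).card ≤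
      (Finset.range (T / M + 1) ×ˢ L.pi fun ℓ => Ω ℓ).card := by
    -- By the Chinese remainder theorem `t` is determined by its block `t / M` and its residues
    -- modulo the sieving primes, each of which is confined to `Ω ℓ`.
    refine Finset.card_le_card_of_injOn (fun t => (t / M, fun ℓ _ => t % ℓ)) ?_ ?_
    · intro t ht
      simp only [Finset.coe_filter, Set.mem_ofPred_eq, Finset.mem_range] at ht
      obtain ⟨ht1, y, hy⟩ := ht
      simp only [Finset.mem_coe, Finset.mem_product, Finset.mem_range, Finset.mem_pi, hΩ,
        Finset.mem_filter]
      refine ⟨Nat.lt_succ_of_le (Nat.div_le_div_right ht1.le), fun ℓ hℓ =>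
        ⟨Nat.mod_lt _ (hL ℓ hℓ).pos, (y : ZMod ℓ), ?_⟩⟩
      have h2 : (ℓ : ℤ) ∣ (t : ℤ) - ((t % ℓ : ℕ) : ℤ) := Nat.modEq_iff_dvd.1 (Nat.mod_modEq _ _)
      have h3 := (ZMod.intCast_eq_intCast_iff_dvd_sub _ _ ℓ).2 (h2.trans (sub_dvd_eval_sub _ _ h))
      rw [h3, hy]
      push_cast
      ring
    · intro s hs t ht hst
      simp only [Prod.mk.injEq] at hst
      have h2 : ∀ ℓ ∈ L, (ℓ : ℤ) ∣ (t : ℤ) - s := by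
        intro ℓ hℓ
        exact Nat.modEq_iff_dvd.1 (congrFun (congrFun hst.2 ℓ) hℓ)
      have h3 : ∏ ℓ ∈ L, (ℓ : ℤ) ∣ (t : ℤ) - s := by
        refine Finset.prod_dvd_of_coprime ?_ h2
        intro a ha b hb hab
        exact Nat.isCoprime_iff_coprime.2 ((Nat.coprime_primes (hL a ha) (hL b hb)).2 hab)
      have h4 : s % M = t % M := by
        refine Nat.modEq_iff_dvd.2 ?_
        rw [hM, Nat.cast_prod]
        exact h3
      rw [← Nat.div_add_mod s M, ← Nat.div_add_mod t M, h4, hst.1]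
  have h2 : ((∏ ℓ ∈ L, (Ω ℓ).card : ℕ) : ℝ) ≤ M * (4 / 5) ^ L.card := by
    rw [← Finset.prod_const, hM]
    push_cast
    rw [← Finset.prod_mul_distrib]
    refine Finset.prod_le_prod (fun _ _ => by positivity) fun ℓ hℓ => ?_
    have : (5 : ℝ) * (Ω ℓ).card ≤ 4 * ℓ := by exact_mod_cast hsq ℓ hℓ
    linarith
  rw [Finset.card_product, Finset.card_range, Finset.card_pi] at h1
  have h3 : ((T / M + 1 : ℕ) : ℝ) * M ≤ 2 * T := by
    have : (T / M + 1) * M ≤ 2 * T := by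
      have := Nat.div_mul_le_self T M
      rw [add_mul, one_mul]
      omega
    exact_mod_cast this
  calc _ ≤ ((T / M + 1 : ℕ) : ℝ) * ((∏ ℓ ∈ L, (Ω ℓ).card : ℕ) : ℝ) := by exact_mod_cast h1
    _ ≤ ((T / M + 1 : ℕ) : ℝ) * (M * (4 / 5) ^ L.card) := by gcongr
    _ = (((T / M + 1 : ℕ) : ℝ) * M) * (4 / 5) ^ L.card := by ring
    _ ≤ _ := by gcongr

/-- The polynomial `g (a + q t) / q` for a root `a` of a cubic `g` modulo `q`. -/
theorem exists_rescaled_cubic {g : ℤ[X]} (hd : g.natDegree = 3) {R : ℤ} {u v : ℤ[X]}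
    (huv : u * g + v * derivative g = C R) {q : ℕ} {a : ℤ}
    (hqa : (q : ℤ) ∣ g.eval a) :
    ∃ h : ℤ[X], (∀ t : ℤ, q * h.eval t = g.eval (a + q * t)) ∧
      ∀ ℓ : ℕ, ℓ.Prime → ¬ (ℓ : ℤ) ∣ R → ¬ (ℓ : ℤ) ∣ g.leadingCoeff →
        (h.map (Int.castRingHom (ZMod ℓ))).natDegree = 1 ∨
          (h.map (Int.castRingHom (ZMod ℓ))).natDegree = 3 := by
  obtain ⟨w, hw⟩ := hqa
  set c₂ := (taylor a g).coeff 2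
  have hc3 : (taylor a g).coeff 3 = g.leadingCoeff := by
    rw [← leadingCoeff_taylor a g, leadingCoeff, natDegree_taylor, hd]
  -- These are the Taylor coefficients of `g` at `a` after `X ↦ q X` and division by `q`. If `ℓ ∣ q`
  -- the cubic collapses to a linear polynomial, whose slope `g'(a)` is nonzero modulo `ℓ` since `ℓ
  -- ∤ R`.
  refine ⟨C (q ^ 2 * g.leadingCoeff) * X ^ 3 + C (q * c₂) * X ^ 2 +
    C ((derivative g).eval a) * X + C w, fun t => ?_, fun ℓ hℓ hR hlc => ?_⟩
  · have h1 : (taylor a g).eval (q * t) = g.eval (a + q * t) := by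
      rw [taylor_eval, add_comm]
    rw [← h1, eval_eq_sum_range (p := taylor a g), natDegree_taylor, hd]
    simp only [Finset.sum_range_succ, Finset.sum_range_zero, hc3, taylor_coeff_zero,
      taylor_coeff_one, hw, eval_add, eval_mul, eval_C, eval_X, eval_pow]
    ring
  · have : Fact ℓ.Prime := ⟨hℓ⟩
    simp only [Polynomial.map_add, Polynomial.map_mul, map_C, Polynomial.map_pow, map_X]
    by_cases hlq : (ℓ : ℤ) ∣ q
    · left
      have h1 : ((q : ℤ) : ZMod ℓ) = 0 := (ZMod.intCast_zmod_eq_zero_iff_dvd _ _).2 hlq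
      have h2 : (((derivative g).eval a : ℤ) : ZMod ℓ) ≠ 0 := by
        intro h
        have h3 := (ZMod.intCast_zmod_eq_zero_iff_dvd _ _).1 h
        refine hR ?_
        have h5 := congrArg (eval a) huv
        simp only [eval_add, eval_mul, eval_C] at h5
        rw [← h5, hw]
        exact dvd_add (Dvd.dvd.mul_left (Dvd.dvd.mul_right hlq _) _) (Dvd.dvd.mul_left h3 _)
      have h3 : (Int.castRingHom (ZMod ℓ)) (q ^ 2 * g.leadingCoeff) = 0 := by
        rw [eq_intCast, Int.cast_mul, Int.cast_pow, h1]; ring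
      have h4 : (Int.castRingHom (ZMod ℓ)) (q * c₂) = 0 := by
        rw [eq_intCast, Int.cast_mul, h1]; ring
      rw [h3, h4, C_0, zero_mul, zero_mul, zero_add, zero_add]
      exact natDegree_linear h2
    · right
      refine natDegree_cubic ?_
      rw [eq_intCast, Ne, ZMod.intCast_zmod_eq_zero_iff_dvd]
      intro h
      have hpr := Nat.prime_iff_prime_int.1 hℓ
      rcases hpr.dvd_or_dvd h with h | h
      · exact hlq (hpr.dvd_of_dvd_pow h)
      · exact hlc h

/-- Bertrand's postulate supplies one prime in each dyadic interval above `2 ^ B`. An interval of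
length `2 ^ j` can thus be sieved by about `sqrt (j / b)` primes. -/
theorem exists_sparse_primes (B : ℕ) :
    ∃ b : ℕ, 0 < b ∧ ∀ k : ℕ, ∃ L : Finset ℕ, L.card = k ∧ (∀ ℓ ∈ L, ℓ.Prime ∧ B < ℓ) ∧
      ∏ ℓ ∈ L, ℓ ≤ 2 ^ (b * k ^ 2) := by
  refine ⟨B + 1, by omega, fun k => ?_⟩
  suffices ∃ L : Finset ℕ, L.card = k ∧ (∀ ℓ ∈ L, ℓ.Prime ∧ B < ℓ ∧ ℓ ≤ 2 ^ (B + k)) ∧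
      ∏ ℓ ∈ L, ℓ ≤ 2 ^ ((B + 1) * k ^ 2) by
    obtain ⟨L, h1, h2, h3⟩ := this
    exact ⟨L, h1, fun ℓ hℓ => ⟨(h2 ℓ hℓ).1, (h2 ℓ hℓ).2.1⟩, h3⟩
  induction k with
  | zero => exact ⟨∅, by simp⟩
  | succ k ih =>
    obtain ⟨L, h1, h2, h3⟩ := ih
    obtain ⟨p, hp, hp1, hp2⟩ := Nat.exists_prime_lt_and_le_two_mul (2 ^ (B + k)) (by positivity)
    have hpL : p ∉ L := fun h => by have := (h2 p h).2.2; omega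
    have hpow : 2 * 2 ^ (B + k) = 2 ^ (B + (k + 1)) := by rw [← add_assoc, pow_succ, mul_comm]
    refine ⟨insert p L, by rw [Finset.card_insert_of_notMem hpL, h1], ?_, ?_⟩
    · intro ℓ hℓ
      rcases Finset.mem_insert.1 hℓ with rfl | hℓ
      · refine ⟨hp, ?_, hpow ▸ hp2⟩
        have : B + k < 2 ^ (B + k) := Nat.lt_two_pow_self
        omega
      · obtain ⟨h4, h5, h6⟩ := h2 ℓ hℓ
        exact ⟨h4, h5, by omega⟩
    · rw [Finset.prod_insert hpL]
      calc p * ∏ ℓ ∈ L, ℓ ≤ 2 ^ (B + (k + 1)) * 2 ^ ((B + 1) * k ^ 2) :=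
            Nat.mul_le_mul (hpow ▸ hp2) h3
        _ = 2 ^ (B + (k + 1) + (B + 1) * k ^ 2) := (pow_add _ _ _).symm
        _ ≤ _ := Nat.pow_le_pow_right (by norm_num) (by nlinarith)

/-- With `k = sqrt (j / b)`, exponential decay in `k` beats `k ^ (-4)`, which is of the order of `j
^ (-2)`. -/
theorem summable_pow_sqrt_div {b : ℕ} (hb : 0 < b) :
    Summable fun j : ℕ => ((4 : ℝ) / 5) ^ (Nat.sqrt (j / b)) := by
  have h1 := (tendsto_pow_const_mul_const_pow_of_abs_lt_one 4
    (show |(4 : ℝ) / 5| < 1 by rw [abs_lt]; norm_num)).bddAbove_range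
  obtain ⟨A, hA⟩ := h1
  have hA' : ∀ n : ℕ, (n : ℝ) ^ 4 * (4 / 5) ^ n ≤ A := fun n => hA ⟨n, rfl⟩
  have h2 : Summable fun j : ℕ => (5 / 4 * A * b ^ 2) * (1 / ((j + 1 : ℕ) : ℝ) ^ 2) :=
    ((summable_nat_add_iff 1).2 (Real.summable_one_div_nat_pow.2 one_lt_two)).mul_left _
  refine Summable.of_nonneg_of_le (fun j => by positivity) (fun j => ?_) h2
  set k := Nat.sqrt (j / b) with hk
  have h3 : j + 1 ≤ b * (k + 1) ^ 2 := by
    have h4 : j / b < (k + 1) ^ 2 := by rw [sq]; exact Nat.lt_succ_sqrt (j / b)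
    have := (Nat.div_lt_iff_lt_mul hb).1 h4
    rw [mul_comm]
    omega
  have h4 := hA' (k + 1)
  rw [pow_succ ((4 : ℝ) / 5)] at h4
  have h5 : ((j + 1 : ℕ) : ℝ) ^ 2 ≤ b ^ 2 * ((k + 1 : ℕ) : ℝ) ^ 4 := by
    have : (j + 1) ^ 2 ≤ b ^ 2 * (k + 1) ^ 4 := by
      calc (j + 1) ^ 2 ≤ (b * (k + 1) ^ 2) ^ 2 := Nat.pow_le_pow_left h3 2
        _ = _ := by ring
    exact_mod_cast this
  rw [mul_one_div, le_div_iff₀ (by positivity)]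
  have h6 : (0 : ℝ) ≤ (4 / 5) ^ k := by positivity
  calc ((4 : ℝ) / 5) ^ k * ((j + 1 : ℕ) : ℝ) ^ 2
      ≤ (4 / 5) ^ k * (b ^ 2 * ((k + 1 : ℕ) : ℝ) ^ 4) := by gcongr
    _ = 5 / 4 * (((k + 1 : ℕ) : ℝ) ^ 4 * ((4 / 5) ^ k * (4 / 5))) * b ^ 2 := by ring
    _ ≤ _ := by gcongr

end SquareSieve

/-! ### Cubic values divisible by the square of a large integer. -/

section LargeSquares

open scoped Classical in
theorem card_square_in_residue_class_le {g : ℤ[X]} (hd : g.natDegree = 3) {R : ℤ} {u v : ℤ[X]}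
    (huv : u * g + v * derivative g = C R) {L : Finset ℕ}
    (hL : ∀ ℓ ∈ L, ℓ.Prime ∧ 75 ≤ ℓ ∧ ¬ (ℓ : ℤ) ∣ R ∧ ¬ (ℓ : ℤ) ∣ g.leadingCoeff) {T : ℕ}
    (hT : ∏ ℓ ∈ L, ℓ ≤ T) {q a n : ℕ} (hq : q ≠ 0) (hqa : (q : ℤ) ∣ g.eval (a : ℤ))
    (hn : n < q * T) :
    (((Finset.Icc 1 n).filter
      fun m : ℕ => m % q = a ∧ ∃ y : ℤ, g.eval (m : ℤ) = q * y ^ 2).card : ℝ) ≤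
      2 * T * (4 / 5) ^ L.card := by
  obtain ⟨h, hh, hdeg⟩ := exists_rescaled_cubic hd huv hqa
  refine le_trans ?_ (card_isSquare_eval_int_le h L (fun ℓ hℓ => (hL ℓ hℓ).1) ?_ hT)
  · norm_cast
    refine Finset.card_le_card_of_injOn (fun m => m / q) ?_ ?_
    · intro m hm
      simp only [Finset.coe_filter, Set.mem_ofPred_eq, Finset.mem_Icc, Finset.mem_range] at hm ⊢
      obtain ⟨⟨h1, h2⟩, h3, y, hy⟩ := hm
      refine ⟨Nat.div_lt_of_lt_mul (by omega), y, ?_⟩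
      have hq' : (q : ℤ) ≠ 0 := by exact_mod_cast hq
      apply mul_left_cancel₀ hq'
      rw [hh, ← hy]
      congr 1
      rw [← h3]
      exact_mod_cast Nat.mod_add_div m q
    · intro x hx y hy hxy
      simp only [Finset.coe_filter, Set.mem_ofPred_eq] at hx hy
      have hxy' : x / q = y / q := hxy
      rw [← Nat.div_add_mod x q, ← Nat.div_add_mod y q, hx.2.1, hy.2.1, hxy']
  · intro ℓ hℓ
    obtain ⟨h1, h2, h3, h4⟩ := hL ℓ hℓ
    have : Fact ℓ.Prime := ⟨h1⟩
    refine le_trans (Nat.mul_le_mul_left 5 ?_) (card_isSquare_eval_le h2 (hdeg ℓ h1 h3 h4))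
    convert card_filter_isSquare_zmod h ℓ

open scoped Classical in
theorem exists_card_large_square_le {g : ℤ[X]} (hg : Irreducible g) (hd : g.natDegree = 3) {ε : ℝ}
    (hε : 0 < ε) :
    ∃ K : ℕ, 0 < K ∧ ∀ n : ℕ, 1 ≤ n → (((Finset.Icc 1 n).filter fun m : ℕ => 0 < g.eval (m : ℤ) ∧
      ∃ p : ℕ, K * n ≤ p ∧ (p : ℤ) ^ 2 ∣ g.eval (m : ℤ)).card : ℝ) ≤ ε * n := by
  obtain ⟨R, hR0, u, v, huv⟩ := exists_bezout_derivative hg (by omega)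
  obtain ⟨C, hC1, hC⟩ := exists_natAbs_eval_le g
  obtain ⟨C₀, hC₀, hsum⟩ := exists_sum_rootCount_le hg (by omega)
  have hlc : g.leadingCoeff ≠ 0 := leadingCoeff_ne_zero.2 hg.ne_zero
  obtain ⟨b, hb, hprimes⟩ := exists_sparse_primes (75 + R.natAbs + g.leadingCoeff.natAbs)
  choose L hLcard hLmem hLprod using hprimes
  have hndvd : ∀ ℓ : ℕ, ∀ z : ℤ, z ≠ 0 → z.natAbs < ℓ → ¬ (ℓ : ℤ) ∣ z := by
    intro ℓ z hz hlt h
    exact absurd (Nat.le_of_dvd (Int.natAbs_pos.2 hz) (Int.natCast_dvd.1 h)) (by omega)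
  set κ : ℕ → ℕ := fun j => Nat.sqrt (j / b) with hκ
  obtain ⟨j₀, hj₀⟩ : ∃ j₀ : ℕ, ∀ s : Finset ℕ, (∀ j ∈ s, j₀ ≤ j) →
      ∑ j ∈ s, ((4 : ℝ) / 5) ^ κ j ≤ ε / (4 * C₀) := by
    obtain ⟨s, hs⟩ := summable_iff_vanishing_norm.1 (summable_pow_sqrt_div hb) (ε / (4 * C₀))
      (by positivity)
    refine ⟨s.sup id + 1, fun t ht => ?_⟩
    have hdis : Disjoint t s := by
      rw [Finset.disjoint_left]
      intro j hjt hjs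
      have h1 := ht j hjt
      have h2 : id j ≤ s.sup id := Finset.le_sup hjs
      simp only [id] at h2
      omega
    exact (le_abs_self _).trans (hs t hdis).le
  -- If `g m = p ^ 2 q ≤ C n ^ 3` and `p ≥ C 2 ^ j₀ n`, then `q ≤ n / 2 ^ j₀`. Every `q` thus lies
  -- in a dyadic range `2 ^ j ≤ n / q < 2 ^ (j + 1)` with `j ≥ j₀`, and only a tail of the
  -- convergent series remains.
  refine ⟨C * 2 ^ j₀, by positivity, fun n hn => ?_⟩
  set V : ℕ → ℕ → Finset ℕ := fun q a => (Finset.Icc 1 n).filter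
      fun m : ℕ => m % q = a ∧ ∃ y : ℤ, g.eval (m : ℤ) = q * y ^ 2 with hV
  set Qs : ℕ → Finset ℕ := fun j => (Finset.Icc 1 (n / 2 ^ j)).filter
    fun q => n < q * 2 ^ (j + 1) with hQs
  set As : ℕ → Finset ℕ := fun q => (Finset.range q).filter
    fun a : ℕ => (q : ℤ) ∣ g.eval (a : ℤ) with hAs
  have hVcard : ∀ j, ∀ q ∈ Qs j, ∀ a ∈ As q, ((V q a).card : ℝ) ≤ 4 * 2 ^ j * (4 / 5) ^ κ j := by
    intro j q hq a ha
    simp only [hQs, hAs, Finset.mem_filter, Finset.mem_Icc] at hq ha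
    have h1 : ∏ ℓ ∈ L (κ j), ℓ ≤ 2 ^ (j + 1) := by
      refine (hLprod (κ j)).trans (Nat.pow_le_pow_right (by norm_num) ?_)
      have h2 : κ j * κ j ≤ j / b := Nat.sqrt_le (j / b)
      have h3 := Nat.mul_le_mul_left b h2
      have h4 := Nat.mul_div_le j b
      rw [sq]
      omega
    have h2 := card_square_in_residue_class_le hd huv (L := L (κ j)) (fun ℓ hℓ => ?_) h1
      (by omega : q ≠ 0) ha.2 hq.2
    · rw [hLcard] at h2
      refine h2.trans (le_of_eq ?_)
      push_cast
      ring
    · obtain ⟨h3, h4⟩ := hLmem _ ℓ hℓ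
      exact ⟨h3, by omega, hndvd ℓ R hR0 (by omega), hndvd ℓ _ hlc (by omega)⟩
  have hcover : ((Finset.Icc 1 n).filter fun m : ℕ => 0 < g.eval (m : ℤ) ∧
      ∃ p : ℕ, C * 2 ^ j₀ * n ≤ p ∧ (p : ℤ) ^ 2 ∣ g.eval (m : ℤ)) ⊆
      (Finset.Icc j₀ n).biUnion fun j => (Qs j).biUnion fun q => (As q).biUnion fun a => V q a := by
    intro m hm
    simp only [Finset.mem_filter, Finset.mem_Icc] at hm
    obtain ⟨⟨hm1, hmn⟩, hpos, p, hp, w, hw⟩ := hm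
    have hw0 : 0 < w := by
      by_contra hcon
      have : (p : ℤ) ^ 2 * w ≤ 0 := mul_nonpos_of_nonneg_of_nonpos (by positivity) (by omega)
      omega
    obtain ⟨q, rfl⟩ := Int.eq_ofNat_of_zero_le hw0.le
    have hq0 : 0 < q := by exact_mod_cast hw0
    have hbound : p ^ 2 * q ≤ C * n ^ 3 := by
      have := hC m n hm1 hmn
      rw [hw, hd] at this
      simpa [Int.natAbs_mul, Int.natAbs_pow] using this
    have hqn : q * 2 ^ j₀ ≤ n := by
      have h1 : (C * 2 ^ j₀ * n) ^ 2 * q ≤ C * n ^ 3 :=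
        (Nat.mul_le_mul_right q (Nat.pow_le_pow_left hp 2)).trans hbound
      have h2 : C * n ^ 2 * (C * 2 ^ j₀ * (q * 2 ^ j₀)) ≤ C * n ^ 2 * n := by
        calc _ = (C * 2 ^ j₀ * n) ^ 2 * q := by ring
          _ ≤ C * n ^ 3 := h1
          _ = _ := by ring
      have h3 := Nat.le_of_mul_le_mul_left h2 (by positivity)
      refine le_trans (Nat.le_mul_of_pos_left _ (by positivity)) h3
    have hqle : q ≤ n := (Nat.le_mul_of_pos_right q (by positivity)).trans hqn
    set j := Nat.log 2 (n / q) with hj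
    have hnq : n / q ≠ 0 := (Nat.div_pos hqle hq0).ne'
    have hj1 : 2 ^ j ≤ n / q := Nat.pow_log_le_self 2 hnq
    have hj2 : n / q < 2 ^ (j + 1) := Nat.lt_pow_succ_log_self (by norm_num) _
    have hj3 : j₀ ≤ j := Nat.le_log_of_pow_le (by norm_num)
      ((Nat.le_div_iff_mul_le hq0).2 (by rw [mul_comm]; exact hqn))
    have hj4 : j ≤ n := (Nat.lt_two_pow_self.le.trans hj1).trans (Nat.div_le_self n q)
    have hdvd : (q : ℤ) ∣ g.eval (m : ℤ) := ⟨(p : ℤ) ^ 2, by rw [hw]; simp [mul_comm]⟩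
    simp only [Finset.mem_biUnion, Finset.mem_Icc, hQs, hAs, hV, Finset.mem_filter,
      Finset.mem_range]
    refine ⟨j, ⟨hj3, hj4⟩, q, ⟨⟨hq0, ?_⟩, ?_⟩, m % q, ⟨Nat.mod_lt _ hq0, ?_⟩, ⟨hm1, hmn⟩, rfl, p, ?_⟩
    · rw [Nat.le_div_iff_mul_le (by positivity), mul_comm]
      exact (Nat.le_div_iff_mul_le hq0).1 hj1
    · rw [mul_comm]
      exact (Nat.div_lt_iff_lt_mul hq0).1 hj2
    · have h2 : (q : ℤ) ∣ (m : ℤ) - ((m % q : ℕ) : ℤ) := Nat.modEq_iff_dvd.1 (Nat.mod_modEq _ _)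
      exact (dvd_sub_right hdvd).1 (h2.trans (sub_dvd_eval_sub _ _ g))
    · rw [hw]
      simp [mul_comm]
  have hj : ∀ j ∈ Finset.Icc j₀ n,
      (((Qs j).biUnion fun q => (As q).biUnion fun a => V q a).card : ℝ) ≤
        4 * C₀ * n * (4 / 5) ^ κ j := by
    intro j _
    have h1 : (((Qs j).biUnion fun q => (As q).biUnion fun a => V q a).card : ℝ) ≤
        ∑ q ∈ Qs j, (rootCount g q : ℝ) * (4 * 2 ^ j * (4 / 5) ^ κ j) := by
      refine (Nat.cast_le.2 Finset.card_biUnion_le).trans ?_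
      push_cast
      refine Finset.sum_le_sum fun q hq => ?_
      refine (Nat.cast_le.2 Finset.card_biUnion_le).trans ?_
      push_cast
      refine (Finset.sum_le_sum fun a ha => hVcard j q hq a ha).trans ?_
      rw [Finset.sum_const, nsmul_eq_mul]
      rfl
    rw [← Finset.sum_mul] at h1
    refine h1.trans ?_
    have h2 : ∑ q ∈ Qs j, (rootCount g q : ℝ) ≤ C₀ * (n / 2 ^ j) := by
      rcases Nat.eq_zero_or_pos (n / 2 ^ j) with h0 | h0
      · have : Qs j = ∅ := by simp [hQs, h0]
        rw [this, Finset.sum_empty]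
        positivity
      · have h3 : ∑ q ∈ Qs j, (rootCount g q : ℝ) ≤
            ∑ q ∈ Finset.Icc 1 (n / 2 ^ j), (rootCount g q : ℝ) :=
          Finset.sum_le_sum_of_subset_of_nonneg (Finset.filter_subset _ _) fun _ _ _ => by positivity
        have h4 := hsum _ h0
        push_cast at h4
        refine h3.trans (h4.trans ?_)
        gcongr
        refine Nat.cast_div_le.trans (le_of_eq ?_)
        push_cast
        rfl
    -- The number of classes, about `n / 2 ^ j` in total over this range of `q`, cancels the factor
    -- `2 ^ j` from the length of each class; only the sieve saving survives.
    calc _ ≤ C₀ * (n / 2 ^ j) * (4 * 2 ^ j * (4 / 5) ^ κ j) := by gcongr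
      _ = _ := by field_simp
  calc _ ≤ (((Finset.Icc j₀ n).biUnion fun j => (Qs j).biUnion fun q =>
        (As q).biUnion fun a => V q a).card : ℝ) := by exact_mod_cast Finset.card_le_card hcover
    _ ≤ ∑ j ∈ Finset.Icc j₀ n, (((Qs j).biUnion fun q => (As q).biUnion fun a => V q a).card : ℝ) := by
        exact_mod_cast Finset.card_biUnion_le
    _ ≤ ∑ j ∈ Finset.Icc j₀ n, 4 * C₀ * n * (4 / 5) ^ κ j := Finset.sum_le_sum hj
    _ = 4 * C₀ * n * ∑ j ∈ Finset.Icc j₀ n, ((4 : ℝ) / 5) ^ κ j := by rw [Finset.mul_sum]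
    _ ≤ 4 * C₀ * n * (ε / (4 * C₀)) := by
        gcongr
        exact hj₀ _ fun j hj => (Finset.mem_Icc.1 hj).1
    _ = ε * n := by field_simp

end LargeSquares

/-! ### Degrees two and three, unconditionally. -/

section LowDegree

open scoped Classical in
theorem exists_card_large_square_le_of_natDegree {g : ℤ[X]} (hg : Irreducible g)
    (hd : g.natDegree = 2 ∨ g.natDegree = 3) {ε : ℝ} (hε : 0 < ε) :
    ∃ K : ℕ, 0 < K ∧ ∀ n : ℕ, 1 ≤ n → (((Finset.Icc 1 n).filter fun m : ℕ => 0 < g.eval (m : ℤ) ∧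
      ∃ p : ℕ, K * n ≤ p ∧ (p : ℤ) ^ 2 ∣ g.eval (m : ℤ)).card : ℝ) ≤ ε * n := by
  rcases hd with hd | hd
  · obtain ⟨C, hC1, hC⟩ := exists_natAbs_eval_le g
    -- For a quadratic, `p ^ 2 ≤ g m ≤ C n ^ 2` already excludes `p ≥ (C + 1) n`.
    refine ⟨C + 1, by omega, fun n hn => ?_⟩
    rw [Finset.filter_false_of_mem, Finset.card_empty, Nat.cast_zero]
    · positivity
    · rintro m hm ⟨hpos, p, hp, hdvd⟩
      rw [Finset.mem_Icc] at hm
      have h1 := hC m n hm.1 hm.2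
      rw [hd] at h1
      have h2 : p ^ 2 ≤ (g.eval (m : ℤ)).natAbs := by
        refine Nat.le_of_dvd (Int.natAbs_pos.2 hpos.ne') ?_
        have := Int.natAbs_dvd_natAbs.2 hdvd
        simpa [Int.natAbs_pow] using this
      have h3 : ((C + 1) * n) ^ 2 ≤ C * n ^ 2 := ((Nat.pow_le_pow_left hp 2).trans h2).trans h1
      have h4 : (C + 1) ^ 2 ≤ C := by
        rw [mul_pow] at h3
        exact Nat.le_of_mul_le_mul_right h3 (by positivity)
      nlinarith
  · exact exists_card_large_square_le hg hd hε

theorem exists_eval_pos {g : ℤ[X]} (hd : 0 < g.natDegree) (hlc : 0 < g.leadingCoeff) :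
    ∃ N : ℕ, ∀ m : ℕ, N ≤ m → 0 < g.eval (m : ℤ) := by
  have hinj : Function.Injective (Int.castRingHom ℝ) := Int.cast_injective
  have h := tendsto_atTop_of_leadingCoeff_nonneg (g.map (Int.castRingHom ℝ))
    (by rwa [degree_map_eq_of_injective hinj, ← natDegree_pos_iff_degree_pos])
    (by
      rw [leadingCoeff_map_of_injective hinj, eq_intCast]
      exact_mod_cast hlc.le)
  obtain ⟨N, hN⟩ := eventually_atTop.1 (h.eventually_gt_atTop 0).natCast_atTop
  refine ⟨N, fun m hm => ?_⟩
  have h1 := hN m hm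
  have h2 := eval_intCast_map (Int.castRingHom ℝ) g (m : ℤ)
  simp only [Int.cast_natCast, eq_intCast] at h2
  rw [h2] at h1
  exact_mod_cast h1

theorem eventually_card_primesUpTo_mul_le (K : ℕ) (hK : 0 < K) {ε : ℝ} (hε : 0 < ε) :
    ∀ᶠ n : ℕ in atTop, ((primesUpTo (K * n)).card : ℝ) ≤ ε * n := by
  obtain ⟨A, hA, h⟩ := exists_card_primesUpTo_mul_log_le
  have hlog : ∀ᶠ n : ℕ in atTop, A * K / ε ≤ Real.log n :=
    (Real.tendsto_log_atTop.comp tendsto_natCast_atTop_atTop).eventually_ge_atTop _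
  have hmul : Tendsto (fun n : ℕ => K * n) atTop atTop := tendsto_id.const_mul_atTop' hK
  filter_upwards [hmul.eventually h, hlog, eventually_gt_atTop 1] with n h1 h2 h3
  have hl0 : 0 < Real.log n := Real.log_pos (by exact_mod_cast h3)
  have h4 : Real.log n ≤ Real.log (K * n : ℕ) :=
    Real.log_le_log (by positivity) (by exact_mod_cast Nat.le_mul_of_pos_left n hK)
  have h5 := mul_le_mul_of_nonneg_left h4 (Nat.cast_nonneg (α := ℝ) (primesUpTo (K * n)).card)
  refine le_of_mul_le_mul_right ((h5.trans h1).trans ?_) hl0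
  rw [div_le_iff₀ hε] at h2
  push_cast
  nlinarith [Nat.cast_nonneg (α := ℝ) n]

theorem eventually_ncard_square_le {g : ℤ[X]} (hg : Irreducible g)
    (hd : g.natDegree = 2 ∨ g.natDegree = 3) (hlc : 0 < g.leadingCoeff) {ε : ℝ} (hε : 0 < ε) :
    ∀ᶠ n : ℕ in atTop,
      ({m ∈ Set.Icc 1 n | ∃ p : ℕ, p.Prime ∧ n < p ∧ (p : ℤ) ^ 2 ∣ g.eval (m : ℤ)}.ncard : ℝ)
        ≤ ε * n := by
  classical
  obtain ⟨K, hK, hbig⟩ := exists_card_large_square_le_of_natDegree hg hd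
    (show 0 < ε / 3 by positivity)
  obtain ⟨N, hN⟩ := exists_eval_pos (g := g) (by omega) hlc
  have hNe : ∀ᶠ n : ℕ in atTop, (N : ℝ) ≤ ε / 3 * n :=
    (Tendsto.const_mul_atTop (by positivity) tendsto_natCast_atTop_atTop).eventually_ge_atTop _
  filter_upwards [hNe, eventually_card_primesUpTo_mul_le K hK (show 0 < ε / 9 by positivity),
    eventually_ge_atTop 1] with n h1 h2 h3
  set S := (Finset.Icc 1 n).filter
    fun m : ℕ => ∃ p : ℕ, p.Prime ∧ n < p ∧ (p : ℤ) ^ 2 ∣ g.eval (m : ℤ) with hS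
  have hcard : {m ∈ Set.Icc 1 n | ∃ p : ℕ, p.Prime ∧ n < p ∧
      (p : ℤ) ^ 2 ∣ g.eval (m : ℤ)}.ncard = S.card := by
    rw [← Set.ncard_coe_finset]
    congr 1
    ext m
    simp [hS]
  rw [hcard]
  set P := (primesUpTo (K * n)).filter fun p => n < p with hP
  set W : ℕ → Finset ℕ := fun p => (Finset.Icc 1 n).filter fun m : ℕ => (p : ℤ) ∣ g.eval (m : ℤ)
  -- Three sources: the bounded range where `g` may fail to be positive; primes between `n` and `K
  -- n`, few by Chebyshev and each dividing at most three values; and divisors beyond `K n`.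
  have hsub : S ⊆ (Finset.range N ∪ P.biUnion W) ∪
      (Finset.Icc 1 n).filter fun m : ℕ => 0 < g.eval (m : ℤ) ∧
        ∃ p : ℕ, K * n ≤ p ∧ (p : ℤ) ^ 2 ∣ g.eval (m : ℤ) := by
    intro m hm
    simp only [hS, Finset.mem_filter] at hm
    obtain ⟨hm, p, hp, hnp, hdvd⟩ := hm
    simp only [Finset.mem_union, Finset.mem_range, Finset.mem_biUnion, Finset.mem_filter, hP, W]
    rcases lt_or_ge m N with h | h
    · exact Or.inl (Or.inl h)
    rcases le_total p (K * n) with h' | h'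
    · exact Or.inl (Or.inr ⟨p, ⟨mem_primesUpTo.2 ⟨hp, h'⟩, hnp⟩, hm,
        (dvd_pow_self _ two_ne_zero).trans hdvd⟩)
    · exact Or.inr ⟨hm, hN m h, p, h', hdvd⟩
  have hW : ∀ p ∈ P, (W p).card ≤ 3 := by
    intro p hp
    rw [hP, Finset.mem_filter] at hp
    have hpp := (mem_primesUpTo.1 hp.1).1
    have : Fact p.Prime := ⟨hpp⟩
    have h4 := rootCount_le_natDegree
      (map_ne_zero_of_isPrimitive (hg.isPrimitive (by omega)) hpp)
    refine le_trans (Finset.card_le_card ?_) (h4.trans (by omega))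
    intro m hm
    rw [Finset.mem_filter, Finset.mem_Icc] at hm
    rw [Finset.mem_filter, Finset.mem_range]
    exact ⟨by omega, hm.2⟩
  have hU : (P.biUnion W).card ≤ (primesUpTo (K * n)).card * 3 := by
    refine Finset.card_biUnion_le.trans ((Finset.sum_le_sum hW).trans ?_)
    rw [Finset.sum_const, smul_eq_mul]
    exact Nat.mul_le_mul_right 3 (Finset.card_filter_le _ _)
  have htot := (Finset.card_le_card hsub).trans ((Finset.card_union_le _ _).trans
    (Nat.add_le_add_right (Finset.card_union_le _ _) _))
  rw [Finset.card_range] at htot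
  have htot' : (S.card : ℝ) ≤ N + (primesUpTo (K * n)).card * 3 +
      ((Finset.Icc 1 n).filter fun m : ℕ => 0 < g.eval (m : ℤ) ∧
        ∃ p : ℕ, K * n ≤ p ∧ (p : ℤ) ^ 2 ∣ g.eval (m : ℤ)).card := by
    exact_mod_cast htot.trans (Nat.add_le_add_right (Nat.add_le_add_left hU _) _)
  have h5 := hbig n h3
  linarith

theorem simplePrimeDivisors_neg (g : ℤ[X]) (n : ℕ) :
    simplePrimeDivisors (-g) n = simplePrimeDivisors g n := by
  simp [simplePrimeDivisors, padicValInt]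

theorem isBigO_simplePrimeDivisors_of_natDegree {g : ℤ[X]} (hg : Irreducible g)
    (hd : g.natDegree = 2 ∨ g.natDegree = 3) :
    (fun n : ℕ => (n : ℝ)) =O[atTop] fun n : ℕ => ((simplePrimeDivisors g n).ncard : ℝ) := by
  rcases lt_or_gt_of_ne (leadingCoeff_ne_zero.2 hg.ne_zero) with hlc | hlc
  · have hg' : Irreducible (-g) := (Associated.refl g).neg_left.irreducible_iff.2 hg
    have hd' : (-g).natDegree = 2 ∨ (-g).natDegree = 3 := by rwa [natDegree_neg]
    have := isBigO_simplePrimeDivisors_of_card_square hg' (by omega) fun ε hε =>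
      eventually_ncard_square_le hg' hd' (by rw [leadingCoeff_neg]; omega) hε
    simpa only [simplePrimeDivisors_neg] using this
  · exact isBigO_simplePrimeDivisors_of_card_square hg (by omega) fun ε hε =>
      eventually_ncard_square_le hg hd hlc hε

end LowDegree

/-! ### Belyi polynomials and their squarefree parts. -/

section Belyi

variable {Ω : Type*} [Field Ω] [Algebra ℚ Ω]

/-- `F` maps the set `S` and all its critical points into `{0, 1}`. -/
def IsBelyiPolynomial (S : Set Ω) (F : ℚ[X]) : Prop :=
  0 < F.natDegree ∧ (∀ s ∈ S, aeval s F = 0 ∨ aeval s F = 1) ∧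
    ∀ z : Ω, aeval z (derivative F) = 0 → aeval z F = 0 ∨ aeval z F = 1

theorem IsBelyiPolynomial.comp {S T : Set Ω} {p F : ℚ[X]} (hF : IsBelyiPolynomial T F)
    (hp : 0 < p.natDegree) (hS : ∀ s ∈ S, aeval s p ∈ T)
    (hcrit : ∀ z : Ω, aeval z (derivative p) = 0 → aeval z p ∈ T) :
    IsBelyiPolynomial S (F.comp p) := by
  obtain ⟨h1, h2, h3⟩ := hF
  refine ⟨by rw [natDegree_comp]; positivity, fun s hs => ?_, fun z hz => ?_⟩
  · rw [aeval_comp]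
    exact h2 _ (hS s hs)
  · rw [aeval_comp]
    rw [derivative_comp, map_mul, aeval_comp] at hz
    rcases mul_eq_zero.1 hz with h | h
    · exact h2 _ (hcrit z h)
    · exact h3 _ h

theorem exists_belyi_of_subset_pair {S : Set Ω} {a b : ℚ} (hab : a ≠ b)
    (hS : ∀ s ∈ S, s = algebraMap ℚ Ω a ∨ s = algebraMap ℚ Ω b) :
    ∃ F, IsBelyiPolynomial S F := by
  have hba : b - a ≠ 0 := sub_ne_zero.2 hab.symm
  refine ⟨C (b - a)⁻¹ * (X - C a), ?_, fun s hs => ?_, fun z hz => ?_⟩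
  · rw [natDegree_C_mul (inv_ne_zero hba), natDegree_X_sub_C]
    exact one_pos
  · rcases hS s hs with rfl | rfl
    · left; simp
    · right
      simp only [map_mul, aeval_C, map_sub, aeval_X]
      rw [← map_sub, ← map_mul, inv_mul_cancel₀ hba, map_one]
  · simp only [derivative_mul, derivative_C, zero_mul, zero_add, derivative_sub, derivative_X,
      sub_zero, mul_one, aeval_C] at hz
    rw [map_eq_zero] at hz
    exact absurd hz (inv_ne_zero hba)

variable (Ω) in
-- Belyi's reduction: `(x - a) ^ m (c - x) ^ n` sends both extreme points of `T` to zero, so it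
-- shrinks `T`. The exponents are tuned so that its critical points lie among `a`, `c` and a third
-- point `b` of `T`, and no new critical value appears.
theorem exists_belyi_of_rat (T : Finset ℚ) :
    ∃ F, IsBelyiPolynomial (algebraMap ℚ Ω '' T) F := by
  have : CharZero Ω := algebraRat.charZero Ω
  induction hk : T.card using Nat.strong_induction_on generalizing T with
  | _ k ih =>
  subst hk
  set φ := algebraMap ℚ Ω
  rcases lt_or_ge T.card 3 with hcard | hcard
  · obtain ⟨a, b, hab, hT⟩ : ∃ a b : ℚ, a ≠ b ∧ ∀ s ∈ T, s = a ∨ s = b := by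
      rcases T.eq_empty_or_nonempty with rfl | ⟨a, ha⟩
      · exact ⟨0, 1, by norm_num, by simp⟩
      · rcases (T.erase a).eq_empty_or_nonempty with h | ⟨b, hb⟩
        · refine ⟨a, a + 1, by simp, fun s hs => ?_⟩
          by_contra hcon
          have : s ∈ T.erase a := Finset.mem_erase.2 ⟨fun h => hcon (Or.inl h), hs⟩
          rw [h] at this
          simp at this
        · refine ⟨a, b, (Finset.ne_of_mem_erase hb).symm, fun s hs => ?_⟩
          by_contra hcon
          rw [not_or] at hcon
          have h3 : ({s, a, b} : Finset ℚ) ⊆ T := by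
            intro x hx
            simp only [Finset.mem_insert, Finset.mem_singleton] at hx
            rcases hx with rfl | rfl | rfl
            exacts [hs, ha, Finset.mem_of_mem_erase hb]
          have h4 := Finset.card_le_card h3
          rw [Finset.card_eq_three.2 ⟨s, a, b, hcon.1, hcon.2,
            (Finset.ne_of_mem_erase hb).symm, rfl⟩] at h4
          omega
    refine exists_belyi_of_subset_pair hab fun s hs => ?_
    obtain ⟨t, ht, rfl⟩ := hs
    rcases hT t ht with rfl | rfl
    exacts [Or.inl rfl, Or.inr rfl]
  · have hne : T.Nonempty := Finset.card_pos.1 (by omega)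
    set a := T.min' hne
    set c := T.max' hne
    have haT : a ∈ T := T.min'_mem hne
    have hcT : c ∈ T := T.max'_mem hne
    obtain ⟨b, hbT, hba, hbc⟩ : ∃ b ∈ T, b ≠ a ∧ b ≠ c := by
      by_contra! hcon
      have h1 : T ⊆ {a, c} := by
        intro x hx
        rw [Finset.mem_insert, Finset.mem_singleton]
        by_cases hxa : x = a
        exacts [Or.inl hxa, Or.inr (hcon x hx hxa)]
      have := (Finset.card_le_card h1).trans Finset.card_le_two
      omega
    have hab : a < b := lt_of_le_of_ne (T.min'_le b hbT) hba.symm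
    have hbc : b < c := lt_of_le_of_ne (T.le_max' b hbT) hbc
    obtain ⟨m, n, hm, hn, hmn⟩ : ∃ m n : ℕ, 0 < m ∧ 0 < n ∧ (m : ℚ) * (c - b) = n * (b - a) := by
      set t := (c - b) / (b - a) with ht
      have ht0 : 0 < t := div_pos (by linarith) (by linarith)
      have hnum : 0 < t.num := Rat.num_pos.2 ht0
      refine ⟨t.den, t.num.toNat, t.den_pos, by omega, ?_⟩
      have h1 : ((t.num.toNat : ℕ) : ℚ) = t.num := by
        rw [← Int.cast_natCast, Int.toNat_of_nonneg hnum.le]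
      have h2 : c - b = t * (b - a) := by
        rw [ht, div_mul_cancel₀]
        linarith
      rw [h1, h2, ← mul_assoc, Rat.den_mul_eq_num]
    set p : ℚ[X] := (X - C a) ^ m * (C c - X) ^ n with hp
    have hCX : (C c - X : ℚ[X]) = -(X - C c) := by ring
    have hdeg : 0 < p.natDegree := by
      rw [hp, hCX, natDegree_mul (pow_ne_zero _ (X_sub_C_ne_zero a))
        (pow_ne_zero _ (neg_ne_zero.2 (X_sub_C_ne_zero c))), natDegree_pow, natDegree_X_sub_C]
      omega
    have hpe : ∀ z : Ω, aeval z p = (z - φ a) ^ m * (φ c - z) ^ n := by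
      intro z
      simp [hp, φ]
    have hpa : p.eval a = 0 := by simp [hp, hm.ne']
    have hpc : p.eval c = 0 := by simp [hp, hn.ne']
    have hpφ : ∀ x : ℚ, aeval (φ x) p = φ (p.eval x) := fun x => aeval_algebraMap_apply_eq_algebraMap_eval x p
    have hcard' : (T.image fun x => p.eval x).card < T.card := by
      have h1 : (T.image fun x => p.eval x) ⊆ (T.erase a).image fun x => p.eval x := by
        intro y hy
        obtain ⟨x, hx, rfl⟩ := Finset.mem_image.1 hy
        by_cases hxa : x = a
        · exact Finset.mem_image.2 ⟨c, Finset.mem_erase.2 ⟨by linarith [hab.trans hbc |>.ne'] , hcT⟩,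
            by rw [hxa, hpa, hpc]⟩
        · exact Finset.mem_image.2 ⟨x, Finset.mem_erase.2 ⟨hxa, hx⟩, rfl⟩
      exact ((Finset.card_le_card h1).trans Finset.card_image_le).trans_lt
        (Finset.card_erase_lt_of_mem haT)
    obtain ⟨F, hF⟩ := ih _ hcard' _ rfl
    have hmemT : ∀ x ∈ T, aeval (φ x) p ∈ φ '' (T.image fun x => p.eval x : Finset ℚ) := by
      intro x hx
      rw [hpφ]
      exact Set.mem_image_of_mem _ (Finset.mem_coe.2 (Finset.mem_image_of_mem _ hx))
    refine ⟨F.comp p, hF.comp hdeg (fun s hs => ?_) fun z hz => ?_⟩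
    · obtain ⟨x, hx, rfl⟩ := hs
      exact hmemT x hx
    · by_cases hza : z = φ a
      · rw [hza]; exact hmemT a haT
      by_cases hzc : z = φ c
      · rw [hzc]; exact hmemT c hcT
      have hd : (z - φ a) * (φ c - z) * aeval z (derivative p) =
          (z - φ a) ^ m * (φ c - z) ^ n * (m * (φ c - z) - n * (z - φ a)) := by
        obtain ⟨m, rfl⟩ := Nat.exists_eq_succ_of_ne_zero hm.ne'
        obtain ⟨n, rfl⟩ := Nat.exists_eq_succ_of_ne_zero hn.ne'
        simp only [hp, derivative_mul, derivative_pow, derivative_X, derivative_C,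
          map_add, map_mul, map_pow, map_sub, aeval_X, aeval_C, map_natCast, map_one, map_zero,
          Nat.succ_eq_add_one, Nat.add_sub_cancel, φ]
        push_cast
        ring
      rw [hz, mul_zero, eq_comm] at hd
      have h1 : (m : Ω) * (φ c - z) - n * (z - φ a) = 0 := by
        refine (mul_eq_zero.1 hd).resolve_left (mul_ne_zero ?_ ?_)
        · exact pow_ne_zero _ (sub_ne_zero.2 hza)
        · exact pow_ne_zero _ (sub_ne_zero.2 (Ne.symm hzc))
      have h2 : (m : Ω) * (φ c - φ b) = n * (φ b - φ a) := by
        have := congrArg φ hmn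
        simpa only [map_mul, map_sub, map_natCast] using this
      have h3 : ((m + n : ℕ) : Ω) * (z - φ b) = 0 := by
        push_cast
        linear_combination h2 - h1
      have h4 : z = φ b := by
        refine sub_eq_zero.1 ((mul_eq_zero.1 h3).resolve_left ?_)
        exact_mod_cast (by omega : m + n ≠ 0)
      rw [h4]
      exact hmemT b hbT

theorem natDegree_minpoly_aeval_le [Algebra.IsAlgebraic ℚ Ω] (z : Ω) (p : ℚ[X]) :
    (minpoly ℚ (aeval z p)).natDegree ≤ (minpoly ℚ z).natDegree := by
  have hint : ∀ w : Ω, IsIntegral ℚ w := fun w => (Algebra.IsAlgebraic.isAlgebraic w).isIntegral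
  rw [← IntermediateField.adjoin.finrank (hint _), ← IntermediateField.adjoin.finrank (hint _)]
  have := IntermediateField.adjoin.finiteDimensional (hint z)
  refine IntermediateField.finrank_le_of_le_right ?_
  rw [IntermediateField.adjoin_simple_le_iff]
  exact IntermediateField.algebra_adjoin_le_adjoin ℚ _ (aeval_mem_adjoin_singleton ℚ z)

/-- A weak form of Belyi's theorem, with polynomial maps. -/
theorem exists_belyi_polynomial [Algebra.IsAlgebraic ℚ Ω] (S : Finset Ω) :
    ∃ F, IsBelyiPolynomial (S : Set Ω) F := by
  classical
  have hint : ∀ w : Ω, IsIntegral ℚ w := fun w => (Algebra.IsAlgebraic.isAlgebraic w).isIntegral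
  suffices H : ∀ e : ℕ, ∀ k : ℕ, ∀ S : Finset Ω,
      (∀ z ∈ S, (minpoly ℚ z).natDegree ≤ e + 1) →
      (S.filter fun z => (minpoly ℚ z).natDegree = e + 1).card ≤ k →
      ∃ F, IsBelyiPolynomial (S : Set Ω) F by
    refine H (S.sup fun z => (minpoly ℚ z).natDegree) _ S (fun z hz => ?_) le_rfl
    exact (Finset.le_sup (f := fun z => (minpoly ℚ z).natDegree) hz).trans (Nat.le_succ _)
  intro e
  induction e with
  | zero =>
    intro _ S hS _
    obtain ⟨T, hT⟩ : ∃ T : Finset ℚ, algebraMap ℚ Ω '' T = S := by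
      have h1 : ∀ z ∈ S, ∃ x : ℚ, algebraMap ℚ Ω x = z := by
        intro z hz
        have h2 : (minpoly ℚ z).natDegree = 1 :=
          le_antisymm (hS z hz) (minpoly.natDegree_pos (hint z))
        exact minpoly.natDegree_eq_one_iff.1 h2
      choose! f hf using h1
      refine ⟨S.image f, ?_⟩
      rw [Finset.coe_image, Set.image_image]
      exact (Set.image_congr hf).trans (Set.image_id' _)
    rw [← hT]
    exact exists_belyi_of_rat Ω T
  | succ e ihe =>
    intro k
    induction k with
    | zero =>
      intro S hS hk
      refine ihe _ S (fun z hz => ?_) le_rfl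
      have h1 := Finset.filter_eq_empty_iff.1 (Finset.card_eq_zero.1 (Nat.le_zero.1 hk)) hz
      have h2 := hS z hz
      omega
    | succ k ihk =>
      intro S hS hk
      rcases (S.filter fun z => (minpoly ℚ z).natDegree = e + 1 + 1).eq_empty_or_nonempty with
        he | ⟨s, hs⟩
      · exact ihk S hS (by rw [he]; simp)
      rw [Finset.mem_filter] at hs
      -- This `p` sends `s` to zero and raises no degree over `ℚ`. Its critical values come from
      -- roots of `p'`, which have smaller degree, so the number of points of top degree falls.
      set p := minpoly ℚ s with hp
      have hp0 : p ≠ 0 := minpoly.ne_zero (hint s)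
      have hpd : derivative p ≠ 0 := fun h => by
        have := derivative_eq_zero.1 h
        omega
      set Tc := ((derivative p).aroots Ω).toFinset.image fun z => aeval z p with hTc
      set T := S.image (fun z => aeval z p) ∪ Tc with hT
      have hTc_deg : ∀ w ∈ Tc, (minpoly ℚ w).natDegree ≤ e + 1 := by
        intro w hw
        obtain ⟨z, hz, rfl⟩ := Finset.mem_image.1 hw
        rw [Multiset.mem_toFinset, mem_aroots] at hz
        refine (natDegree_minpoly_aeval_le z p).trans ?_
        refine (natDegree_le_of_dvd (minpoly.dvd ℚ z hz.2) hpd).trans ?_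
        have := natDegree_derivative_le p
        omega
      obtain ⟨F, hF⟩ : ∃ F, IsBelyiPolynomial (T : Set Ω) F := by
        refine ihk T (fun w hw => ?_) ?_
        · rcases Finset.mem_union.1 hw with hw | hw
          · obtain ⟨z, hz, rfl⟩ := Finset.mem_image.1 hw
            exact (natDegree_minpoly_aeval_le z p).trans (hS z hz)
          · exact (hTc_deg w hw).trans (Nat.le_succ _)
        · have h1 : (T.filter fun z => (minpoly ℚ z).natDegree = e + 1 + 1) ⊆
              (((S.filter fun z => (minpoly ℚ z).natDegree = e + 1 + 1).erase s).image
                fun z => aeval z p) := by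
            intro w hw
            rw [Finset.mem_filter] at hw
            obtain ⟨hw, hdeg⟩ := hw
            rcases Finset.mem_union.1 hw with hw | hw
            · obtain ⟨z, hz, rfl⟩ := Finset.mem_image.1 hw
              refine Finset.mem_image.2 ⟨z, Finset.mem_erase.2 ⟨?_, Finset.mem_filter.2 ⟨hz, ?_⟩⟩, rfl⟩
              · rintro rfl
                rw [hp, minpoly.aeval, minpoly.zero, natDegree_X] at hdeg
                omega
              · exact le_antisymm (hS z hz) (hdeg ▸ natDegree_minpoly_aeval_le z p)
            · have := hTc_deg w hw
              omega
          have h2 := (Finset.card_le_card h1).trans Finset.card_image_le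
          rw [Finset.card_erase_of_mem (Finset.mem_filter.2 hs)] at h2
          omega
      refine ⟨F.comp p, hF.comp (by omega) (fun z hz => ?_) fun z hz => ?_⟩
      · exact Finset.mem_union_left _ (Finset.mem_image_of_mem (fun z => aeval z p) hz)
      · refine Finset.mem_union_right _ (Finset.mem_image_of_mem (fun z => aeval z p) ?_)
        rw [Multiset.mem_toFinset, mem_aroots]
        exact ⟨hpd, hz⟩

theorem IsBelyiPolynomial.one_sub {S : Set Ω} {F : ℚ[X]} (hF : IsBelyiPolynomial S F) :
    IsBelyiPolynomial S (1 - F) := by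
  obtain ⟨h1, h2, h3⟩ := hF
  have key : ∀ z : Ω, aeval z F = 0 ∨ aeval z F = 1 →
      aeval z (1 - F) = 0 ∨ aeval z (1 - F) = 1 := by
    rintro z (h | h) <;> simp [h]
  refine ⟨?_, fun s hs => key s (h2 s hs), fun z hz => key z (h3 z ?_)⟩
  · rwa [natDegree_sub_eq_right_of_natDegree_lt (by simpa using h1)]
  · simpa using hz

/-- The squarefree part of `F (F - 1)` for a Belyi polynomial `F` of degree `D` has degree
`D + 1`. -/
theorem IsBelyiPolynomial.exists_squarefree_part [IsAlgClosed Ω] {S : Set Ω} {F : ℚ[X]}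
    (hF : IsBelyiPolynomial S F) :
    ∃ R : ℚ[X], R ≠ 0 ∧ R.natDegree = F.natDegree + 1 ∧ (∀ s ∈ S, aeval s R = 0) ∧
      ∃ k : ℕ, F * (F - 1) ∣ R ^ k := by
  classical
  have : CharZero Ω := algebraRat.charZero Ω
  obtain ⟨h1, h2, h3⟩ := hF
  set φ := algebraMap ℚ Ω
  have hφ : Function.Injective φ := φ.injective
  have hF0 : F ≠ 0 := by rintro rfl; simp at h1
  have hF1_deg : (F - 1).natDegree = F.natDegree :=
    natDegree_sub_eq_left_of_natDegree_lt (by simpa using h1)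
  have hF1 : F - 1 ≠ 0 := by
    intro h
    rw [h, natDegree_zero] at hF1_deg
    omega
  have hd0 : derivative F ≠ 0 := fun h => by
    have := derivative_eq_zero.1 h
    omega
  set P := F * (F - 1) with hP
  have hP0 : P ≠ 0 := mul_ne_zero hF0 hF1
  have hPdeg : P.natDegree = 2 * F.natDegree := by
    rw [hP, natDegree_mul hF0 hF1, hF1_deg]
    ring
  have hev : ∀ (z : Ω) (Q : ℚ[X]), (Q.map φ).eval z = aeval z Q := fun z Q => by
    rw [eval_map_algebraMap]
  have hne : ∀ {Q : ℚ[X]}, Q ≠ 0 → Q.map φ ≠ 0 := fun hQ => (Polynomial.map_ne_zero_iff hφ).2 hQ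
  have hmult : ∀ z : Ω, aeval z P = 0 →
      (P.map φ).rootMultiplicity z = ((derivative F).map φ).rootMultiplicity z + 1 := by
    intro z hz
    have hne' : (F.map φ) * ((F - 1).map φ) ≠ 0 := mul_ne_zero (hne hF0) (hne hF1)
    rw [hP, Polynomial.map_mul, rootMultiplicity_mul hne']
    rw [hP, map_mul] at hz
    rcases mul_eq_zero.1 hz with h | h
    · have hr : (F.map φ).IsRoot z := by rw [IsRoot.def, hev, h]
      have h4 := derivative_rootMultiplicity_of_root hr
      have h5 := (rootMultiplicity_pos (hne hF0)).2 hr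
      have h6 : ((F - 1).map φ).rootMultiplicity z = 0 := by
        refine rootMultiplicity_eq_zero ?_
        rw [IsRoot.def, hev, map_sub, h]
        simp
      rw [derivative_map] at h4
      omega
    · have hr : ((F - 1).map φ).IsRoot z := by rw [IsRoot.def, hev, h]
      have h4 := derivative_rootMultiplicity_of_root hr
      have h5 := (rootMultiplicity_pos (hne hF1)).2 hr
      have h6 : (F.map φ).rootMultiplicity z = 0 := by
        refine rootMultiplicity_eq_zero ?_
        rw [map_sub, map_one, sub_eq_zero] at h
        rw [IsRoot.def, hev, h]
        simp
      rw [derivative_map, derivative_sub, derivative_one, sub_zero] at h4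
      omega
  -- Every critical point is a root of `F (F - 1)`, with multiplicity one higher than in `F'`. The
  -- quotient `R` has degree `2 D - (D - 1) = D + 1`, where `D = deg F`.
  have hdvd : derivative F ∣ P := by
    rw [← Polynomial.map_dvd_map' φ, IsAlgClosed.dvd_iff_roots_le_roots (hne hd0) (hne hP0),
      Multiset.le_iff_count]
    intro z
    rw [count_roots, count_roots]
    by_cases hz : aeval z (derivative F) = 0
    · have hz' : aeval z P = 0 := by
        rw [hP, map_mul]
        rcases h3 z hz with h | h <;> simp [h]
      have := hmult z hz'
      omega
    · rw [rootMultiplicity_eq_zero]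
      · exact Nat.zero_le _
      · rwa [IsRoot.def, hev]
  obtain ⟨R, hR⟩ := hdvd
  have hR0 : R ≠ 0 := by
    rintro rfl
    exact hP0 (by simpa using hR)
  have hroot : ∀ z : Ω, aeval z P = 0 → aeval z R = 0 := by
    intro z hz
    have h4 := hmult z hz
    rw [hR, Polynomial.map_mul, rootMultiplicity_mul (mul_ne_zero (hne hd0) (hne hR0))] at h4
    rw [← hev]
    exact (rootMultiplicity_pos (hne hR0)).1 (by omega)
  refine ⟨R, hR0, ?_, fun s hs => hroot s ?_, P.natDegree, ?_⟩
  · have h4 := congrArg natDegree hR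
    rw [natDegree_mul hd0 hR0, hPdeg, natDegree_derivative] at h4
    omega
  · rw [hP, map_mul]
    rcases h2 s hs with h | h <;> simp [h]
  · rw [← Polynomial.map_dvd_map' φ, IsAlgClosed.dvd_iff_roots_le_roots (hne hP0)
      (hne (pow_ne_zero _ hR0)), Multiset.le_iff_count]
    intro z
    rw [Polynomial.map_pow, roots_pow, Multiset.count_nsmul]
    by_cases hz : z ∈ (P.map φ).roots
    · have h4 : aeval z P = 0 := by
        rw [← hev]
        exact (mem_roots'.1 hz).2
      have h5 : 0 < (R.map φ).roots.count z := by
        rw [Multiset.count_pos, mem_roots (hne hR0), IsRoot.def, hev]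
        exact hroot z h4
      refine le_trans (Multiset.count_le_card _ _) ((card_roots' _).trans ?_)
      rw [natDegree_map]
      exact Nat.le_mul_of_pos_right _ h5
    · rw [Multiset.count_eq_zero_of_notMem hz]
      exact Nat.zero_le _

theorem exists_pos_leadingCoeff_belyi [Algebra.IsAlgebraic ℚ Ω] (S : Finset Ω) :
    ∃ F, 0 < F.leadingCoeff ∧ IsBelyiPolynomial (S : Set Ω) F := by
  obtain ⟨F, hF⟩ := exists_belyi_polynomial S
  rcases lt_trichotomy F.leadingCoeff 0 with h | h | h
  · refine ⟨1 - F, ?_, hF.one_sub⟩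
    rw [leadingCoeff_sub_of_degree_lt']
    · linarith
    · exact degree_lt_degree (by simpa using hF.1)
  · rw [leadingCoeff_eq_zero] at h
    have := hF.1
    rw [h] at this
    simp at this
  · exact ⟨F, h, hF⟩

end Belyi

/-! ### Clearing denominators in the Belyi polynomial. -/

theorem exists_int_multiple_map (F : ℚ[X]) :
    ∃ (N : ℤ) (A : ℤ[X]), 0 < N ∧ A.map (Int.castRingHom ℚ) = C (N : ℚ) * F := by
  obtain ⟨a, ha, hA⟩ := IsLocalization.integerNormalization_spec (nonZeroDivisors ℤ) F
  have ha0 := nonZeroDivisors.ne_zero ha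
  rw [algebraMap_int_eq, zsmul_eq_mul, ← eq_intCast (C.comp (Int.castRingHom ℚ))] at hA
  rcases lt_or_gt_of_ne ha0 with h | h
  · refine ⟨-a, -IsLocalization.integerNormalization (nonZeroDivisors ℤ) F, by omega, ?_⟩
    rw [Polynomial.map_neg, hA]
    simp
  · exact ⟨a, _, h, hA⟩

/-- An integral form of the Belyi polynomial attached to the roots of `g`. -/
theorem exists_integral_belyi {g : ℤ[X]} (hg : Irreducible g) (hd : g.natDegree ≠ 0) :
    ∃ (A H Y : ℤ[X]) (N M : ℤ) (k : ℕ), 0 < N ∧ M ≠ 0 ∧ H ≠ 0 ∧ 0 < A.natDegree ∧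
      0 < A.leadingCoeff ∧ g.natDegree + H.natDegree = A.natDegree + 1 ∧
      A * (A - C N) * Y = C M * (g * H) ^ k := by
  have hprim : g.IsPrimitive := hg.isPrimitive hd
  have hirr : Irreducible (g.map (Int.castRingHom ℚ)) :=
    (IsPrimitive.Int.irreducible_iff_irreducible_map_cast hprim).1 hg
  have hinj : Function.Injective (Int.castRingHom ℚ) := Int.cast_injective
  have : Algebra.IsAlgebraic ℚ (AlgebraicClosure ℚ) := by
    convert! AlgebraicClosure.isAlgebraic ℚ
  obtain ⟨s, hs⟩ : ∃ s : AlgebraicClosure ℚ, aeval s (g.map (Int.castRingHom ℚ)) = 0 :=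
    IsAlgClosed.exists_aeval_eq_zero _ _ (degree_pos_of_irreducible hirr).ne'
  obtain ⟨F, hlc, hF⟩ := exists_pos_leadingCoeff_belyi {s}
  obtain ⟨R₀, hR₀, hR₀_deg, hR₀s, k, Z, hZ⟩ := hF.exists_squarefree_part
  obtain ⟨N, A, hN, hA⟩ := exists_int_multiple_map F
  obtain ⟨M, R, hM, hR⟩ := exists_int_multiple_map R₀
  obtain ⟨z, Z', hz, hZ'⟩ := exists_int_multiple_map Z
  have hgR : g ∣ R := by
    rw [IsPrimitive.Int.dvd_iff_map_cast_dvd_map_cast _ _ hprim, hR]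
    refine Dvd.dvd.mul_left ?_ _
    by_contra hcon
    obtain ⟨u, v, huv⟩ := (hirr.coprime_iff_not_dvd).2 hcon
    have := congrArg (aeval s) huv
    rw [map_add, map_mul, map_mul, hs, hR₀s s (by simp)] at this
    simp at this
  obtain ⟨H, hH⟩ := hgR
  have hN' : (N : ℚ) ≠ 0 := by exact_mod_cast hN.ne'
  have hM' : (M : ℚ) ≠ 0 := by exact_mod_cast hM.ne'
  have hAdeg : A.natDegree = F.natDegree := by
    rw [← natDegree_map_eq_of_injective hinj A, hA, natDegree_C_mul hN']
  have hRdeg : R.natDegree = F.natDegree + 1 := by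
    rw [← natDegree_map_eq_of_injective hinj R, hR, natDegree_C_mul hM', hR₀_deg]
  have hR0 : R ≠ 0 := by
    rintro rfl
    simp at hRdeg
  have hH0 : H ≠ 0 := by
    rintro rfl
    exact hR0 (by simpa using hH)
  refine ⟨A, H, C (M ^ k) * Z', N, N ^ 2 * z, k, hN, mul_ne_zero (pow_ne_zero _ hN.ne') hz.ne',
    hH0, hAdeg ▸ hF.1, ?_, ?_, ?_⟩
  · have h1 := leadingCoeff_map_of_injective hinj A
    rw [hA, leadingCoeff_mul, leadingCoeff_C, eq_intCast] at h1
    have : (0 : ℚ) < A.leadingCoeff := by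
      rw [← h1]
      exact mul_pos (by exact_mod_cast hN) hlc
    exact_mod_cast this
  · rw [← natDegree_mul hg.ne_zero hH0, ← hH, hRdeg, hAdeg]
  · apply map_injective (Int.castRingHom ℚ) hinj
    have e : ∀ z : ℤ, C (z : ℚ) = (z : ℚ[X]) := fun z => by simp
    rw [← hH]
    simp only [Polynomial.map_mul, Polynomial.map_sub, Polynomial.map_pow, hA, hR, hZ', e,
      eq_intCast, Polynomial.map_intCast, Int.cast_pow, Int.cast_mul, mul_pow, hZ]
    ring

/-! ### Consequences of `abc` for the radical of `g m`, and the conclusion. -/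

open UniqueFactorizationMonoid (radical)

theorem radical_le_of_prime_dvd {w W : ℕ} (hW : W ≠ 0) (h : ∀ p : ℕ, p.Prime → p ∣ w → p ∣ W) :
    radical w ≤ W := by
  refine Nat.le_of_dvd (Nat.pos_of_ne_zero hW) ((Nat.radical_dvd_iff hW).2 fun p hp => ?_)
  rw [Nat.mem_primeFactors] at hp ⊢
  exact ⟨hp.1, h p hp.1 hp.2.1, hW⟩

theorem prime_dvd_radical {p w : ℕ} (hp : p.Prime) (hw : w ≠ 0) (h : p ∣ w) : p ∣ radical w := by
  rw [Nat.radical_eq_prod_primeFactors]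
  exact Finset.dvd_prod_of_mem _ (Nat.mem_primeFactors.2 ⟨hp, h, hw⟩)

/-- The `abc` inequality for `(A m - N) + N = A m`, not assumed coprime. -/
theorem ABCConjecture.log_le (habc : ABCConjecture) {ε : ℝ} (hε : 0 < ε) :
    ∃ K : ℝ, ∀ x N W : ℕ, 0 < N → N < x → W ≠ 0 →
      (∀ p : ℕ, p.Prime → p ∣ x * (x - N) * N → p ∣ W) →
      Real.log x - Real.log N ≤ K + (1 + ε) * Real.log W := by
  obtain ⟨K, hK, h⟩ := habc ε hε
  refine ⟨Real.log K, fun x N W hN hNx hW hp => ?_⟩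
  -- Dividing out the common factor restores coprimality; as `δ ≤ N`, it costs only the `log N` on
  -- the left side.
  set δ := Nat.gcd (x - N) N
  have hδ : 0 < δ := Nat.gcd_pos_of_pos_right _ hN
  obtain ⟨a, ha⟩ : δ ∣ x - N := Nat.gcd_dvd_left _ _
  obtain ⟨b, hb⟩ : δ ∣ N := Nat.gcd_dvd_right _ _
  have hx : x = δ * (a + b) := by rw [mul_add, ← ha, ← hb]; omega
  have ha0 : 0 < a := Nat.pos_of_ne_zero fun h0 => by rw [h0, mul_zero] at ha; omega
  have hb0 : 0 < b := Nat.pos_of_ne_zero fun h0 => by rw [h0, mul_zero] at hb; omega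
  have hcop : Nat.Coprime a b := by
    have h1 : δ * Nat.gcd a b = δ * 1 := by rw [← Nat.gcd_mul_left, ← ha, ← hb, mul_one]
    exact Nat.eq_of_mul_eq_mul_left hδ h1
  have h1 := h a b (a + b) ha0 hb0 hcop rfl
  have h2 : radical (a * b * (a + b)) ≤ W := by
    refine radical_le_of_prime_dvd hW fun p hpp hpd => hp p hpp (hpd.trans ?_)
    rw [ha, hx]
    conv_rhs => rw [hb]
    exact ⟨δ ^ 3, by ring⟩
  have h3 : (0 : ℝ) < radical (a * b * (a + b)) := by exact_mod_cast Nat.radical_pos _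
  have h4 : Real.log (a + b : ℕ) ≤ Real.log K + (1 + ε) * Real.log W := by
    refine (Real.log_le_log (by positivity) h1).trans ?_
    rw [Real.log_mul hK.ne' (by positivity), Real.log_rpow h3]
    gcongr
  have hδN : δ ≤ N := Nat.le_of_dvd hN (Nat.gcd_dvd_right _ _)
  have h5 : Real.log x = Real.log δ + Real.log (a + b : ℕ) := by
    rw [← Real.log_mul (by positivity) (by positivity), hx]
    push_cast
    rfl
  have h6 : Real.log δ ≤ Real.log N := Real.log_le_log (by positivity) (by exact_mod_cast hδN)
  linarith

theorem exists_log_natAbs_eval_le_add (g : ℤ[X]) :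
    ∃ B : ℝ, 0 ≤ B ∧ ∀ m : ℕ, 1 ≤ m →
      Real.log (g.eval (m : ℤ)).natAbs ≤ g.natDegree * Real.log m + B := by
  obtain ⟨C, hC1, hC⟩ := exists_natAbs_eval_le g
  refine ⟨Real.log C, Real.log_natCast_nonneg _, fun m hm => ?_⟩
  rcases Nat.eq_zero_or_pos (g.eval (m : ℤ)).natAbs with h0 | h0
  · rw [h0, Nat.cast_zero, Real.log_zero]
    have := Real.log_natCast_nonneg m
    have := Real.log_natCast_nonneg C
    positivity
  · have h1 : ((g.eval (m : ℤ)).natAbs : ℝ) ≤ C * (m : ℝ) ^ g.natDegree := by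
      exact_mod_cast hC m m hm le_rfl
    have h2 := Real.log_le_log (by exact_mod_cast h0) h1
    rw [Real.log_mul (by positivity) (by positivity), Real.log_pow] at h2
    linarith

/-- The primes of `A (A - N) N` at `m` divide `N M rad (g m) H m`, so `abc` gives `D log m ≤ (1 +
ε)(log rad (g m) + e log m) + O(1)` with `D = deg A` and `e = deg H = D + 1 - d`. Hence the radical
keeps all but about `log m` of `log |g m|`. -/
theorem ABCConjecture.log_sub_log_radical_le (habc : ABCConjecture) {g : ℤ[X]}
    (hg : Irreducible g) (hd : 2 ≤ g.natDegree) {η : ℝ} (hη : 0 < η) :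
    ∃ B : ℝ, 0 ≤ B ∧ ∀ m : ℕ, 1 ≤ m → Real.log (g.eval (m : ℤ)).natAbs -
      Real.log (radical (g.eval (m : ℤ)).natAbs : ℕ) ≤ (1 + η) * Real.log m + B := by
  have hg0 := eval_ne_zero_of_irreducible hg hd
  obtain ⟨A, H, Y, N, M, k, hN, hM, hH, hA1, hA2, hdeg, hAY⟩ :=
    exists_integral_belyi hg (by omega)
  have hA0 : A ≠ 0 := by rintro rfl; simp at hA1
  obtain ⟨B₁, m₁, h₁⟩ := exists_log_natAbs_eval_ge_of_le hA0
  obtain ⟨_, m₂, h₂⟩ := exists_log_natAbs_eval_ge_of_le hH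
  obtain ⟨B₃, hB₃, h₃⟩ := exists_log_natAbs_eval_le_add H
  obtain ⟨B₄, hB₄, h₄⟩ := exists_log_natAbs_eval_le_add g
  obtain ⟨m₅, h₅⟩ := exists_eval_pos (g := A - C N)
    (by rwa [natDegree_sub_C])
    (by rwa [leadingCoeff_sub_of_degree_lt (degree_C_le.trans_lt (natDegree_pos_iff_degree_pos.1 hA1))])
  set D : ℝ := (A.natDegree : ℝ) with hD
  set d : ℝ := (g.natDegree : ℝ) with hdd
  set e : ℝ := (H.natDegree : ℝ) with he
  have hdeg' : d + e = D + 1 := by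
    rw [hdd, he, hD]
    exact_mod_cast hdeg
  obtain ⟨K, hK⟩ := habc.log_le (ε := η / (D + 1)) (by positivity)
  -- The factor `1 + ε` acts on a total degree `d + e = D + 1`, so the loss is exactly `η log m`.
  set ε : ℝ := η / (D + 1) with hε
  have hε0 : 0 < ε := by positivity
  have hεD : ε * (D + 1) = η := div_mul_cancel₀ _ (by positivity)
  set P := max (max m₁ m₂) m₅
  have hLN := Real.log_natCast_nonneg N.natAbs
  have hLM := Real.log_natCast_nonneg M.natAbs
  set LN := Real.log N.natAbs
  set LM := Real.log M.natAbs
  have hd0 : 0 ≤ d := by positivity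
  have hLP := Real.log_natCast_nonneg P
  refine ⟨d * Real.log P + B₄ +
    (|B₁| + LN + |K| + (1 + ε) * (LN + LM + B₃) + (1 + ε) * B₄), by positivity,
    fun m hm => ?_⟩
  have hg1 := hg0 m
  have hg2 : (g.eval (m : ℤ)).natAbs ≠ 0 := Int.natAbs_ne_zero.2 hg1
  have hr0 : 0 < radical (g.eval (m : ℤ)).natAbs := Nat.radical_pos _
  have hr1 := Real.log_natCast_nonneg (radical (g.eval (m : ℤ)).natAbs : ℕ)
  have hr2 : Real.log (radical (g.eval (m : ℤ)).natAbs : ℕ) ≤ Real.log (g.eval (m : ℤ)).natAbs :=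
    Real.log_le_log (by exact_mod_cast hr0) (by exact_mod_cast Nat.radical_le_self_iff.2 hg2)
  have hlm := Real.log_natCast_nonneg m
  have h4 := h₄ m hm
  rcases le_total m P with hmP | hmP
  · have h6 : Real.log m ≤ Real.log P :=
      Real.log_le_log (by exact_mod_cast hm) (by exact_mod_cast hmP)
    have h7 : d * Real.log m ≤ d * Real.log P := by gcongr
    have h8 : 0 ≤ (1 + η) * Real.log m := by positivity
    have h9 : 0 ≤ |B₁| + LN + |K| + (1 + ε) * (LN + LM + B₃) + (1 + ε) * B₄ := by positivity
    linarith
  · have hm1 : m₁ ≤ m := ((le_max_left _ _).trans (le_max_left _ _)).trans hmP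
    have hm2 : m₂ ≤ m := ((le_max_right _ _).trans (le_max_left _ _)).trans hmP
    have hm5 : m₅ ≤ m := (le_max_right _ _).trans hmP
    have hAm := (h₁ m hm1 hm).2
    have hHm := (h₂ m hm2 hm).1
    have h3 := h₃ m hm
    have hpos := h₅ m hm5
    have hev := congrArg (eval (m : ℤ)) hAY
    simp only [eval_sub, eval_C, eval_mul, eval_pow] at hpos hev
    set a := A.eval (m : ℤ)
    set y := g.eval (m : ℤ)
    set z := H.eval (m : ℤ)
    have hW : N.natAbs * M.natAbs * radical y.natAbs * z.natAbs ≠ 0 :=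
      mul_ne_zero (mul_ne_zero (mul_ne_zero (Int.natAbs_ne_zero.2 hN.ne')
        (Int.natAbs_ne_zero.2 hM)) hr0.ne') (Int.natAbs_ne_zero.2 hHm)
    have hx : (((a.natAbs - N.natAbs : ℕ) : ℕ) : ℤ) = a - N := by omega
    have hdvd : ∀ p : ℕ, p.Prime → p ∣ a.natAbs * (a.natAbs - N.natAbs) * N.natAbs →
        p ∣ N.natAbs * M.natAbs * radical y.natAbs * z.natAbs := by
      intro p hp hpd
      have hpI := Nat.prime_iff_prime_int.1 hp
      rcases hp.dvd_mul.1 hpd with hpd | hpd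
      · have h6 : (p : ℤ) ∣ a * (a - N) := by
          have := Int.natCast_dvd_natCast.2 hpd
          rwa [Nat.cast_mul, hx, Int.natCast_natAbs, abs_of_pos (by omega)] at this
        have h7 : (p : ℤ) ∣ M * (y * z) ^ k := hev ▸ h6.mul_right _
        rcases hpI.dvd_or_dvd h7 with h8 | h8
        · exact (((Int.natCast_dvd.1 h8).mul_left _).mul_right _).mul_right _
        · rcases hpI.dvd_or_dvd (hpI.dvd_of_dvd_pow h8) with h9 | h9
          · exact ((prime_dvd_radical hp hg2 (Int.natCast_dvd.1 h9)).mul_left _).mul_right _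
          · exact (Int.natCast_dvd.1 h9).mul_left _
      · exact ((hpd.mul_right _).mul_right _).mul_right _
    have h6 := hK a.natAbs N.natAbs _ (by omega) (by omega) hW hdvd
    have hW' : Real.log (N.natAbs * M.natAbs * radical y.natAbs * z.natAbs : ℕ) =
        LN + LM + Real.log (radical y.natAbs : ℕ) + Real.log z.natAbs := by
      have hN0 : (N.natAbs : ℝ) ≠ 0 := by exact_mod_cast Int.natAbs_ne_zero.2 hN.ne'
      have hM0 : (M.natAbs : ℝ) ≠ 0 := by exact_mod_cast Int.natAbs_ne_zero.2 hM
      have hz0 : (z.natAbs : ℝ) ≠ 0 := by exact_mod_cast Int.natAbs_ne_zero.2 hHm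
      have hr0' : ((radical y.natAbs : ℕ) : ℝ) ≠ 0 := by exact_mod_cast hr0.ne'
      rw [Nat.cast_mul, Nat.cast_mul, Nat.cast_mul, Real.log_mul (by positivity) hz0,
        Real.log_mul (by positivity) hr0', Real.log_mul hN0 hM0]
    rw [hW'] at h6
    generalize Real.log (radical y.natAbs : ℕ) = ρ at *
    generalize Real.log y.natAbs = y' at *
    generalize Real.log z.natAbs = ζ at *
    generalize Real.log m = l at *
    -- One copy of `ρ` is kept, since it is to be bounded from below; only the excess `ε ρ` is
    -- replaced by the trivial upper bound from `|g m|`.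
    have h7 : (1 + ε) * (LN + LM + ρ + ζ) ≤ (1 + ε) * (LN + LM + B₃) + (1 + ε) * (e * l) + ρ
        + ε * (d * l + B₄) := by
      have h8 : ε * ρ ≤ ε * (d * l + B₄) := by gcongr; linarith
      have h9 : (1 + ε) * ζ ≤ (1 + ε) * (e * l + B₃) := by gcongr
      linarith
    have h8 : (1 + ε) * (e * l) + ε * (d * l) - D * l + d * l = (1 + η) * l := by
      rw [← hεD]
      linear_combination (1 + ε) * l * hdeg'
    have h9 := le_abs_self B₁
    have h10 := le_abs_self K
    have h11 : 0 ≤ d * Real.log P := by positivity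
    linarith

/-- The defect `log |x| - log rad x` counts a prime of exponent `v` with weight `v - 1`, and `v ≤ 2
(v - 1)` as soon as `v ≥ 2`. -/
theorem nonsimpleWeight_le_two_mul {g : ℤ[X]} {m : ℕ} (hx : g.eval (m : ℤ) ≠ 0) (n : ℕ) :
    nonsimpleWeight g n m ≤ 2 * (Real.log (g.eval (m : ℤ)).natAbs -
      Real.log (radical (g.eval (m : ℤ)).natAbs : ℕ)) := by
  rw [log_natAbs_eq_sum hx, Nat.radical_eq_prod_primeFactors, Nat.cast_prod, Real.log_prod,
    ← Finset.sum_sub_distrib, Finset.mul_sum, nonsimpleWeight, Finset.sum_filter]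
  · refine Finset.sum_le_sum fun p hp => ?_
    have hl := Real.log_natCast_nonneg p
    rw [Nat.mem_primeFactors] at hp
    have hv : (1 : ℝ) ≤ padicValInt p (g.eval (m : ℤ)) := by
      have := (Nat.Prime.dvd_iff_one_le_factorization hp.1 hp.2.2).1 hp.2.1
      rw [Nat.factorization_def _ hp.1] at this
      exact_mod_cast this
    split_ifs with h
    · have h2 : (2 : ℝ) ≤ padicValInt p (g.eval (m : ℤ)) := by exact_mod_cast h.2
      nlinarith
    · nlinarith
  · intro p hp
    exact_mod_cast (Nat.prime_of_mem_primeFactors hp).ne_zero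

theorem ABCConjecture.isBigO_simplePrimeDivisors (habc : ABCConjecture) {g : ℤ[X]}
    (hg : Irreducible g) (hd : 4 ≤ g.natDegree) :
    (fun n : ℕ => (n : ℝ)) =O[atTop] fun n : ℕ => ((simplePrimeDivisors g n).ncard : ℝ) := by
  have hg0 := eval_ne_zero_of_irreducible hg (by omega)
  have hd' : (4 : ℝ) ≤ g.natDegree := by exact_mod_cast hd
  obtain ⟨B, hB, h⟩ := habc.log_sub_log_radical_le hg (by omega) (η := 1 / 8) (by norm_num)
  refine isBigO_simplePrimeDivisors_of_nonsimpleWeight hg (by omega) (δ := 1 / 2) (by norm_num) ?_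
  have hlog : ∀ᶠ n : ℕ in atTop, 8 * B ≤ Real.log n :=
    (Real.tendsto_log_atTop.comp tendsto_natCast_atTop_atTop).eventually_ge_atTop _
  filter_upwards [hlog] with n hn
  -- With `η = 1 / 8` the weight is at most `(9 / 4) log m + 2 B`, and `2 B ≤ (log n) / 4`. The
  -- total `5 / 2` equals `4 - 1 - 1 / 2`, which is where degree four is needed.
  have h1 : ∑ m ∈ Finset.Icc 1 n, nonsimpleWeight g n m ≤
      ∑ m ∈ Finset.Icc 1 n, (5 / 2 * Real.log n) := by
    refine Finset.sum_le_sum fun m hm => ?_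
    rw [Finset.mem_Icc] at hm
    have h2 := nonsimpleWeight_le_two_mul (hg0 m) n
    have h3 := h m hm.1
    have h4 : Real.log m ≤ Real.log n :=
      Real.log_le_log (by exact_mod_cast hm.1) (by exact_mod_cast hm.2)
    linarith
  refine h1.trans ?_
  rw [Finset.sum_const, Nat.card_Icc, nsmul_eq_mul, Nat.add_sub_cancel]
  have h5 : 0 ≤ (n : ℝ) * Real.log n := mul_nonneg n.cast_nonneg (Real.log_natCast_nonneg n)
  nlinarith

theorem mainTheorem7 :
    (ABCConjecture →
      ∀ g : ℤ[X], Irreducible g → 2 ≤ g.natDegree →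
        (fun n : ℕ => (n : ℝ)) =O[atTop] fun n : ℕ => ((simplePrimeDivisors g n).ncard : ℝ)) ∧
    (∀ g : ℤ[X], Irreducible g → (g.natDegree = 2 ∨ g.natDegree = 3) →
        (fun n : ℕ => (n : ℝ)) =O[atTop] fun n : ℕ => ((simplePrimeDivisors g n).ncard : ℝ)) := by
  refine ⟨fun habc g hg hd => ?_, fun g hg hd => isBigO_simplePrimeDivisors_of_natDegree hg hd⟩
  rcases lt_or_ge g.natDegree 4 with h | h
  · exact isBigO_simplePrimeDivisors_of_natDegree hg (by omega)
  · exact habc.isBigO_simplePrimeDivisors hg h
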